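/- **Lemma 3.4 ($C^2$ a priori estimate).** Let $2\le k<n$ be integers, and let $m>0$ and $\Lambda_1,\Lambda_2$ be real numbers. There is a constant $C$, depending only on $n,k,m,\Lambda_1,\Lambda_2$, with the following property. Let $f\in C^2(\mathbb S^n)$ satisfy $\min_{\mathbb S^n} f\ge m$, $|f|_{C^1}\le\Lambda_1$ and $|f|_{C^2}\le\Lambda_2$, where $|f|_{C^1}=\max|f|+\max|\nabla f|$ and $|f|_{C^2}=|f|_{C^1}+\max|\nabla^2 f|$. Let $\rho\in C^4(\mathbb S^n)$ be positive, and let $M=\{X(x)=\rho(x)x : x\in\mathbb S^n\}\subset\mathbb R^{n+1}$ be its radial graph, with outer unit normal $\nu$, support function $u=\langle X,\nu\rangle$ and principal curvatures $\kappa_1,\dots,\kappa_n$ with respect to $\nu$, signed so that they are positive for round spheres. Suppose that $M$ satisfies the curvature equation $$\sigma_k(\kappa_1,\dots,\kappa_n)(X)=\frac{u(X)}{|X|^{n+1}}\,f\Big(\frac{X}{|X|}\Big)\qquad\text{for all }X\in M,$$ where $\sigma_k$ is the $k$-th elementary symmetric function. Then $$\max_M \sigma_1(\kappa_1,\dots,\kappa_n)\le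 C\qquad\text{and}\qquad \max_{\mathbb S^n}|\nabla^2\rho|\le C .$$ Here $\nabla$ is the Levi-Civita connection of the standard metric of $\mathbb S^n$, and $|\nabla^2\rho|$, $|\nabla^2 f|$ are the operator norms of the Hessians. -/

import Mathlib

open Metric Submodule
open scoped Manifold ContDiff InnerProductSpace Gradient

noncomputable section

/-- The ambient Euclidean space `ℝ^{n+1}`. -/
abbrev Amb (n : ℕ) : Type := EuclideanSpace ℝ (Fin (n + 1))

/-- The standard unit sphere `𝕊ⁿ ⊂ ℝ^{n+1}`. -/
abbrev Sph (n : ℕ) : Type := sphere (0 : Amb n) 1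

/-- The tangent space `T_x 𝕊ⁿ = x^⊥`, with the round metric (the restricted inner product). -/
abbrev Tan {n : ℕ} (x : Sph n) : Submodule ℝ (Amb n) := (ℝ ∙ (x : Amb n))ᗮ

/-- The extension `y ↦ φ (y / |y|)` of a map on the sphere, homogeneous of degree `0`
(with value `0` at the origin). -/
def radialExt {n : ℕ} {F : Type*} [Zero F] (φ : Sph n → F) (y : Amb n) : F :=
  if h : y = 0 then 0
  else φ ⟨‖y‖⁻¹ • y, by
    rw [mem_sphere_zero_iff_norm, norm_smul, norm_inv, norm_norm,
      inv_mul_cancel₀ (norm_ne_zero_iff.mpr h)]⟩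

/-- The differential at `x` along the sphere of a vector valued map `φ`, as a linear map on
`T_x 𝕊ⁿ`. -/
def sphDeriv {n : ℕ} {F : Type*} [NormedAddCommGroup F] [NormedSpace ℝ F]
    (φ : Sph n → F) (x : Sph n) : Tan x →L[ℝ] F :=
  (fderiv ℝ (radialExt φ) (x : Amb n)).comp (Tan x).subtypeL

/-- The gradient `∇φ(x)` with respect to the round metric, as a vector of `ℝ^{n+1}`.
It is the Euclidean gradient of the degree `0` homogeneous extension, which is tangent to the
sphere. -/
def sphGrad {n : ℕ} (φ : Sph n → ℝ) (x : Sph n) : Amb n :=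
  ∇ (radialExt φ) (x : Amb n)

/-- The covariant Hessian `∇²φ(x)` with respect to the round metric, a bilinear form on
`T_x 𝕊ⁿ`, regarded as a bilinear form on `ℝ^{n+1}` through the orthogonal projection onto
`T_x 𝕊ⁿ` (which does not change its operator norm).  On `T_x 𝕊ⁿ` it is the Euclidean Hessian of
the degree `0` homogeneous extension: the second fundamental form of the sphere contributes the
radial derivative of the extension times the metric, and that derivative vanishes. -/
def sphHess {n : ℕ} (φ : Sph n → ℝ) (x : Sph n) : Amb n →L[ℝ] Amb n →L[ℝ] ℝ :=
  (fderiv ℝ (fderiv ℝ (radialExt φ)) (x : Amb n)).bilinearComp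
    (Tan x).starProjection (Tan x).starProjection

/-- The norm `|f|_{C¹} = max |f| + max |∇f|`. -/
def c1Norm {n : ℕ} (f : Sph n → ℝ) : ℝ := (⨆ x, |f x|) + ⨆ x, ‖sphGrad f x‖

/-- The norm `|f|_{C²} = |f|_{C¹} + max |∇²f|`. -/
def c2Norm {n : ℕ} (f : Sph n → ℝ) : ℝ := c1Norm f + ⨆ x, ‖sphHess f x‖

/-- The position vector `X(x) = ρ(x) x` of the radial graph `M` of `ρ`. -/
def radialGraph {n : ℕ} (ρ : Sph n → ℝ) (x : Sph n) : Amb n := ρ x • (x : Amb n)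

/-- The outer unit normal `ν = (ρ x - ∇ρ) / √(ρ² + |∇ρ|²)` of `M` at `X(x)`. -/
def outerNormal {n : ℕ} (ρ : Sph n → ℝ) (x : Sph n) : Amb n :=
  (√(ρ x ^ 2 + ‖sphGrad ρ x‖ ^ 2))⁻¹ • (ρ x • (x : Amb n) - sphGrad ρ x)

/-- The support function `u = ⟨X, ν⟩`. -/
def supportFn {n : ℕ} (ρ : Sph n → ℝ) (x : Sph n) : ℝ :=
  ⟪radialGraph ρ x, outerNormal ρ x⟫_ℝ

/-- The induced metric `g(v, w) = ⟨∂_v X, ∂_w X⟩` of `M`, pulled back to `T_x 𝕊ⁿ`. -/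
def firstForm {n : ℕ} (ρ : Sph n → ℝ) (x : Sph n) (v w : Tan x) : ℝ :=
  ⟪sphDeriv (radialGraph ρ) x v, sphDeriv (radialGraph ρ) x w⟫_ℝ

/-- The second fundamental form `h(v, w) = ⟨∂_v X, ∂_w ν⟩` of `M`, pulled back to `T_x 𝕊ⁿ`. -/
def secondForm {n : ℕ} (ρ : Sph n → ℝ) (x : Sph n) (v w : Tan x) : ℝ :=
  ⟪sphDeriv (radialGraph ρ) x v, sphDeriv (outerNormal ρ) x w⟫_ℝ

/-- An orthonormal basis of `T_x 𝕊ⁿ`. -/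
def tanBasis {n : ℕ} (x : Sph n) : OrthonormalBasis (Fin n) ℝ (Tan x) :=
  have : Fact (Module.finrank ℝ (Amb n) = n + 1) := ⟨finrank_euclideanSpace_fin⟩
  OrthonormalBasis.fromOrthogonalSpanSingleton n (ne_zero_of_mem_unit_sphere x)

/-- The polynomial `det (h_ij - κ g_ij)` in the variable `κ`.  A change of basis multiplies it by
a nonzero constant, so its roots do not depend on the basis. -/
def curvaturePoly {n : ℕ} (ρ : Sph n → ℝ) (x : Sph n) : Polynomial ℝ :=
  Matrix.det (Matrix.of fun i j : Fin n =>
    Polynomial.C (secondForm ρ x (tanBasis x i) (tanBasis x j)) -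
      Polynomial.X * Polynomial.C (firstForm ρ x (tanBasis x i) (tanBasis x j)))

/-- The principal curvatures `κ₁, …, κ_n` of `M` at `X(x)`: the solutions `κ` of
`det (h_ij - κ g_ij) = 0`, with multiplicity. -/
def principalCurvatures {n : ℕ} (ρ : Sph n → ℝ) (x : Sph n) : Multiset ℝ :=
  (curvaturePoly ρ x).roots

/-- `σ_k (κ₁, …, κ_n)` at `X(x)`, the `k`-th elementary symmetric function of the principal
curvatures. -/
def sigmaCurv {n : ℕ} (k : ℕ) (ρ : Sph n → ℝ) (x : Sph n) : ℝ :=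
  (principalCurvatures ρ x).esymm k

/-- The radial graph of `ρ` satisfies the curvature equation
`σ_k(κ₁, …, κ_n)(X) = u(X) / |X|^{n+1} · f(X / |X|)`; here `X / |X| = x`. -/
def SolvesCurvatureEq {n : ℕ} (k : ℕ) (f ρ : Sph n → ℝ) : Prop :=
  ∀ x : Sph n,
    sigmaCurv k ρ x = supportFn ρ x / ‖radialGraph ρ x‖ ^ (n + 1) * f x

end

/-! Write `σ_j` for the symmetric functions of the principal curvatures, `H = σ_1` and `Φ =
f/ρ^{n+1}`, so that the equation reads `σ_k = Φ u`. All bounds come from the second order test at an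
extremum of `ρ`, of `u/ρ` or of `H/u`.

At the maximum of `ρ` all curvatures are at least `1/ρ`. The set where `σ_1, …, σ_k > 0` is
therefore nonempty; it is open, and it is closed because `σ_{j+1} ≤ σ_1 σ_j` passes to its closure
while `σ_k > 0` everywhere. By connectedness it is the whole sphere
(`sigmaCurv_pos_of_sigmaCurv_pos`). Comparing the equation with round spheres at the extrema of `ρ`
bounds `ρ` on both sides, since `k < n` (`radius_le`, `le_radius`).

At a minimum of `u/ρ`, the second order conditions are summed with the positive weights `F_l =
∂σ_k/∂κ_l`, and third derivatives are removed by the differentiated equation. Up to a gradient term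
with a factor `ρu`, this leaves `(n-k)ρ² ≤ (n+k)u²`; since `k < n`, it gives `u/ρ ≥ c > 0`, a
gradient bound (`support_estimate`, `support_lower_bound`).

At a maximum of `H/u`, the equation is differentiated twice and summed over principal directions.
Concavity of `log (σ_k/σ_1)` on the Gårding cone controls `D²σ_k`; as `dH/H = du/u` there, its error
terms cancel against those of `σ_k = Φ u`. What survives is `(k-1) Φ u |A|² ≤ C(1 + H)` after
scaling, and `H² ≤ n|A|²` bounds `H` (`mean_curvature_estimate`, `mean_curvature_le`). For `k ≥ 2`,
`|A|² = H² - 2σ_2 ≤ H²` bounds every curvature, and expanding `|X|²` in two ways turns this into a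
bound for `∇²ρ` (`PrincipalFrame.norm_sphHess_le`).

The algebra rests on Newton's inequality and the Marcus–Lopes superadditivity of `σ_{j+1}/σ_j`. The
geometry is done at one point at a time: near it the hypersurface is a graph `w` over its tangent
plane, and covariant derivatives are replaced by second order Taylor expansions (`Jet`) along lines
in that plane. `PrincipalFrame` packages the outcome. -/

/-! ### Elementary symmetric functions of a finite family -/

section ElementarySymmetric

set_option linter.unusedSectionVars false

open Finset Polynomial

variable {ι : Type*} [DecidableEq ι]

/-- The `k`-th elementary symmetric function of the numbers `x i`, `i ∈ s`. -/
def esum (x : ι → ℝ) (s : Finset ι) (k : ℕ) : ℝ := ∑ t ∈ s.powersetCard k, ∏ i ∈ t, x i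

@[simp] lemma esum_zero (x : ι → ℝ) (s : Finset ι) : esum x s 0 = 1 := by simp [esum]

lemma esum_one (x : ι → ℝ) (s : Finset ι) : esum x s 1 = ∑ i ∈ s, x i := by
  simp [esum, powersetCard_one]

lemma esum_empty_succ (x : ι → ℝ) (k : ℕ) : esum x ∅ (k + 1) = 0 := by
  rw [esum, powersetCard_eq_empty.2 (by simp)]; simp

lemma esum_insert (x : ι → ℝ) {s : Finset ι} {a : ι} (ha : a ∉ s) (k : ℕ) :
    esum x (insert a s) (k + 1) = esum x s (k + 1) + x a * esum x s k := by
  unfold esum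
  rw [powersetCard_succ_insert ha, sum_union, sum_image, mul_sum]
  · congr 1
    refine sum_congr rfl fun t ht => ?_
    rw [prod_insert fun h => ha ((mem_powersetCard.1 ht).1 h)]
  · intro t ht t' ht' h
    have h1 : a ∉ t := fun h => ha ((mem_powersetCard.1 ht).1 h)
    have h2 : a ∉ t' := fun h => ha ((mem_powersetCard.1 ht').1 h)
    rw [← erase_insert h1, ← erase_insert h2, h]
  · rw [disjoint_left]
    intro t ht ht'
    obtain ⟨u, -, rfl⟩ := mem_image.1 ht'
    exact ha ((mem_powersetCard.1 ht).1 (mem_insert_self a u))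

lemma esum_erase (x : ι → ℝ) {s : Finset ι} {i : ι} (hi : i ∈ s) (k : ℕ) :
    esum x s (k + 1) = esum x (s.erase i) (k + 1) + x i * esum x (s.erase i) k := by
  rw [← esum_insert x (notMem_erase i s), insert_erase hi]

/-- Double counting of pairs of a `(k+1)`-subset and a point in it. Derivatives of `σ_k` appear in
the left form and are wanted in the right one. -/
lemma sum_powersetCard_succ_sum_erase (s : Finset ι) (k : ℕ) (G : ι → Finset ι → ℝ) :
    ∑ I ∈ s.powersetCard (k + 1), ∑ i ∈ I, G i (I.erase i) =
      ∑ i ∈ s, ∑ J ∈ (s.erase i).powersetCard k, G i J := by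
  rw [sum_sigma', sum_sigma']
  refine sum_bij' (fun p _ => ⟨p.2, p.1.erase p.2⟩) (fun p _ => ⟨insert p.1 p.2, p.1⟩) ?_ ?_ ?_ ?_ ?_
  · rintro ⟨I, i⟩ h
    simp only [mem_sigma, mem_powersetCard] at h ⊢
    refine ⟨h.1.1 h.2, erase_subset_erase _ h.1.1, ?_⟩
    rw [card_erase_of_mem h.2, h.1.2]; rfl
  · rintro ⟨i, J⟩ h
    simp only [mem_sigma, mem_powersetCard] at h ⊢
    have hi : i ∉ J := fun hh => notMem_erase i s (h.2.1 hh)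
    refine ⟨⟨insert_subset h.1 (h.2.1.trans (erase_subset _ _)), ?_⟩, mem_insert_self _ _⟩
    rw [card_insert_of_notMem hi, h.2.2]
  · rintro ⟨I, i⟩ h
    simp only [mem_sigma, mem_powersetCard] at h
    simp [insert_erase h.2]
  · rintro ⟨i, J⟩ h
    simp only [mem_sigma, mem_powersetCard] at h
    have hi : i ∉ J := fun hh => notMem_erase i s (h.2.1 hh)
    simp [erase_insert hi]
  · rintro ⟨I, i⟩ h
    rfl

/-- Euler's identity for the homogeneous polynomial `σ_{k+1}`, whose `i`-th partial derivative is
`σ_k` of the remaining variables. -/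
lemma sum_mul_esum_erase (x : ι → ℝ) (s : Finset ι) (k : ℕ) :
    ∑ i ∈ s, x i * esum x (s.erase i) k = (k + 1) * esum x s (k + 1) := by
  have h := sum_powersetCard_succ_sum_erase s k fun i J => x i * ∏ j ∈ J, x j
  simp only [esum, mul_sum]
  rw [← h]
  refine sum_congr rfl fun I hI => ?_
  rw [sum_congr rfl fun i hi => mul_prod_erase I x hi, sum_const, (mem_powersetCard.1 hI).2]
  simp

lemma coeff_prod_one_add_C_mul_X (x : ι → ℝ) (s : Finset ι) (k : ℕ) :
    (∏ i ∈ s, (1 + C (x i) * X : ℝ[X])).coeff k = esum x s k := by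
  induction s using Finset.induction_on generalizing k with
  | empty =>
    cases k with
    | zero => simp
    | succ k => simp [esum_empty_succ, coeff_one]
  | insert a s ha ih =>
    rw [prod_insert ha]
    cases k with
    | zero => simp [add_mul, ih, mul_assoc]
    | succ k =>
      rw [esum_insert x ha, add_mul, one_mul, coeff_add, ih, mul_assoc, coeff_C_mul, coeff_X_mul, ih]

/-- Rolle: passing to the derivative loses at most one real root, counted with multiplicity. -/
lemma splits_derivative {p : ℝ[X]} (hp : p.Splits) : (derivative p).Splits := by
  by_cases h0 : p.natDegree = 0
  · rw [eq_C_of_natDegree_eq_zero h0]; simp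
  rw [splits_iff_card_roots] at hp ⊢
  refine le_antisymm (card_roots' _) ?_
  have := card_roots_le_derivative p
  have := natDegree_derivative_lt h0
  omega

/-- The Laguerre inequality for real-rooted polynomials. -/
lemma Polynomial.Splits.laguerre {p : ℝ[X]} (hp : p.Splits) (t : ℝ) :
    p.eval t * (derivative (derivative p)).eval t ≤ (derivative p).eval t ^ 2 := by
  have key : ∀ m : Multiset ℝ,
      ((m.map fun a => X - C a).prod).eval t *
        (derivative (derivative (m.map fun a => X - C a).prod)).eval t ≤
        (derivative (m.map fun a => X - C a).prod).eval t ^ 2 := by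
    intro m
    induction m using Multiset.induction_on with
    | empty => simp
    | cons a m ih =>
      simp only [Multiset.map_cons, Multiset.prod_cons, derivative_mul, derivative_sub, derivative_X,
        derivative_C, sub_zero, one_mul, derivative_add, eval_add, eval_mul, eval_sub, eval_X,
        eval_C]
      nlinarith [mul_le_mul_of_nonneg_left ih (sq_nonneg (t - a)),
        sq_nonneg (((m.map fun a => X - C a).prod).eval t)]
  rw [hp.eq_prod_roots]
  have h := mul_le_mul_of_nonneg_left (key p.roots) (sq_nonneg p.leadingCoeff)
  simp only [derivative_C_mul, eval_mul, eval_C]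
  nlinarith [h]

/-- Newton's inequality. -/
theorem esum_mul_esum_le_sq (x : ι → ℝ) (s : Finset ι) (k : ℕ) :
    esum x s k * esum x s (k + 2) ≤ esum x s (k + 1) ^ 2 := by
  set p : ℝ[X] := ∏ i ∈ s, (1 + C (x i) * X) with hp
  have hs : p.Splits := by
    refine Splits.prod fun i _ => Splits.of_natDegree_le_one ?_
    refine (natDegree_add_le _ _).trans (max_le (by simp) ?_)
    exact (natDegree_mul_le.trans (by simp))
  have hd : ∀ m, (derivative^[m] p).Splits := by
    intro m
    induction m with
    | zero => simpa using hs
    | succ m ih => rw [Function.iterate_succ_apply']; exact splits_derivative ih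
  have hc : ∀ m, (derivative^[m] p).eval 0 = m.factorial * esum x s m := by
    intro m
    rw [← coeff_zero_eq_eval_zero, coeff_iterate_derivative, hp, zero_add,
      coeff_prod_one_add_C_mul_X]
    simp [Nat.descFactorial_self]
  have h := (hd k).laguerre 0
  rw [← Function.iterate_succ_apply' derivative, ← Function.iterate_succ_apply' derivative,
    hc, hc, hc, Nat.factorial_succ (k + 1), Nat.factorial_succ k] at h
  push_cast at h
  have hf : (0 : ℝ) < k.factorial := by exact_mod_cast k.factorial_pos
  have h2 : (k + 2 : ℝ) * (esum x s k * esum x s (k + 2)) ≤ (k + 1) * esum x s (k + 1) ^ 2 := by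
    have h3 : (k.factorial : ℝ) ^ 2 * (k + 1) *
        ((k + 2 : ℝ) * (esum x s k * esum x s (k + 2))) ≤
        (k.factorial : ℝ) ^ 2 * (k + 1) * ((k + 1) * esum x s (k + 1) ^ 2) := by
      nlinarith [h]
    exact le_of_mul_le_mul_left h3 (by positivity)
  -- The sharper factor `(k+1)/(k+2)` is given up here; the weaker form suffices throughout.
  by_contra hcon
  push Not at hcon
  have : (0 : ℝ) ≤ k := by positivity
  nlinarith [sq_nonneg (esum x s (k + 1))]

/-! ### The Gårding cone -/

/-- The family `x i`, `i ∈ s`, lies in the Gårding cone `Γ_k`. -/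
def InGarding (x : ι → ℝ) (s : Finset ι) (k : ℕ) : Prop := ∀ j ≤ k, 0 < esum x s j

lemma InGarding.mono {x : ι → ℝ} {s : Finset ι} {k l : ℕ} (h : InGarding x s k) (hl : l ≤ k) :
    InGarding x s l := fun j hj => h j (hj.trans hl)

lemma inGarding_zero (x : ι → ℝ) (s : Finset ι) : InGarding x s 0 := by
  intro j hj
  rw [Nat.le_zero.1 hj, esum_zero]
  exact one_pos

lemma inGarding_succ {x : ι → ℝ} {s : Finset ι} {k : ℕ} :
    InGarding x s (k + 1) ↔ InGarding x s k ∧ 0 < esum x s (k + 1) := by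
  refine ⟨fun h => ⟨h.mono (Nat.le_succ k), h _ le_rfl⟩, fun h j hj => ?_⟩
  rcases Nat.le_succ_iff.1 hj with hj | rfl
  · exact h.1 j hj
  · exact h.2

/-- With `e_j` the symmetric functions without `x i`: if `e_{k+1} ≤ 0`, Newton's inequality gives
`e_k σ_{k+2} ≤ e_{k+1} (e_{k+1} + x_i e_k) = e_{k+1} σ_{k+1} ≤ 0`, a contradiction. This yields
ellipticity: the partial derivatives of `σ_{k+1}` are positive on the cone. -/
lemma InGarding.erase {x : ι → ℝ} {s : Finset ι} {i : ι} (hi : i ∈ s) {k : ℕ}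
    (h : InGarding x s (k + 1)) : InGarding x (s.erase i) k := by
  induction k with
  | zero => exact inGarding_zero _ _
  | succ k ih =>
    have h0 := ih (h.mono (Nat.le_succ _))
    refine inGarding_succ.2 ⟨h0, ?_⟩
    by_contra hb
    push Not at hb
    have h1 := h (k + 1) (Nat.le_succ _)
    have h2 := h (k + 2) le_rfl
    rw [esum_erase x hi] at h1 h2
    have h3 := esum_mul_esum_le_sq x (s.erase i) k
    have h4 := h0 k le_rfl
    nlinarith [mul_pos h4 h2, mul_nonneg (neg_nonneg.2 hb) h1.le]

/-- By Newton's inequality the quotients `σ_{j+1}/σ_j` decrease in `j`, so each is at most the first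
one, `σ_1`. -/
lemma InGarding.esum_succ_le {x : ι → ℝ} {s : Finset ι} {k : ℕ} (h : InGarding x s k) {j : ℕ}
    (hj : j < k) : esum x s (j + 1) ≤ esum x s 1 * esum x s j := by
  induction j with
  | zero => simp
  | succ j ih =>
    have h1 := ih (by omega)
    have h2 := esum_mul_esum_le_sq x s j
    have h3 := h j (by omega)
    have h4 := h (j + 1) (by omega)
    have h5 : esum x s j * esum x s (j + 2) ≤
        esum x s j * (esum x s 1 * esum x s (j + 1)) := by nlinarith
    exact le_of_mul_le_mul_left h5 h3

lemma InGarding.esum_le_pow {x : ι → ℝ} {s : Finset ι} {k : ℕ} (h : InGarding x s k) (hk : 1 ≤ k) :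
    esum x s k ≤ esum x s 1 ^ k := by
  have key : ∀ j ≤ k, esum x s j ≤ esum x s 1 ^ j := by
    intro j
    induction j with
    | zero => simp
    | succ j ih =>
      intro hj
      refine (h.esum_succ_le hj).trans ?_
      rw [pow_succ']
      exact mul_le_mul_of_nonneg_left (ih (by omega)) (h 1 hk).le
  exact key k le_rfl

lemma esum_sq_sum (x : ι → ℝ) (s : Finset ι) :
    ∑ i ∈ s, x i ^ 2 = esum x s 1 ^ 2 - 2 * esum x s 2 := by
  induction s using Finset.induction_on with
  | empty => simp [esum_empty_succ]
  | insert a s ha ih => rw [sum_insert ha, ih, esum_insert x ha, esum_insert x ha, esum_zero]; ring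

/-- Expresses a quotient through quotients of one order less on one variable less. The denominator
is `σ_{k+1}(s)/σ_k(s \ i) > 0`, so concavity can be passed up by induction. -/
lemma quotient_recursion {x : ι → ℝ} {s : Finset ι} {k : ℕ} (h : InGarding x s (k + 1)) :
    (k + 2 : ℝ) * (esum x s (k + 2) / esum x s (k + 1)) =
      ∑ i ∈ s, (x i - x i ^ 2 / (x i + esum x (s.erase i) (k + 1) / esum x (s.erase i) k)) := by
  have h1 := h (k + 1) le_rfl
  have h2 := sum_mul_esum_erase x s (k + 1)
  push_cast at h2
  rw [mul_div_assoc', show (k + 2 : ℝ) = k + 1 + 1 by ring, ← h2, sum_div]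
  refine sum_congr rfl fun i hi => ?_
  have h3 := h.erase hi k le_rfl
  have h4 := esum_erase x hi k
  rw [h4] at h1 ⊢
  have h5 : x i + esum x (s.erase i) (k + 1) / esum x (s.erase i) k =
      (esum x (s.erase i) (k + 1) + x i * esum x (s.erase i) k) / esum x (s.erase i) k := by
    field_simp; ring
  rw [h5]
  field_simp
  ring

/-- Subadditivity of the convex, homogeneous function `a²/c` on `c > 0`. -/
lemma add_sq_div_add_le {a b c d : ℝ} (hc : 0 < c) (hd : 0 < d) :
    (a + b) ^ 2 / (c + d) ≤ a ^ 2 / c + b ^ 2 / d := by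
  rw [div_add_div _ _ hc.ne' hd.ne', div_le_div_iff₀ (by positivity) (by positivity)]
  nlinarith [mul_nonneg (mul_nonneg hc.le hd.le) (sq_nonneg (a * d - b * c)),
    sq_nonneg (a * d - b * c)]

/-- The Gårding cone is closed under addition, and the quotients `σ_{k+1}/σ_k` are superadditive
there (Marcus–Lopes). -/
theorem InGarding.add_and_quotient_le {k : ℕ} : ∀ {s : Finset ι} {x y : ι → ℝ},
    InGarding x s (k + 1) → InGarding y s (k + 1) →
      InGarding (x + y) s (k + 1) ∧
      esum x s (k + 1) / esum x s k + esum y s (k + 1) / esum y s k ≤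
        esum (x + y) s (k + 1) / esum (x + y) s k := by
  induction k with
  | zero =>
    intro s x y hx hy
    have h : esum (x + y) s 1 = esum x s 1 + esum y s 1 := by simp [esum_one, sum_add_distrib]
    refine ⟨inGarding_succ.2 ⟨inGarding_zero _ _, ?_⟩, ?_⟩
    · rw [zero_add, h]
      exact add_pos (hx 1 le_rfl) (hy 1 le_rfl)
    · simp [h]
  | succ k ih =>
    intro s x y hx hy
    have hx' := hx.mono (Nat.le_succ _)
    have hy' := hy.mono (Nat.le_succ _)
    have hxy := (ih hx' hy').1
    have hq : esum x s (k + 2) / esum x s (k + 1) + esum y s (k + 2) / esum y s (k + 1) ≤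
        esum (x + y) s (k + 2) / esum (x + y) s (k + 1) := by
      have h0 : (0 : ℝ) < k + 2 := by positivity
      refine le_of_mul_le_mul_left ?_ h0
      rw [mul_add, quotient_recursion hx', quotient_recursion hy', quotient_recursion hxy,
        ← sum_add_distrib]
      refine sum_le_sum fun i hi => ?_
      have hpos : ∀ z : ι → ℝ, InGarding z s (k + 1) →
          0 < z i + esum z (s.erase i) (k + 1) / esum z (s.erase i) k := by
        intro z hz
        have h1 := hz (k + 1) le_rfl
        have h3 := hz.erase hi k le_rfl
        rw [esum_erase z hi k] at h1
        have h5 : z i + esum z (s.erase i) (k + 1) / esum z (s.erase i) k =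
            (esum z (s.erase i) (k + 1) + z i * esum z (s.erase i) k) / esum z (s.erase i) k := by
          field_simp; ring
        rw [h5]; positivity
      -- Superadditivity for the erased families enlarges the denominator, and subadditivity of
      -- `a²/c` then splits the fraction.
      have hle := (ih (hx.erase hi) (hy.erase hi)).2
      have h1 := hpos x hx'
      have h2 := hpos y hy'
      have h3 : (x i + y i) ^ 2 /
          ((x + y) i + esum (x + y) (s.erase i) (k + 1) / esum (x + y) (s.erase i) k) ≤
          (x i + y i) ^ 2 / ((x i + esum x (s.erase i) (k + 1) / esum x (s.erase i) k) +
            (y i + esum y (s.erase i) (k + 1) / esum y (s.erase i) k)) := by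
        refine div_le_div_of_nonneg_left (sq_nonneg _) (add_pos h1 h2) ?_
        rw [Pi.add_apply]; linarith
      have h4 := h3.trans (add_sq_div_add_le (a := x i) (b := y i) h1 h2)
      rw [Pi.add_apply] at h4 ⊢
      linarith
    refine ⟨inGarding_succ.2 ⟨hxy, ?_⟩, hq⟩
    have h1 : 0 < esum (x + y) s (k + 2) / esum (x + y) s (k + 1) :=
      lt_of_lt_of_le (add_pos (div_pos (hx _ le_rfl) (hx' _ le_rfl))
        (div_pos (hy _ le_rfl) (hy' _ le_rfl))) hq
    exact (div_pos_iff_of_pos_right (hxy _ le_rfl)).1 h1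

lemma esum_smul (c : ℝ) (x : ι → ℝ) (s : Finset ι) (k : ℕ) :
    esum (c • x) s k = c ^ k * esum x s k := by
  unfold esum
  rw [mul_sum]
  refine sum_congr rfl fun t ht => ?_
  simp [prod_mul_distrib, (mem_powersetCard.1 ht).2]

/-- Midpoint log-concavity of `σ_{k+1}/σ_1` on `Γ_{k+1}`. -/
lemma InGarding.midpoint_log_concave {k : ℕ} {s : Finset ι} {x y z : ι → ℝ}
    (hx : InGarding x s (k + 1)) (hy : InGarding y s (k + 1)) (hz : InGarding z s (k + 1))
    (hxyz : x + y = (2 : ℝ) • z) :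
    (esum x s (k + 1) / esum x s 1) * (esum y s (k + 1) / esum y s 1) ≤
      (esum z s (k + 1) / esum z s 1) ^ 2 := by
  induction k with
  | zero =>
    have h1 := hx 1 le_rfl
    have h2 := hy 1 le_rfl
    have h3 := hz 1 le_rfl
    simp only [zero_add]
    rw [div_self h1.ne', div_self h2.ne', div_self h3.ne']
    norm_num
  | succ k ih =>
    have ih := ih (hx.mono (Nat.le_succ _)) (hy.mono (Nat.le_succ _)) (hz.mono (Nat.le_succ _))
    have hq := (hx.add_and_quotient_le hy).2
    have hp : ∀ w : ι → ℝ, InGarding w s (k + 1 + 1) → 0 < esum w s (k + 1) ∧ 0 < esum w s 1 ∧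
        0 < esum w s (k + 2) := fun w hw => ⟨hw _ (by omega), hw _ (by omega), hw _ (by omega)⟩
    obtain ⟨x1, x2, x3⟩ := hp x hx
    obtain ⟨y1, y2, y3⟩ := hp y hy
    obtain ⟨z1, z2, z3⟩ := hp z hz
    rw [hxyz, esum_smul, esum_smul, pow_succ' 2 (k + 1), mul_assoc, mul_div_assoc,
      mul_div_mul_left _ _ (by positivity)] at hq
    -- The quotient `σ_{k+2}/σ_1` telescopes into `σ_{j+1}/σ_j`, each superadditive and of degree
    -- one, hence concave; a product of positive concave functions is log-concave.
    have e : ∀ w : ι → ℝ, 0 < esum w s (k + 1) →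
        esum w s (k + 1 + 1) / esum w s 1 = (esum w s (k + 2) / esum w s (k + 1)) *
          (esum w s (k + 1) / esum w s 1) := by
      intro w hw; field_simp
    rw [e x x1, e y y1, e z z1]
    have h1 : (esum x s (k + 2) / esum x s (k + 1)) * (esum y s (k + 2) / esum y s (k + 1)) ≤
        (esum z s (k + 2) / esum z s (k + 1)) ^ 2 := by
      have := div_pos x3 x1
      have := div_pos y3 y1
      nlinarith [sq_nonneg (esum x s (k + 2) / esum x s (k + 1) -
        esum y s (k + 2) / esum y s (k + 1))]
    have h2 : 0 ≤ (esum x s (k + 1) / esum x s 1) * (esum y s (k + 1) / esum y s 1) := by positivity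
    calc _ = ((esum x s (k + 2) / esum x s (k + 1)) * (esum y s (k + 2) / esum y s (k + 1))) *
          ((esum x s (k + 1) / esum x s 1) * (esum y s (k + 1) / esum y s 1)) := by ring
      _ ≤ (esum z s (k + 2) / esum z s (k + 1)) ^ 2 * (esum z s (k + 1) / esum z s 1) ^ 2 :=
          mul_le_mul h1 ih h2 (sq_nonneg _)
      _ = _ := by ring

end ElementarySymmetric

/-! ### Second order expansions of functions of one real variable -/

section Jets

open Filter Topology Asymptotics

/-- `f t = a + b t + c t² / 2 + o(t²)` as `t → 0`. -/
def Jet (f : ℝ → ℝ) (a b c : ℝ) : Prop :=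
  (fun t => f t - (a + b * t + c / 2 * t ^ 2)) =o[𝓝 0] fun t => t ^ 2

variable {f g : ℝ → ℝ} {a b c a' b' c' : ℝ}

lemma Jet.congr (h : Jet f a b c) (hfg : ∀ᶠ t in 𝓝 0, f t = g t) : Jet g a b c :=
  IsLittleO.congr' h (hfg.mono fun t ht => by simp only [ht]) EventuallyEq.rfl

lemma Jet.cast (h : Jet f a b c) (ha : a = a') (hb : b = b') (hc : c = c') : Jet f a' b' c' := by
  subst ha hb hc; exact h

lemma jet_quadratic (a b c : ℝ) : Jet (fun t => a + b * t + c / 2 * t ^ 2) a b c := by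
  simp [Jet]

lemma jet_const (a : ℝ) : Jet (fun _ => a) a 0 0 := by simp [Jet]

lemma jet_id : Jet (fun t => t) 0 1 0 := by simp [Jet]

lemma Jet.add (hf : Jet f a b c) (hg : Jet g a' b' c') :
    Jet (fun t => f t + g t) (a + a') (b + b') (c + c') := by
  refine (IsLittleO.add hf hg).congr_left fun t => ?_
  ring

lemma Jet.const_mul (r : ℝ) (hf : Jet f a b c) : Jet (fun t => r * f t) (r * a) (r * b) (r * c) := by
  refine (IsLittleO.const_mul_left hf r).congr_left fun t => ?_
  ring

lemma Jet.neg (hf : Jet f a b c) : Jet (fun t => - f t) (-a) (-b) (-c) := by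
  refine (IsLittleO.neg_left hf).congr_left fun t => ?_
  ring

lemma Jet.sub (hf : Jet f a b c) (hg : Jet g a' b' c') :
    Jet (fun t => f t - g t) (a - a') (b - b') (c - c') := by
  simpa [sub_eq_add_neg] using hf.add hg.neg

lemma Jet.sum {ι : Type*} {s : Finset ι} {f : ι → ℝ → ℝ} {a b c : ι → ℝ}
    (h : ∀ i ∈ s, Jet (f i) (a i) (b i) (c i)) :
    Jet (fun t => ∑ i ∈ s, f i t) (∑ i ∈ s, a i) (∑ i ∈ s, b i) (∑ i ∈ s, c i) := by
  classical
  induction s using Finset.induction_on with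
  | empty => simpa using jet_const 0
  | insert i s hi ih =>
    simp only [Finset.sum_insert hi]
    exact (h i (Finset.mem_insert_self i s)).add
      (ih fun j hj => h j (Finset.mem_insert_of_mem hj))

lemma isLittleO_of_tendsto_mul_sq {h : ℝ → ℝ} (hh : Tendsto h (𝓝 0) (𝓝 0)) :
    (fun t => h t * t ^ 2) =o[𝓝 0] fun t : ℝ => t ^ 2 := by
  simpa using ((isLittleO_one_iff ℝ).2 hh).mul_isBigO (isBigO_refl (fun t : ℝ => t ^ 2) (𝓝 0))

lemma Jet.tendsto (hf : Jet f a b c) : Tendsto f (𝓝 0) (𝓝 a) := by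
  have h1 : Tendsto (fun t : ℝ => t ^ 2) (𝓝 0) (𝓝 0) := by
    have : Continuous fun t : ℝ => t ^ 2 := by fun_prop
    simpa using this.tendsto 0
  have h2 := IsLittleO.trans_tendsto hf h1
  have h3 : Tendsto (fun t : ℝ => a + b * t + c / 2 * t ^ 2) (𝓝 0) (𝓝 a) := by
    have : Continuous fun t : ℝ => a + b * t + c / 2 * t ^ 2 := by fun_prop
    simpa using this.tendsto 0
  simpa using h2.add h3

lemma Jet.mul (hf : Jet f a b c) (hg : Jet g a' b' c') :
    Jet (fun t => f t * g t) (a * a') (a * b' + b * a') (a * c' + 2 * (b * b') + c * a') := by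
  have h1 : (fun t => f t * (g t - (a' + b' * t + c' / 2 * t ^ 2))) =o[𝓝 0] fun t : ℝ => t ^ 2 := by
    simpa using (hf.tendsto.isBigO_one ℝ).mul_isLittleO hg
  have h2 : (fun t => (a' + b' * t + c' / 2 * t ^ 2) * (f t - (a + b * t + c / 2 * t ^ 2)))
      =o[𝓝 0] fun t : ℝ => t ^ 2 := by
    simpa using ((jet_quadratic a' b' c').tendsto.isBigO_one ℝ).mul_isLittleO hf
  have h3 := isLittleO_of_tendsto_mul_sq
    (h := fun t => (b * c' / 2 + c * b' / 2) * t + c * c' / 4 * t ^ 2) (by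
      have : Continuous fun t : ℝ => (b * c' / 2 + c * b' / 2) * t + c * c' / 4 * t ^ 2 := by
        fun_prop
      simpa using this.tendsto 0)
  refine ((h1.add h2).add h3).congr_left fun t => ?_
  ring

/-- The form in which every maximum principle below is applied: a function with value `0` and local
maximum at `0`. -/
lemma Jet.zero_of_eventually_nonpos (hf : Jet f 0 b c) (h : ∀ᶠ t in 𝓝 0, f t ≤ 0) :
    b = 0 ∧ c ≤ 0 := by
  have hb : b = 0 := by
    have h1 : HasDerivAt f b 0 := by
      -- The filter is the full neighbourhood filter, not the punctured one, so the limit is also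
      -- the value at `0`.
      have h0 : f 0 = 0 := tendsto_nhds_unique (tendsto_pure_nhds f 0) (hf.tendsto.mono_left (pure_le_nhds 0))
      rw [hasDerivAt_iff_isLittleO]
      have h2 : (fun t : ℝ => t ^ 2) =o[𝓝 0] fun t : ℝ => t := by
        simpa [pow_two] using
          (IsLittleO.mul_isBigO ((isLittleO_one_iff ℝ).2 (tendsto_id (α := ℝ) (x := 𝓝 0)))
            (isBigO_refl (fun t : ℝ => t) (𝓝 0)))
      have h3 := (IsLittleO.trans hf h2).add (h2.const_mul_left (c / 2))
      refine h3.congr (fun t => ?_) (fun t => ?_)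
      · simp only [h0, smul_eq_mul]; ring
      · ring
    have h2 : IsLocalMax f 0 := by
      have h0 : f 0 = 0 := tendsto_nhds_unique (tendsto_pure_nhds f 0) (hf.tendsto.mono_left (pure_le_nhds 0))
      filter_upwards [h] with t ht
      rwa [h0]
    exact h2.hasDerivAt_eq_zero h1
  refine ⟨hb, ?_⟩
  subst hb
  by_contra hc
  push Not at hc
  have h1 := hf.def (show 0 < c / 4 by linarith)
  have h2 : ∀ᶠ t in 𝓝[≠] (0 : ℝ), False := by
    filter_upwards [h.filter_mono nhdsWithin_le_nhds, h1.filter_mono nhdsWithin_le_nhds,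
      self_mem_nhdsWithin] with t ht1 ht2 ht3
    have ht : 0 < t ^ 2 := by have : t ≠ 0 := ht3; positivity
    rw [Real.norm_eq_abs, Real.norm_eq_abs, abs_of_pos ht, abs_le] at ht2
    nlinarith [ht2.1]
  exact (NeBot.ne (f := 𝓝[≠] (0 : ℝ)) inferInstance) (by simpa using h2)

/-- Lets two computations of the expansion of one function be compared; this is how the curvature
equation is differentiated. -/
lemma Jet.unique (hf : Jet f a b c) (hf' : Jet f a' b' c') : a = a' ∧ b = b' ∧ c = c' := by
  have ha := tendsto_nhds_unique hf.tendsto hf'.tendsto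
  subst ha
  have h := (hf.sub hf').cast (sub_self a) rfl rfl
  have h1 := h.zero_of_eventually_nonpos (by simp)
  have h2 := (h.neg.cast neg_zero rfl rfl).zero_of_eventually_nonpos (by simp)
  exact ⟨rfl, by linarith [h1.1], by linarith [h1.2, h2.2]⟩

/-- Subtract the quadratic polynomial: what is left has derivative at most `ε|t|` between `0` and
`t`, and the mean value inequality applies. Second differentiability is needed at `0` only. -/
lemma jet_of_hasDerivAt {f' : ℝ → ℝ} (hf : ∀ᶠ t in 𝓝 0, HasDerivAt f (f' t) t)
    (hf' : HasDerivAt f' c 0) : Jet f (f 0) (f' 0) c := by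
  rw [hasDerivAt_iff_isLittleO] at hf'
  refine IsLittleO.of_bound fun ε hε => ?_
  obtain ⟨δ, hδ, h⟩ := Metric.eventually_nhds_iff_ball.1 (hf.and (hf'.def hε))
  filter_upwards [Metric.ball_mem_nhds (0 : ℝ) hδ] with t ht
  have hsub : Set.uIcc 0 t ⊆ Metric.ball (0 : ℝ) δ := by
    have h0 : (0 : ℝ) ∈ Metric.ball (0 : ℝ) δ := Metric.mem_ball_self hδ
    exact (convex_ball (0 : ℝ) δ).ordConnected.uIcc_subset h0 ht
  have hmv := (convex_uIcc (0 : ℝ) t).norm_image_sub_le_of_norm_hasDerivWithin_le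
    (f := fun s => f s - (f 0 + f' 0 * s + c / 2 * s ^ 2))
    (f' := fun s => f' s - (f' 0 + c * s)) (C := ε * |t|) (x := 0) (y := t)
    (fun s hs => by
      have h1 := (h s (hsub hs)).1
      have h2 : HasDerivAt (fun s => f 0 + f' 0 * s + c / 2 * s ^ 2) (f' 0 + c * s) s := by
        have := (((hasDerivAt_id s).const_mul (f' 0)).const_add (f 0)).add
          (((hasDerivAt_id s).pow 2).const_mul (c / 2))
        refine (this.congr_deriv ?_).congr_of_eventuallyEq ?_
        · simp; ring
        · filter_upwards with r
          simp
      exact (h1.sub h2).hasDerivWithinAt)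
    (fun s hs => by
      have h1 := (h s (hsub hs)).2
      simp only [sub_zero, smul_eq_mul, Real.norm_eq_abs] at h1 ⊢
      have h2 : f' s - (f' 0 + c * s) = f' s - f' 0 - s * c := by ring
      rw [h2]
      refine h1.trans (mul_le_mul_of_nonneg_left ?_ hε.le)
      rcases Set.mem_uIcc.1 hs with hs | hs
      · rw [abs_of_nonneg hs.1, abs_of_nonneg (hs.1.trans hs.2)]; exact hs.2
      · rw [abs_of_nonpos hs.2, abs_of_nonpos (hs.1.trans hs.2)]; linarith [hs.1])
    Set.left_mem_uIcc Set.right_mem_uIcc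
  simp only [mul_zero, add_zero, ne_eq, OfNat.ofNat_ne_zero, not_false_eq_true, zero_pow, sub_self,
    sub_zero, Real.norm_eq_abs] at hmv ⊢
  refine hmv.trans (le_of_eq ?_)
  rw [abs_pow, pow_two]; ring

lemma Jet.isBigO_id (hf : Jet f 0 b c) : f =O[𝓝 0] fun t : ℝ => t := by
  have h1 : (fun t : ℝ => t ^ 2) =O[𝓝 0] fun t : ℝ => t := by
    simpa [pow_two] using (IsBigO.mul (((isLittleO_one_iff ℝ).2
      (tendsto_id (α := ℝ) (x := 𝓝 0))).isBigO) (isBigO_refl (fun t : ℝ => t) (𝓝 0)))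
  have h2 : (fun t : ℝ => b * t + c / 2 * t ^ 2) =O[𝓝 0] fun t : ℝ => t :=
    ((isBigO_refl _ _).const_mul_left b).add (h1.const_mul_left _)
  refine ((IsLittleO.isBigO hf).trans h1 |>.add h2).congr_left fun t => ?_
  ring

/-- The first factor is already quadratic in `t`, so the second one need only have a limit. -/
lemma Jet.mul_tendsto {q : ℝ} (hf : Jet f 0 0 c) (hg : Tendsto g (𝓝 0) (𝓝 q)) :
    Jet (fun t => f t * g t) 0 0 (c * q) := by
  have h1 : (fun t => (f t - (0 + 0 * t + c / 2 * t ^ 2)) * g t) =o[𝓝 0] fun t : ℝ => t ^ 2 := by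
    simpa using IsLittleO.mul_isBigO hf (hg.isBigO_one ℝ)
  have h2 := isLittleO_of_tendsto_mul_sq (h := fun t => c / 2 * (g t - q)) (by
    simpa using (hg.sub_const q).const_mul (c / 2))
  refine (h1.add h2).congr_left fun t => ?_
  ring

/-- Second order chain rule. -/
lemma Jet.comp {φ : ℝ → ℝ} {A B C : ℝ} (hφ : Jet (fun s => φ (a + s)) A B C) (hf : Jet f a b c) :
    Jet (fun t => φ (f t)) A (B * b) (B * c + C * b ^ 2) := by
  have hs : Jet (fun t => f t - a) 0 b c := by simpa using hf.sub (jet_const a)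
  have h1 : (fun t => φ (a + (f t - a)) - (A + B * (f t - a) + C / 2 * (f t - a) ^ 2)) =o[𝓝 0]
      fun t : ℝ => t ^ 2 :=
    (IsLittleO.comp_tendsto hφ hs.tendsto).trans_isBigO (hs.isBigO_id.pow 2)
  have h2 := ((jet_const A).add (hs.const_mul B)).add ((hs.mul hs).const_mul (C / 2))
  refine (h1.add h2).congr_left fun t => ?_
  simp only [add_sub_cancel]
  ring

lemma Jet.comp_of_hasDerivAt {φ φ' : ℝ → ℝ} {C : ℝ} (hφ : ∀ᶠ s in 𝓝 a, HasDerivAt φ (φ' s) s)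
    (hφ' : HasDerivAt φ' C a) (hf : Jet f a b c) :
    Jet (fun t => φ (f t)) (φ a) (φ' a * b) (φ' a * c + C * b ^ 2) := by
  have ht : Tendsto (fun s : ℝ => a + s) (𝓝 0) (𝓝 a) := by
    have : Continuous fun s : ℝ => a + s := by fun_prop
    simpa using this.tendsto 0
  have := jet_of_hasDerivAt (f := fun s => φ (a + s)) (f' := fun s => φ' (a + s)) (c := C)
    ((ht.eventually hφ).mono fun s hs => by
      simpa using hs.comp_const_add a s)
    (by simpa using HasDerivAt.comp_const_add a 0 (by simpa using hφ'))
  simpa using this.comp hf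

end Jets

/-! ### Expansions of elementary symmetric functions -/

section JetsSymmetric

set_option linter.unusedSectionVars false

open Filter Topology Asymptotics Finset

variable {ι : Type*} [DecidableEq ι]

lemma jet_prod {s : Finset ι} {x : ι → ℝ → ℝ} {κ η θ : ι → ℝ}
    (h : ∀ i ∈ s, Jet (x i) (κ i) (η i) (θ i)) :
    Jet (fun t => ∏ i ∈ s, x i t) (∏ i ∈ s, κ i) (∑ i ∈ s, η i * ∏ j ∈ s.erase i, κ j)
      (∑ i ∈ s, (θ i * ∏ j ∈ s.erase i, κ j +
        ∑ j ∈ s.erase i, η i * η j * ∏ l ∈ (s.erase i).erase j, κ l)) := by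
  induction s using Finset.induction_on with
  | empty => simpa using jet_const 1
  | insert a s ha ih =>
    have ih := ih fun j hj => h j (mem_insert_of_mem hj)
    simp only [prod_insert ha]
    have hne : ∀ i ∈ s, a ≠ i := fun i hi e => ha (e ▸ hi)
    have e1 : ∀ i ∈ s, ∏ j ∈ (insert a s).erase i, κ j = κ a * ∏ j ∈ s.erase i, κ j := by
      intro i hi
      rw [erase_insert_of_ne (hne i hi), prod_insert fun h => ha (mem_of_mem_erase h)]
    have e2 : ∀ i ∈ s, ∑ j ∈ (insert a s).erase i,
        η i * η j * ∏ l ∈ ((insert a s).erase i).erase j, κ l =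
        η a * (η i * ∏ j ∈ s.erase i, κ j) +
          κ a * ∑ j ∈ s.erase i, η i * η j * ∏ l ∈ (s.erase i).erase j, κ l := by
      intro i hi
      have ha' : a ∉ s.erase i := fun h => ha (mem_of_mem_erase h)
      rw [erase_insert_of_ne (hne i hi), sum_insert ha', erase_insert ha', mul_sum]
      congr 1
      · ring
      refine sum_congr rfl fun j hj => ?_
      rw [erase_insert_of_ne (ne_of_mem_of_not_mem hj ha').symm,
        prod_insert fun h => ha' (mem_of_mem_erase h)]
      ring
    refine ((h a (mem_insert_self a s)).mul ih).cast rfl ?_ ?_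
    · rw [sum_insert ha, erase_insert ha, add_comm, mul_sum]
      congr 1
      refine sum_congr rfl fun i hi => ?_
      rw [e1 i hi]; ring
    · rw [sum_insert ha, erase_insert ha]
      have e3 : ∑ i ∈ s, (θ i * ∏ j ∈ (insert a s).erase i, κ j + ∑ j ∈ (insert a s).erase i,
          η i * η j * ∏ l ∈ ((insert a s).erase i).erase j, κ l) =
          κ a * ∑ i ∈ s, (θ i * ∏ j ∈ s.erase i, κ j +
            ∑ j ∈ s.erase i, η i * η j * ∏ l ∈ (s.erase i).erase j, κ l) +
          η a * ∑ i ∈ s, η i * ∏ j ∈ s.erase i, κ j := by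
        rw [mul_sum, mul_sum, ← sum_add_distrib]
        refine sum_congr rfl fun i hi => ?_
        rw [e1 i hi, e2 i hi]; ring
      have e4 : ∑ j ∈ s, η a * η j * ∏ l ∈ s.erase j, κ l =
          η a * ∑ i ∈ s, η i * ∏ j ∈ s.erase i, κ j := by
        rw [mul_sum]
        refine sum_congr rfl fun i _ => ?_
        ring
      rw [e3, e4]
      ring

/-- Second variation of `σ_{k+2}` at `κ`. -/
def esumHess (κ : ι → ℝ) (s : Finset ι) (k : ℕ) (η : ι → ℝ) : ℝ :=
  ∑ i ∈ s, ∑ j ∈ s.erase i, η i * η j * esum κ ((s.erase i).erase j) k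

lemma jet_esum {s : Finset ι} {x : ι → ℝ → ℝ} {κ η θ : ι → ℝ} (k : ℕ)
    (h : ∀ i ∈ s, Jet (x i) (κ i) (η i) (θ i)) :
    Jet (fun t => esum (fun i => x i t) s (k + 2)) (esum κ s (k + 2))
      (∑ i ∈ s, η i * esum κ (s.erase i) (k + 1))
      (∑ i ∈ s, θ i * esum κ (s.erase i) (k + 1) + esumHess κ s k η) := by
  have := Jet.sum (s := s.powersetCard (k + 2)) fun I hI =>
    jet_prod fun i hi => h i ((mem_powersetCard.1 hI).1 hi)
  refine this.cast rfl ?_ ?_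
  · rw [sum_powersetCard_succ_sum_erase s (k + 1) fun i J => η i * ∏ j ∈ J, κ j]
    simp only [esum, mul_sum]
  · rw [sum_powersetCard_succ_sum_erase s (k + 1) fun i J => θ i * ∏ j ∈ J, κ j +
      ∑ j ∈ J, η i * η j * ∏ l ∈ J.erase j, κ l]
    simp only [esumHess, esum, mul_sum, sum_add_distrib]
    congr 1
    refine sum_congr rfl fun i hi => ?_
    rw [sum_powersetCard_succ_sum_erase (s.erase i) k fun j L => η i * η j * ∏ l ∈ L, κ l]

lemma continuous_esum (s : Finset ι) (k : ℕ) : Continuous fun x : ι → ℝ => esum x s k := by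
  unfold esum
  fun_prop

lemma InGarding.eventually {κ : ι → ℝ} {s : Finset ι} {k : ℕ} (h : InGarding κ s k)
    {x : ℝ → ι → ℝ} (hx : Tendsto x (𝓝 0) (𝓝 κ)) : ∀ᶠ t in 𝓝 0, InGarding (x t) s k := by
  have : ∀ j ∈ range (k + 1), ∀ᶠ t in 𝓝 0, 0 < esum (x t) s j := by
    intro j hj
    exact (((continuous_esum s j).tendsto κ).comp hx).eventually_const_lt
      (h j (Nat.lt_succ_iff.1 (mem_range.1 hj)))
  filter_upwards [(Filter.eventually_all_finset _).2 this] with t ht j hj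
  exact ht j (mem_range.2 (Nat.lt_succ_iff.2 hj))

/-- Log-concavity of `σ_{k+2}/σ_1` on `Γ_{k+2}`, in infinitesimal form. -/
theorem InGarding.esumHess_le {κ : ι → ℝ} {s : Finset ι} {k : ℕ} (h : InGarding κ s (k + 2))
    (η : ι → ℝ) :
    esumHess κ s k η * esum κ s (k + 2) * esum κ s 1 ^ 2 ≤
      (∑ i ∈ s, η i * esum κ (s.erase i) (k + 1)) ^ 2 * esum κ s 1 ^ 2 -
        esum κ s (k + 2) ^ 2 * (∑ i ∈ s, η i) ^ 2 := by
  have hlin : ∀ r : ℝ, ∀ i, Jet (fun t => κ i + r * η i * t) (κ i) (r * η i) 0 := by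
    intro r i
    simpa using (jet_const (κ i)).add (jet_id.const_mul (r * η i))
  have hE : ∀ r : ℝ, _ := fun r => jet_esum (s := s) k fun i _ => hlin r i
  have hA : ∀ r : ℝ, Jet (fun t => esum (fun i => κ i + r * η i * t) s 1) (esum κ s 1)
      (∑ i ∈ s, r * η i) 0 := by
    intro r
    simpa [esum_one] using Jet.sum (s := s) fun i _ => hlin r i
  have hc : ∀ r : ℝ, Tendsto (fun t i => κ i + r * η i * t) (𝓝 0) (𝓝 κ) := by
    intro r
    have : Continuous fun (t : ℝ) i => κ i + r * η i * t := by fun_prop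
    simpa using this.tendsto 0
  set A := esum κ s 1
  set E := esum κ s (k + 2)
  -- Log-concavity at the midpoint of `κ + tη` and `κ - tη`, cleared of denominators, says that this
  -- function of `t` is nonpositive. It vanishes at `0`, so its second order coefficient is
  -- nonpositive.
  have hJ := (((hE 1).mul (hE (-1))).const_mul (A ^ 2)).sub
    (((hA 1).mul (hA (-1))).const_mul (E ^ 2))
  have hneg : ∀ᶠ t in 𝓝 (0 : ℝ),
      A ^ 2 * (esum (fun i => κ i + 1 * η i * t) s (k + 2) *
        esum (fun i => κ i + -1 * η i * t) s (k + 2)) -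
      E ^ 2 * (esum (fun i => κ i + 1 * η i * t) s 1 *
        esum (fun i => κ i + -1 * η i * t) s 1) ≤ 0 := by
    filter_upwards [h.eventually (hc 1), h.eventually (hc (-1))] with t h1 h2
    have h3 := h1.midpoint_log_concave (k := k + 1) h2 h (by ext i; simp; ring)
    have p1 := h1 1 (by omega)
    have p2 := h2 1 (by omega)
    have p3 : 0 < A := h 1 (by omega)
    rw [div_mul_div_comm, div_pow, div_le_div_iff₀ (by positivity) (by positivity)] at h3
    linarith
  have hfin := ((hJ.cast (by ring) rfl rfl).zero_of_eventually_nonpos hneg).2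
  have s1 : ∑ i ∈ s, 1 * η i * esum κ (s.erase i) (k + 1) =
      ∑ i ∈ s, η i * esum κ (s.erase i) (k + 1) := by simp
  have s2 : ∑ i ∈ s, -1 * η i * esum κ (s.erase i) (k + 1) =
      -∑ i ∈ s, η i * esum κ (s.erase i) (k + 1) := by simp
  have s3 : esumHess κ s k (fun i => 1 * η i) = esumHess κ s k η := by simp
  have s4 : esumHess κ s k (fun i => -1 * η i) = esumHess κ s k η := by simp [esumHess]
  have s5 : ∑ i ∈ s, -1 * η i = -∑ i ∈ s, η i := by simp
  have s6 : ∑ i ∈ s, 1 * η i = ∑ i ∈ s, η i := by simp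
  rw [s1, s2, s3, s4, s5, s6] at hfin
  simp only [zero_mul, sum_const_zero, zero_add] at hfin
  linarith

end JetsSymmetric

/-! ### Elementary symmetric functions of a matrix -/

section MatrixSymmetric

open Filter Topology Asymptotics Finset Polynomial

variable {ι : Type*} [Fintype ι] [DecidableEq ι]

/-- The `k`-th elementary symmetric function of the eigenvalues of a matrix. -/
noncomputable def ematrix (S : Matrix ι ι ℝ) (k : ℕ) : ℝ :=
  (Matrix.det (1 + (X : ℝ[X]) • S.map C)).coeff k

/-- Leibniz formula sorted by support: moved points contribute off-diagonal entries and a factor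
`X`, fixed points contribute `1 + S_ii X`. Near a diagonal matrix, the size of the support is then a
lower bound for the order of vanishing. -/
lemma ematrix_eq_sum_perm (S : Matrix ι ι ℝ) (k : ℕ) :
    ematrix S k = ∑ π : Equiv.Perm ι, ((Equiv.Perm.sign π : ℤ) : ℝ) *
      (if #π.support ≤ k then (∏ i ∈ π.support, S (π i) i) *
        esum (fun i => S i i) π.supportᶜ (k - #π.support) else 0) := by
  unfold ematrix
  rw [Matrix.det_apply', finsetSum_coeff]
  refine sum_congr rfl fun π _ => ?_
  rw [← Polynomial.C_eq_intCast, Polynomial.coeff_C_mul, ← prod_mul_prod_compl π.support]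
  congr 1
  have h1 : ∏ i ∈ π.support, ((1 : Matrix ι ι ℝ[X]) + (X : ℝ[X]) • S.map C) (π i) i =
      C (∏ i ∈ π.support, S (π i) i) * X ^ #π.support := by
    rw [map_prod, ← prod_const, ← prod_mul_distrib]
    refine prod_congr rfl fun i hi => ?_
    rw [Matrix.add_apply, Matrix.one_apply_ne (Equiv.Perm.mem_support.1 hi)]
    simp [X_mul_C]
  have h2 : ∏ i ∈ π.supportᶜ, ((1 : Matrix ι ι ℝ[X]) + (X : ℝ[X]) • S.map C) (π i) i =
      ∏ i ∈ π.supportᶜ, (1 + C (S i i) * X) := by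
    refine prod_congr rfl fun i hi => ?_
    rw [mem_compl, Equiv.Perm.notMem_support] at hi
    simp [hi, X_mul_C]
  rw [h1, h2, mul_assoc, Polynomial.coeff_C_mul, Polynomial.coeff_X_pow_mul']
  split_ifs
  · rw [coeff_prod_one_add_C_mul_X]
  · simp

lemma ematrix_one (S : Matrix ι ι ℝ) : ematrix S 1 = S.trace := by
  unfold ematrix
  rw [Matrix.coeff_det_one_add_X_smul_one]

lemma ematrix_diagonal (κ : ι → ℝ) (k : ℕ) : ematrix (Matrix.diagonal κ) k = esum κ univ k := by
  unfold ematrix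
  rw [← coeff_prod_one_add_C_mul_X, ← Matrix.det_diagonal]
  congr 2
  ext i j
  by_cases h : i = j
  · subst h; simp [X_mul_C]
  · simp [h]

lemma continuous_ematrix (k : ℕ) : Continuous fun S : Matrix ι ι ℝ => ematrix S k := by
  simp only [ematrix_eq_sum_perm]
  refine continuous_finsetSum _ fun π _ => continuous_const.mul ?_
  split_ifs
  · refine (continuous_finsetProd _ fun i _ => ?_).mul ((continuous_esum _ _).comp ?_)
    · fun_prop
    · fun_prop
  · exact continuous_const

/-- Second order expansion of `σ_{k+2}` along a curve of matrices through a diagonal matrix with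
symmetric velocity: the off-diagonal part of the velocity only contributes a nonpositive term. -/
theorem jet_ematrix {S : ℝ → Matrix ι ι ℝ} {κ : ι → ℝ} {ξ θ : ι → ι → ℝ} {k : ℕ}
    (hS : ∀ i j, Jet (fun t => S t i j) (if i = j then κ i else 0) (ξ i j) (θ i j))
    (hξ : ∀ i j, ξ i j = ξ j i)
    (hκ : ∀ i j, i ≠ j → 0 ≤ esum κ ((univ.erase i).erase j) k) :
    ∃ c, c ≤ ∑ i, θ i i * esum κ (univ.erase i) (k + 1) + esumHess κ univ k (fun i => ξ i i) ∧
      Jet (fun t => ematrix (S t) (k + 2)) (esum κ univ (k + 2))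
        (∑ i, ξ i i * esum κ (univ.erase i) (k + 1)) c := by
  have hdiag : ∀ i, Jet (fun t => S t i i) (κ i) (ξ i i) (θ i i) := fun i => by
    simpa using hS i i
  have hoff : ∀ i j, i ≠ j → Jet (fun t => S t i j) 0 (ξ i j) (θ i j) := fun i j h => by
    simpa [h] using hS i j
  have htend : Tendsto (fun t i => S t i i) (𝓝 0) (𝓝 κ) := by
    rw [tendsto_pi_nhds]
    exact fun i => (hdiag i).tendsto
  let T : Equiv.Perm ι → ℝ → ℝ := fun π t => ((Equiv.Perm.sign π : ℤ) : ℝ) *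
    (if #π.support ≤ k + 2 then (∏ i ∈ π.support, S t (π i) i) *
      esum (fun i => S t i i) π.supportᶜ (k + 2 - #π.support) else 0)
  have hT : ∀ π : Equiv.Perm ι, π ≠ 1 → ∃ c, c ≤ 0 ∧ Jet (T π) 0 0 c := by
    intro π hπ
    by_cases hle : #π.support ≤ k + 2
    swap
    · exact ⟨0, le_rfl, by simpa [T, hle] using jet_const 0⟩
    have hlim := ((continuous_esum π.supportᶜ (k + 2 - #π.support)).tendsto κ).comp htend
    have h2 : 2 ≤ #π.support := Equiv.Perm.two_le_card_support_of_ne_one hπ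
    rcases h2.eq_or_lt with h2 | h3
    -- A transposition has sign `-1` and contributes `-ξ_ab²` times a nonnegative symmetric function
    -- at order `t²`.
    · obtain ⟨a, b, hab, rfl⟩ := Equiv.Perm.card_support_eq_two.1 h2.symm
      have hsupp := Equiv.Perm.support_swap hab
      have hc : ({a, b} : Finset ι)ᶜ = (univ.erase a).erase b := by
        ext i; simp [and_comm]
      have hJ := (((hoff b a hab.symm).mul (hoff a b hab)).cast (mul_zero 0)
        (by simp) rfl).mul_tendsto hlim
      rw [← h2, hsupp, hc, Nat.add_sub_cancel] at hJ
      have hJ' := hJ.neg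
      refine ⟨_, ?_, (hJ'.cast neg_zero neg_zero rfl).congr (Eventually.of_forall fun t => ?_)⟩
      · have := hκ a b hab
        rw [hξ b a]
        have h0 : 0 ≤ ξ a b * ξ a b * esum κ ((univ.erase a).erase b) k :=
          mul_nonneg (mul_self_nonneg _) this
        linarith
      · simp only [T, Equiv.Perm.sign_swap hab]
        rw [if_pos hle, ← h2, hsupp, hc, Nat.add_sub_cancel, prod_pair hab]
        simp
    -- At least three points are moved, so the product of off-diagonal entries is `O(t³)`.
    · refine ⟨0, le_rfl, ?_⟩
      have hO : (fun t => ∏ i ∈ π.support, S t (π i) i) =O[𝓝 0]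
          fun t : ℝ => ∏ _i ∈ π.support, t :=
        IsBigO.finsetProd fun i hi =>
          (hoff (π i) i (Equiv.Perm.mem_support.1 hi)).isBigO_id
      simp only [prod_const] at hO
      have ho : (fun t : ℝ => t ^ #π.support) =o[𝓝 0] fun t : ℝ => t ^ 2 :=
        isLittleO_pow_pow h3
      have hJ : Jet (fun t => ∏ i ∈ π.support, S t (π i) i) 0 0 0 := by
        simpa [Jet] using hO.trans_isLittleO ho
      have := (hJ.mul_tendsto hlim).const_mul ((Equiv.Perm.sign π : ℤ) : ℝ)
      simpa [T, hle] using this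
  have hT1 : Jet (T 1) (esum κ univ (k + 2)) (∑ i, ξ i i * esum κ (univ.erase i) (k + 1))
      (∑ i, θ i i * esum κ (univ.erase i) (k + 1) + esumHess κ univ k (fun i => ξ i i)) := by
    simpa [T] using jet_esum (s := univ) k fun i _ => hdiag i
  choose! c hc0 hc using hT
  refine ⟨_ + ∑ π ∈ univ.erase 1, c π, ?_, ((hT1.add (Jet.sum (s := univ.erase 1)
    fun π hπ => hc π (ne_of_mem_erase hπ))).cast ?_ ?_ rfl).congr (Eventually.of_forall fun t => ?_)⟩
  · have : ∑ π ∈ univ.erase 1, c π ≤ 0 := sum_nonpos fun π hπ => hc0 π (ne_of_mem_erase hπ)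
    linarith
  · simp
  · simp
  · rw [add_sum_erase univ (fun π => T π t) (mem_univ 1), ematrix_eq_sum_perm]

end MatrixSymmetric

/-! ### Homogeneous extension of functions on the sphere -/

section RadialExtension

open Filter Topology

variable {n : ℕ}

instance fact_finrank_amb : Fact (Module.finrank ℝ (Amb n) = n + 1) :=
  ⟨finrank_euclideanSpace_fin⟩

lemma norm_sph (x : Sph n) : ‖(x : Amb n)‖ = 1 := norm_eq_of_mem_sphere x

lemma sph_ne_zero (x : Sph n) : (x : Amb n) ≠ 0 := ne_zero_of_mem_unit_sphere x

/-- The direction `y / |y|`, with a default value at the origin. -/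
noncomputable def unitDir (x₀ : Sph n) (y : Amb n) : Sph n :=
  if h : y = 0 then x₀
  else ⟨‖y‖⁻¹ • y, by
    rw [mem_sphere_zero_iff_norm, norm_smul, norm_inv, norm_norm,
      inv_mul_cancel₀ (norm_ne_zero_iff.mpr h)]⟩

lemma coe_unitDir (x₀ : Sph n) {y : Amb n} (hy : y ≠ 0) :
    (unitDir x₀ y : Amb n) = ‖y‖⁻¹ • y := by
  simp [unitDir, hy]

lemma radialExt_of_ne_zero {F : Type*} [Zero F] (φ : Sph n → F) (x₀ : Sph n) {y : Amb n}
    (hy : y ≠ 0) : radialExt φ y = φ (unitDir x₀ y) := by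
  simp [radialExt, unitDir, hy]

lemma unitDir_smul (x₀ x : Sph n) {r : ℝ} (hr : 0 < r) : unitDir x₀ (r • (x : Amb n)) = x := by
  apply Subtype.ext
  rw [coe_unitDir _ (smul_ne_zero hr.ne' (sph_ne_zero x)), norm_smul, norm_sph,
    Real.norm_of_nonneg hr.le, smul_smul, mul_one, inv_mul_cancel₀ hr.ne', one_smul]

lemma unitDir_coe (x₀ x : Sph n) : unitDir x₀ (x : Amb n) = x := by
  simpa using unitDir_smul x₀ x one_pos

lemma radialExt_coe {F : Type*} [Zero F] (φ : Sph n → F) (x : Sph n) :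
    radialExt φ (x : Amb n) = φ x := by
  rw [radialExt_of_ne_zero φ x (sph_ne_zero x), unitDir_coe]

lemma radialExt_smul {F : Type*} [Zero F] (φ : Sph n → F) {c : ℝ} (hc : 0 < c) (y : Amb n) :
    radialExt φ (c • y) = radialExt φ y := by
  by_cases hy : y = 0
  · simp [hy]
  have h : c • y ≠ 0 := smul_ne_zero hc.ne' hy
  simp only [radialExt, hy, h, dite_false]
  congr 1
  apply Subtype.ext
  simp only
  rw [norm_smul, Real.norm_of_nonneg hc.le, smul_smul]
  congr 1
  field_simp

lemma continuousAt_unitDir (x₀ : Sph n) {y : Amb n} (hy : y ≠ 0) :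
    ContinuousAt (unitDir x₀) y := by
  rw [Topology.IsInducing.subtypeVal.continuousAt_iff]
  have h : ContinuousAt (fun y : Amb n => ‖y‖⁻¹ • y) y :=
    (continuous_norm.continuousAt.inv₀ (norm_ne_zero_iff.2 hy)).smul continuousAt_id
  refine h.congr ?_
  filter_upwards [isOpen_ne.mem_nhds hy] with z hz
  exact (coe_unitDir x₀ hz).symm

/-- Away from the origin the extension is the composite of `φ` with the normalization `y ↦ y/|y|`,
smooth as a map into the sphere. It trades manifold calculus for Fréchet derivatives on the ambient
space. -/
lemma contDiffAt_radialExt {φ : Sph n → ℝ} {r : ℕ∞ω} (h : ContMDiff (𝓡 n) 𝓘(ℝ, ℝ) r φ)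
    {y : Amb n} (hy : y ≠ 0) : ContDiffAt ℝ r (radialExt φ) y := by
  let U : TopologicalSpace.Opens (Amb n) := ⟨{0}ᶜ, isOpen_compl_singleton⟩
  have hU : ∀ z : U, (z : Amb n) ≠ 0 := fun z => z.2
  have h1 : ContMDiff 𝓘(ℝ, Amb n) 𝓘(ℝ, Amb n) r fun z : U => ‖(z : Amb n)‖⁻¹ • (z : Amb n) := by
    intro z
    refine (contMDiffAt_subtype_iff (f := fun z : Amb n => ‖z‖⁻¹ • z)).2 ?_
    rw [contMDiffAt_iff_contDiffAt]
    exact ((contDiffAt_norm ℝ (hU z)).inv (norm_ne_zero_iff.2 (hU z))).smul contDiffAt_id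
  have h2 : ∀ z : U, ‖(z : Amb n)‖⁻¹ • (z : Amb n) ∈ sphere (0 : Amb n) 1 := fun z => by
    rw [mem_sphere_zero_iff_norm, norm_smul, norm_inv, norm_norm,
      inv_mul_cancel₀ (norm_ne_zero_iff.mpr (hU z))]
  have h3 := h.comp (h1.codRestrict_sphere h2)
  have h4 : ContMDiffAt 𝓘(ℝ, Amb n) 𝓘(ℝ, ℝ) r (fun z : U => radialExt φ (z : Amb n)) ⟨y, hy⟩ := by
    refine (h3 ⟨y, hy⟩).congr_of_eventuallyEq (Eventually.of_forall fun z => ?_)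
    simp only [radialExt, hU z, dite_false]
    rfl
  rw [contMDiffAt_subtype_iff (f := radialExt φ)] at h4
  exact contMDiffAt_iff_contDiffAt.1 h4

lemma fderiv_radialExt_smul {F : Type*} [NormedAddCommGroup F] [NormedSpace ℝ F] (φ : Sph n → F)
    {c : ℝ} (hc : 0 < c) (y : Amb n) :
    fderiv ℝ (radialExt φ) (c • y) = c⁻¹ • fderiv ℝ (radialExt φ) y := by
  have h := fderiv_comp_smul (f := radialExt φ) (x := y) c
  simp only [radialExt_smul φ hc] at h
  rw [h, smul_smul, inv_mul_cancel₀ hc.ne', one_smul]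

/-- Euler's relation in degree `0`: the extension is constant along rays. No differentiability is
required because `fderiv` defaults to zero. -/
lemma fderiv_radialExt_self {F : Type*} [NormedAddCommGroup F] [NormedSpace ℝ F] (φ : Sph n → F)
    (y : Amb n) : fderiv ℝ (radialExt φ) y y = 0 := by
  by_cases hd : DifferentiableAt ℝ (radialExt φ) y
  swap
  · simp [fderiv_zero_of_not_differentiableAt hd]
  have h1 : HasDerivAt (fun t : ℝ => t • y) y 1 := by
    simpa using (hasDerivAt_id (1 : ℝ)).smul_const y
  have h2 : HasDerivAt (fun t : ℝ => radialExt φ (t • y)) (fderiv ℝ (radialExt φ) y y) 1 := by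
    have hd' : HasFDerivAt (radialExt φ) (fderiv ℝ (radialExt φ) y) ((1 : ℝ) • y) := by
      rw [one_smul]; exact hd.hasFDerivAt
    exact hd'.comp_hasDerivAt (1 : ℝ) h1
  have h3 : HasDerivAt (fun t : ℝ => radialExt φ (t • y)) 0 1 := by
    refine (hasDerivAt_const (1 : ℝ) (radialExt φ y)).congr_of_eventuallyEq ?_
    filter_upwards [lt_mem_nhds (zero_lt_one' ℝ)] with t ht
    exact radialExt_smul φ ht y
  exact h2.unique h3

/-- Differentiate `Dφ(y) y = 0` in the direction `v`. -/
lemma fderiv_fderiv_radialExt_self {φ : Sph n → ℝ} (h : ContMDiff (𝓡 n) 𝓘(ℝ, ℝ) 2 φ)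
    {y : Amb n} (hy : y ≠ 0) (v : Amb n) :
    fderiv ℝ (fderiv ℝ (radialExt φ)) y v y = - fderiv ℝ (radialExt φ) y v := by
  have hd : DifferentiableAt ℝ (fderiv ℝ (radialExt φ)) y :=
    ((contDiffAt_radialExt h hy).fderiv_right (m := 1) (by norm_num)).differentiableAt (by simp)
  have h1 := hd.hasFDerivAt.clm_apply (hasFDerivAt_id y)
  have h2 : (fun z : Amb n => fderiv ℝ (radialExt φ) z (id z)) = fun _ => 0 := by
    funext z; exact fderiv_radialExt_self φ z
  rw [h2] at h1
  have h3 := congrArg (fun L : Amb n →L[ℝ] ℝ => L v) (h1.unique (hasFDerivAt_const (0 : ℝ) y))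
  simp at h3
  linarith

lemma fderiv_fderiv_radialExt_symm {φ : Sph n → ℝ} (h : ContMDiff (𝓡 n) 𝓘(ℝ, ℝ) 2 φ)
    {y : Amb n} (hy : y ≠ 0) (v w : Amb n) :
    fderiv ℝ (fderiv ℝ (radialExt φ)) y v w = fderiv ℝ (fderiv ℝ (radialExt φ)) y w v :=
  ((contDiffAt_radialExt h hy).isSymmSndFDerivAt (by simp)) v w

lemma inner_sphGrad (φ : Sph n → ℝ) (x : Sph n) (v : Amb n) :
    ⟪sphGrad φ x, v⟫_ℝ = fderiv ℝ (radialExt φ) (x : Amb n) v :=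
  InnerProductSpace.toDual_symm_apply

lemma norm_sphGrad (φ : Sph n → ℝ) (x : Sph n) :
    ‖sphGrad φ x‖ = ‖fderiv ℝ (radialExt φ) (x : Amb n)‖ :=
  LinearIsometryEquiv.norm_map _ _

lemma inner_sphGrad_self (φ : Sph n → ℝ) (x : Sph n) : ⟪sphGrad φ x, (x : Amb n)⟫_ℝ = 0 := by
  rw [inner_sphGrad, fderiv_radialExt_self]

lemma continuous_fderiv_radialExt {φ : Sph n → ℝ} (h : ContMDiff (𝓡 n) 𝓘(ℝ, ℝ) 1 φ) :
    Continuous fun x : Sph n => fderiv ℝ (radialExt φ) (x : Amb n) := by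
  rw [continuous_iff_continuousAt]
  intro x
  exact ((contDiffAt_radialExt h (sph_ne_zero x)).fderiv_right (m := 0)
    (by norm_num)).continuousAt.comp continuous_subtype_val.continuousAt

lemma continuous_fderiv_fderiv_radialExt {φ : Sph n → ℝ} (h : ContMDiff (𝓡 n) 𝓘(ℝ, ℝ) 2 φ) :
    Continuous fun x : Sph n => fderiv ℝ (fderiv ℝ (radialExt φ)) (x : Amb n) := by
  rw [continuous_iff_continuousAt]
  intro x
  exact (((contDiffAt_radialExt h (sph_ne_zero x)).fderiv_right (m := 1)
    (by norm_num)).fderiv_right (m := 0) (by norm_num)).continuousAt.comp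
    continuous_subtype_val.continuousAt

lemma continuous_sphGrad {φ : Sph n → ℝ} (h : ContMDiff (𝓡 n) 𝓘(ℝ, ℝ) 1 φ) :
    Continuous (sphGrad φ) :=
  (LinearIsometryEquiv.continuous _).comp (continuous_fderiv_radialExt h)

lemma norm_sphHess_le (φ : Sph n → ℝ) (x : Sph n) :
    ‖sphHess φ x‖ ≤ ‖fderiv ℝ (fderiv ℝ (radialExt φ)) (x : Amb n)‖ := by
  refine ContinuousLinearMap.opNorm_le_bound₂ _ (ContinuousLinearMap.opNorm_nonneg _) fun v w => ?_
  simp only [sphHess, ContinuousLinearMap.bilinearComp_apply]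
  refine (ContinuousLinearMap.le_opNorm₂ _ _ _).trans ?_
  gcongr
  · exact (Tan x).norm_starProjection_apply_le v
  · exact (Tan x).norm_starProjection_apply_le w

lemma bddAbove_range_of_continuous {φ : Sph n → ℝ} (h : Continuous φ) :
    BddAbove (Set.range φ) := (isCompact_range h).bddAbove

/-- A real supremum over an unbounded range is `0` by convention, so bounds on `c2Norm` say nothing
pointwise until the range is known to be bounded; a continuous majorant provides this. -/
lemma le_iSup_sph {φ ψ : Sph n → ℝ} (hψ : Continuous ψ) (h : ∀ x, φ x ≤ ψ x) (x : Sph n) :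
    φ x ≤ ⨆ y, φ y := by
  obtain ⟨B, hB⟩ := bddAbove_range_of_continuous hψ
  exact le_ciSup (f := φ) ⟨B, by rintro _ ⟨y, rfl⟩; exact (h y).trans (hB ⟨y, rfl⟩)⟩ x

lemma bounds_of_c2Norm_le {f : Sph n → ℝ} (hf : ContMDiff (𝓡 n) 𝓘(ℝ, ℝ) 2 f) {Λ : ℝ}
    (h : c2Norm f ≤ Λ) (x : Sph n) :
    |f x| ≤ Λ ∧ ‖sphGrad f x‖ ≤ Λ ∧ ‖sphHess f x‖ ≤ Λ := by
  have hf1 : ContMDiff (𝓡 n) 𝓘(ℝ, ℝ) 1 f := hf.of_le (by norm_num)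
  have h0 := le_iSup_sph (hf.continuous.abs) (fun y => le_refl |f y|) x
  have h1 := le_iSup_sph (continuous_sphGrad hf1).norm (fun y => le_refl ‖sphGrad f y‖) x
  have hc := Continuous.norm (E := Amb n →L[ℝ] Amb n →L[ℝ] ℝ)
    (continuous_fderiv_fderiv_radialExt hf)
  have h2 := le_iSup_sph hc (fun y => norm_sphHess_le f y) x
  have p0 := abs_nonneg (f x)
  have p1 := norm_nonneg (sphGrad f x)
  have p2 := norm_nonneg (sphHess f x)
  unfold c2Norm c1Norm at h
  exact ⟨by linarith, by linarith, by linarith⟩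

/-- The full Euclidean Hessian of the extension is controlled by the covariant derivatives. -/
lemma abs_fderiv_fderiv_radialExt_le {f : Sph n → ℝ} (hf : ContMDiff (𝓡 n) 𝓘(ℝ, ℝ) 2 f)
    (x : Sph n) (v : Amb n) :
    |fderiv ℝ (fderiv ℝ (radialExt f)) (x : Amb n) v v| ≤
      (‖sphHess f x‖ + 2 * ‖sphGrad f x‖) * ‖v‖ ^ 2 := by
  set D := fderiv ℝ (fderiv ℝ (radialExt f)) (x : Amb n) with hD
  set p := (Tan x).starProjection v with hp
  set c := ⟪(x : Amb n), v⟫_ℝ with hc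
  have hv : v = p + c • (x : Amb n) := by
    rw [hp, starProjection_orthogonal]
    simp [starProjection_singleton, hc]
  have h1 := fderiv_fderiv_radialExt_self hf (sph_ne_zero x)
  have h2 := fderiv_fderiv_radialExt_symm hf (sph_ne_zero x)
  have h3 : D v v = sphHess f x v v - 2 * (c * fderiv ℝ (radialExt f) (x : Amb n) p) := by
    have e1 : sphHess f x v v = D p p := by
      simp only [sphHess, ContinuousLinearMap.bilinearComp_apply, ← hp, ← hD]
    rw [e1]
    conv_lhs => rw [hv]
    simp only [map_add, map_smul, _root_.add_apply, _root_.smul_apply,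
      smul_eq_mul]
    rw [h2 x p, h1, h1, fderiv_radialExt_self]
    ring
  have hpn : ‖p‖ ≤ ‖v‖ := (Tan x).norm_starProjection_apply_le v
  have hcn : |c| ≤ ‖v‖ := by
    have := abs_real_inner_le_norm (x : Amb n) v
    rwa [norm_sph, one_mul] at this
  rw [h3]
  refine (abs_sub _ _).trans ?_
  have h4 : |sphHess f x v v| ≤ ‖sphHess f x‖ * ‖v‖ * ‖v‖ := (sphHess f x).le_opNorm₂ v v
  have h5 : |fderiv ℝ (radialExt f) (x : Amb n) p| ≤ ‖sphGrad f x‖ * ‖v‖ := by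
    rw [norm_sphGrad]
    exact ((fderiv ℝ (radialExt f) (x : Amb n)).le_opNorm p).trans (by gcongr)
  rw [abs_mul, abs_mul, abs_two]
  have h6 : |c| * |fderiv ℝ (radialExt f) (x : Amb n) p| ≤ ‖v‖ * (‖sphGrad f x‖ * ‖v‖) := by
    gcongr
  nlinarith

end RadialExtension

/-! ### The outer normal of a radial graph -/

section Normal

open Filter Topology

variable {n : ℕ}

/-- `√(ρ² + |∇ρ|²)`. -/
noncomputable def gradLen (ρ : Sph n → ℝ) (x : Sph n) : ℝ := √(ρ x ^ 2 + ‖sphGrad ρ x‖ ^ 2)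

variable {ρ : Sph n → ℝ}

lemma gradLen_pos (hρ : ∀ x, 0 < ρ x) (x : Sph n) : 0 < gradLen ρ x :=
  Real.sqrt_pos.2 (by have := hρ x; positivity)

lemma gradLen_sq (x : Sph n) : gradLen ρ x ^ 2 = ρ x ^ 2 + ‖sphGrad ρ x‖ ^ 2 :=
  Real.sq_sqrt (by positivity)

lemma gradLen_smul_outerNormal (hρ : ∀ x, 0 < ρ x) (x : Sph n) :
    gradLen ρ x • outerNormal ρ x = ρ x • (x : Amb n) - sphGrad ρ x := by
  unfold outerNormal
  rw [smul_smul]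
  change (gradLen ρ x * (gradLen ρ x)⁻¹) • _ = _
  rw [mul_inv_cancel₀ (gradLen_pos hρ x).ne', one_smul]

lemma norm_outerNormal (hρ : ∀ x, 0 < ρ x) (x : Sph n) : ‖outerNormal ρ x‖ = 1 := by
  have h0 := gradLen_pos hρ x
  have h1 : ‖gradLen ρ x • outerNormal ρ x‖ ^ 2 = gradLen ρ x ^ 2 := by
    rw [gradLen_smul_outerNormal hρ, norm_sub_sq_real, norm_smul, norm_sph, inner_smul_left,
      real_inner_comm, inner_sphGrad_self, gradLen_sq]
    simp
  rw [norm_smul, Real.norm_of_nonneg h0.le, mul_pow] at h1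
  have h2 : ‖outerNormal ρ x‖ ^ 2 = 1 := by
    have : gradLen ρ x ^ 2 ≠ 0 := by positivity
    field_simp at h1
    linarith
  nlinarith [norm_nonneg (outerNormal ρ x)]

lemma norm_radialGraph (hρ : ∀ x, 0 < ρ x) (x : Sph n) : ‖radialGraph ρ x‖ = ρ x := by
  rw [radialGraph, norm_smul, norm_sph, Real.norm_of_nonneg (hρ x).le, mul_one]

lemma supportFn_mul_gradLen (hρ : ∀ x, 0 < ρ x) (x : Sph n) :
    supportFn ρ x * gradLen ρ x = ρ x ^ 2 := by
  unfold supportFn radialGraph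
  rw [mul_comm, ← inner_smul_right, gradLen_smul_outerNormal hρ, inner_sub_right, inner_smul_left,
    inner_smul_left, inner_smul_right, real_inner_self_eq_norm_sq, norm_sph,
    real_inner_comm, inner_sphGrad_self]
  simp [pow_two]

lemma supportFn_eq (hρ : ∀ x, 0 < ρ x) (x : Sph n) : supportFn ρ x = ρ x ^ 2 / gradLen ρ x := by
  rw [eq_div_iff (gradLen_pos hρ x).ne', supportFn_mul_gradLen hρ]

lemma supportFn_pos (hρ : ∀ x, 0 < ρ x) (x : Sph n) : 0 < supportFn ρ x := by
  rw [supportFn_eq hρ]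
  exact div_pos (pow_pos (hρ x) 2) (gradLen_pos hρ x)

lemma continuous_gradLen (h : ContMDiff (𝓡 n) 𝓘(ℝ, ℝ) 1 ρ) : Continuous (gradLen ρ) := by
  have h1 := h.continuous
  have h2 := continuous_sphGrad h
  unfold gradLen
  fun_prop

lemma continuous_outerNormal (h : ContMDiff (𝓡 n) 𝓘(ℝ, ℝ) 1 ρ) (hρ : ∀ x, 0 < ρ x) :
    Continuous (outerNormal ρ) := by
  have h1 := h.continuous
  have h2 := continuous_sphGrad h
  have h3 := (continuous_gradLen h).inv₀ fun x => (gradLen_pos hρ x).ne'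
  have : outerNormal ρ = fun x => (gradLen ρ x)⁻¹ • (ρ x • (x : Amb n) - sphGrad ρ x) := rfl
  rw [this]
  exact h3.smul ((h1.smul continuous_subtype_val).sub h2)

lemma continuous_supportFn (h : ContMDiff (𝓡 n) 𝓘(ℝ, ℝ) 1 ρ) (hρ : ∀ x, 0 < ρ x) :
    Continuous (supportFn ρ) := by
  have h1 := h.continuous
  have h2 := continuous_outerNormal h hρ
  unfold supportFn radialGraph
  fun_prop

lemma differentiableAt_radialExt_radialGraph (h : ContMDiff (𝓡 n) 𝓘(ℝ, ℝ) 1 ρ) (x : Sph n) :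
    DifferentiableAt ℝ (radialExt (radialGraph ρ)) (x : Amb n) := by
  have h1 := (contDiffAt_radialExt h (sph_ne_zero x)).differentiableAt (by simp)
  have h2 : DifferentiableAt ℝ (fun y : Amb n => ‖y‖⁻¹) (x : Amb n) :=
    (differentiableAt_id.norm ℝ (sph_ne_zero x)).inv (norm_ne_zero_iff.2 (sph_ne_zero x))
  refine (h1.smul (h2.smul differentiableAt_id)).congr_of_eventuallyEq ?_
  filter_upwards [isOpen_ne.mem_nhds (sph_ne_zero x)] with y hy
  rw [radialExt_of_ne_zero _ x hy, radialGraph, coe_unitDir x hy]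
  simp only [Pi.smul_apply', radialExt_of_ne_zero ρ x hy, id]

lemma sphGrad_unitDir (φ : Sph n → ℝ) (x₀ : Sph n) {y : Amb n} (hy : y ≠ 0) :
    sphGrad φ (unitDir x₀ y) = ‖y‖ • (InnerProductSpace.toDual ℝ (Amb n)).symm
      (fderiv ℝ (radialExt φ) y) := by
  unfold sphGrad gradient
  rw [coe_unitDir x₀ hy, fderiv_radialExt_smul φ (inv_pos.2 (norm_pos_iff.2 hy)), inv_inv, map_smul]

lemma differentiableAt_radialExt_outerNormal (h : ContMDiff (𝓡 n) 𝓘(ℝ, ℝ) 2 ρ)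
    (hρ : ∀ x, 0 < ρ x) (x : Sph n) :
    DifferentiableAt ℝ (radialExt (outerNormal ρ)) (x : Amb n) := by
  have hx := sph_ne_zero x
  have h1 := (contDiffAt_radialExt h hx).differentiableAt (by simp)
  have h2 : DifferentiableAt ℝ (fun y : Amb n => ‖y‖) (x : Amb n) := differentiableAt_id.norm ℝ hx
  have h2' : DifferentiableAt ℝ (fun y : Amb n => ‖y‖⁻¹) (x : Amb n) :=
    h2.inv (norm_ne_zero_iff.2 hx)
  have h3 : DifferentiableAt ℝ (fderiv ℝ (radialExt ρ)) (x : Amb n) :=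
    ((contDiffAt_radialExt h hx).fderiv_right (m := 1) (by norm_num)).differentiableAt (by simp)
  have h4 : DifferentiableAt ℝ (fun y : Amb n => ‖y‖ • (InnerProductSpace.toDual ℝ (Amb n)).symm
      (fderiv ℝ (radialExt ρ) y)) (x : Amb n) :=
    h2.smul (((InnerProductSpace.toDual ℝ (Amb n)).symm.toContinuousLinearEquiv.toContinuousLinearMap
      ).differentiableAt.comp _ h3)
  have h5 : ∀ᶠ y in 𝓝 (x : Amb n), y ≠ 0 := isOpen_ne.mem_nhds hx
  have h6 : radialExt ρ (x : Amb n) ^ 2 + ‖‖(x : Amb n)‖ •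
      (InnerProductSpace.toDual ℝ (Amb n)).symm (fderiv ℝ (radialExt ρ) (x : Amb n))‖ ^ 2 ≠ 0 := by
    have := hρ x
    rw [radialExt_coe]
    positivity
  have h7 := (((h1.pow 2).add (h4.norm_sq ℝ)).sqrt h6).inv (Real.sqrt_ne_zero'.2 (by
    have := hρ x
    simp only [Pi.add_apply, Pi.pow_apply, radialExt_coe]
    positivity))
  refine (h7.smul ((h1.smul (h2'.smul differentiableAt_id)).sub h4)).congr_of_eventuallyEq ?_
  filter_upwards [h5] with y hy
  rw [radialExt_of_ne_zero _ x hy, outerNormal, sphGrad_unitDir ρ x hy, coe_unitDir x hy,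
    ← radialExt_of_ne_zero ρ x hy]
  simp

lemma contDiffAt_defining {r : ℕ∞ω} (h : ContMDiff (𝓡 n) 𝓘(ℝ, ℝ) r ρ) {y : Amb n} (hy : y ≠ 0) :
    ContDiffAt ℝ r (fun y : Amb n => ‖y‖ - radialExt ρ y) y :=
  (contDiffAt_norm ℝ hy).sub (contDiffAt_radialExt h hy)

/-- The differential of the defining function `|y| - ρ(y/|y|)` of the radial graph. -/
lemma fderiv_defining (h : ContMDiff (𝓡 n) 𝓘(ℝ, ℝ) 1 ρ) (hρ : ∀ x, 0 < ρ x) (x : Sph n)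
    (v : Amb n) :
    fderiv ℝ (fun y : Amb n => ‖y‖ - radialExt ρ y) (radialGraph ρ x) v =
      gradLen ρ x / ρ x * ⟪outerNormal ρ x, v⟫_ℝ := by
  have hp := hρ x
  have hX : radialGraph ρ x ≠ 0 := smul_ne_zero hp.ne' (sph_ne_zero x)
  have h1 : DifferentiableAt ℝ (fun y : Amb n => ‖y‖) (radialGraph ρ x) :=
    differentiableAt_id.norm ℝ hX
  have h2 := (contDiffAt_radialExt h hX).differentiableAt (by simp)
  rw [fderiv_fun_sub h1 h2, _root_.sub_apply]
  have h3 : fderiv ℝ (fun y : Amb n => ‖y‖) (radialGraph ρ x) v = ⟪(x : Amb n), v⟫_ℝ := by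
    have hs : HasFDerivAt (fun y : Amb n => ‖y‖ ^ 2) (2 • innerSL ℝ (radialGraph ρ x))
      (radialGraph ρ x) := (hasStrictFDerivAt_norm_sq _).hasFDerivAt
    have hs' := h1.hasFDerivAt.pow 2
    have := congrArg (fun L : Amb n →L[ℝ] ℝ => L v) (hs'.unique hs)
    simp only [norm_radialGraph hρ, _root_.smul_apply, innerSL_apply_apply] at this
    rw [radialGraph, inner_smul_left] at this
    simp at this
    have h4 : ρ x * (fderiv ℝ (fun y : Amb n => ‖y‖) (radialGraph ρ x) v) =
        ρ x * ⟪(x : Amb n), v⟫_ℝ := by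
      rw [radialGraph]; linarith
    exact mul_left_cancel₀ hp.ne' h4
  rw [h3, radialGraph, fderiv_radialExt_smul ρ hp, _root_.smul_apply, smul_eq_mul,
    ← inner_sphGrad]
  have h4 : gradLen ρ x * ⟪outerNormal ρ x, v⟫_ℝ = ρ x * ⟪(x : Amb n), v⟫_ℝ - ⟪sphGrad ρ x, v⟫_ℝ := by
    rw [← real_inner_smul_left, gradLen_smul_outerNormal hρ, inner_sub_left, real_inner_smul_left]
  rw [div_mul_eq_mul_div, h4]
  field_simp

end Normal

/-! ### Generalized eigenvalues of a pair of forms -/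

section GeneralizedEigenvalues

open Polynomial
open scoped MatrixOrder Matrix.Norms.L2Operator

variable {ι : Type*} [Fintype ι] [DecidableEq ι]

/-- With `g = BᵀB`, the matrix `S = g⁻¹h = B⁻¹(B⁻ᵀh)` has the characteristic polynomial of the
symmetric matrix `B⁻ᵀhB⁻¹`. -/
lemma splits_charpoly_of_posDef {g h S : Matrix ι ι ℝ} (hg : g.PosDef) (hh : h.IsHermitian)
    (hS : g * S = h) : S.charpoly.Splits := by
  obtain ⟨B, hB⟩ := CStarAlgebra.nonneg_iff_eq_star_mul_self.1
    (Matrix.nonneg_iff_posSemidef.2 hg.posSemidef)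
  have hB' : g = B.transpose * B := by
    rw [hB, Matrix.star_eq_conjTranspose, Matrix.conjTranspose_eq_transpose_of_trivial]
  have hdet : IsUnit B.det := by
    have h1 := hg.det_pos
    rw [hB', Matrix.det_mul, Matrix.det_transpose] at h1
    exact isUnit_iff_ne_zero.2 fun h0 => by simp [h0] at h1
  have hdetT : IsUnit B.transpose.det := by rwa [Matrix.det_transpose]
  have h1 : S = B⁻¹ * ((B.transpose)⁻¹ * h) := by
    rw [← hS, hB', Matrix.mul_assoc B.transpose, Matrix.nonsing_inv_mul_cancel_left _ _ hdetT,
      Matrix.nonsing_inv_mul_cancel_left _ _ hdet]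
  rw [h1, Matrix.charpoly_mul_comm]
  refine Matrix.IsHermitian.splits_charpoly ?_
  rw [Matrix.IsHermitian, Matrix.conjTranspose_eq_transpose_of_trivial, Matrix.transpose_mul,
    Matrix.transpose_mul, ← Matrix.transpose_nonsing_inv, Matrix.transpose_transpose,
    ← Matrix.conjTranspose_eq_transpose_of_trivial h, hh.eq, Matrix.mul_assoc]

lemma esymm_roots_charpoly {S : Matrix ι ι ℝ} (hS : S.charpoly.Splits) {j : ℕ}
    (hj : j ≤ Fintype.card ι) : S.charpoly.roots.esymm j = ematrix S j := by
  have h1 := coeff_eq_esymm_roots_of_splits hS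
    (k := Fintype.card ι - j) (by rw [Matrix.charpoly_natDegree_eq_dim]; omega)
  rw [Matrix.charpoly_natDegree_eq_dim, Matrix.charpoly_monic S |>.leadingCoeff, one_mul,
    Nat.sub_sub_self hj, Matrix.charpoly_coeff_eq_sum_minors S j hj,
    ← Matrix.coeff_det_one_add_X_smul_eq_sum_minors] at h1
  exact (mul_left_cancel₀ (pow_ne_zero j (by norm_num)) h1).symm

/-- Up to nonzero constants (`det M ^ 2` on one side, `± det g` on the other), `det (H - X G)` is
the characteristic polynomial of `S`, so both have the same roots with multiplicity. Curvatures
defined in one basis can thus be computed in another. -/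
lemma esymm_roots_det_sub {G H M S g h : Matrix ι ι ℝ} (hg : g = M.transpose * G * M)
    (hh : h = M.transpose * H * M) (hpos : g.PosDef) (hsym : h.IsHermitian) (hS : g * S = h)
    {j : ℕ} (hj : j ≤ Fintype.card ι) :
    (Matrix.det (Matrix.of fun a b => C (H a b) - X * C (G a b))).roots.esymm j =
      ematrix S j := by
  have hM : M.det ≠ 0 := by
    have h1 := hpos.det_pos
    rw [hg, Matrix.det_mul] at h1
    exact fun h0 => by simp [h0] at h1
  rw [← esymm_roots_charpoly (splits_charpoly_of_posDef hpos hsym hS) hj]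
  congr 1
  have e1 : (Matrix.of fun a b => C (H a b) - X * C (G a b)) =
      H.map C - (X : ℝ[X]) • G.map C := by
    ext a b; simp
  have e2 : h.map C - (X : ℝ[X]) • g.map C =
      M.transpose.map C * (H.map C - (X : ℝ[X]) • G.map C) * M.map C := by
    rw [hh, hg]
    simp only [Matrix.map_mul, Matrix.mul_sub, Matrix.sub_mul, Matrix.mul_smul, Matrix.smul_mul]
  have e3 : h.map C - (X : ℝ[X]) • g.map C = -(g.map C * S.charmatrix) := by
    rw [← hS, Matrix.charmatrix, Matrix.mul_sub]
    have : g.map C * (Matrix.scalar ι) (X : ℝ[X]) = (X : ℝ[X]) • g.map C := by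
      rw [Matrix.scalar_apply, ← Matrix.smul_one_eq_diagonal, Matrix.mul_smul, Matrix.mul_one]
    rw [this, neg_sub, Matrix.map_mul]
    rfl
  have e4 := congrArg Matrix.det (e2.symm.trans e3)
  rw [Matrix.det_mul, Matrix.det_mul, Matrix.det_neg, Matrix.det_mul, ← e1] at e4
  have d : ∀ A : Matrix ι ι ℝ, (A.map C).det = C A.det := fun A => (RingHom.map_det C A).symm
  rw [d, d, d, Matrix.det_transpose] at e4
  set P := Matrix.det (Matrix.of fun a b => C (H a b) - X * C (G a b)) with hP
  change C M.det * P * C M.det = _ * (_ * S.charpoly) at e4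
  have e5 : C (M.det * M.det) * P = C ((-1) ^ Fintype.card ι * g.det) * S.charpoly := by
    rw [C_mul, C_mul, C_pow, C_neg, C_1]
    linear_combination e4
  have e6 := congrArg roots e5
  rwa [roots_C_mul _ (mul_ne_zero hM hM), roots_C_mul _
    (mul_ne_zero (pow_ne_zero _ (by norm_num)) hpos.det_pos.ne')] at e6

end GeneralizedEigenvalues

/-! ### Local graphs over the tangent plane -/

section ImplicitGraph

set_option linter.unusedSectionVars false

open Filter Topology

variable {E : Type*} [NormedAddCommGroup E] [InnerProductSpace ℝ E] [CompleteSpace E]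

/-- The point of the graph of `w` over the plane `X + e^⊥`, in the direction `-e`. -/
def graphMap (X e : E) (w : (ℝ ∙ e)ᗮ → ℝ) (z : (ℝ ∙ e)ᗮ) : E := X + (z : E) - w z • e

lemma inner_coe_orthogonal (e : E) (z : (ℝ ∙ e)ᗮ) : ⟪e, (z : E)⟫_ℝ = 0 :=
  mem_orthogonal_singleton_iff_inner_right.1 z.2

lemma coe_orthogonalProjection_add {e : E} (he : ‖e‖ = 1) (v : E) :
    (((ℝ ∙ e)ᗮ.orthogonalProjectionOnto v : (ℝ ∙ e)ᗮ) : E) + ⟪e, v⟫_ℝ • e = v := by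
  have : (((ℝ ∙ e)ᗮ.orthogonalProjectionOnto v : (ℝ ∙ e)ᗮ) : E) = (ℝ ∙ e)ᗮ.starProjection v := rfl
  rw [this, starProjection_orthogonal]
  simp [starProjection_singleton, he]

/-- In the coordinates `(z, s) ↦ X + z - s e` the `s`-derivative of `ψ` is `-c ≠ 0`, so the implicit
function theorem applies. The last clause is its uniqueness part: every zero of `ψ` near `X` lies on
the graph. -/
theorem exists_graph {ψ : E → ℝ} {X e : E} (he : ‖e‖ = 1) {r : ℕ∞ω} (hr : r ≠ 0)
    (hψ : ContDiffAt ℝ r ψ X) (h0 : ψ X = 0) {c : ℝ} (hc : 0 < c)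
    (hd : ∀ v, fderiv ℝ ψ X v = c * ⟪e, v⟫_ℝ) :
    ∃ w : (ℝ ∙ e)ᗮ → ℝ, ContDiffAt ℝ r w 0 ∧ w 0 = 0 ∧ fderiv ℝ w 0 = 0 ∧
      (∀ᶠ z in 𝓝 0, ψ (graphMap X e w z) = 0) ∧
      ∀ᶠ y in 𝓝 X, ψ y = 0 → graphMap X e w ((ℝ ∙ e)ᗮ.orthogonalProjectionOnto (y - X)) = y := by
  let K := (ℝ ∙ e)ᗮ
  let q : K × ℝ → E := fun p => X + (p.1 : E) - p.2 • e
  have hq0 : q (0, 0) = X := by simp [q]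
  have hqd : HasFDerivAt q
      (K.subtypeL.comp (ContinuousLinearMap.fst ℝ K ℝ) -
        (ContinuousLinearMap.snd ℝ K ℝ).smulRight e) (0, 0) := by
    have h1 : HasFDerivAt (fun p : K × ℝ => (p.1 : E)) (K.subtypeL.comp
      (ContinuousLinearMap.fst ℝ K ℝ)) (0, 0) :=
      (K.subtypeL.comp (ContinuousLinearMap.fst ℝ K ℝ)).hasFDerivAt
    have h2 : HasFDerivAt (fun p : K × ℝ => p.2 • e) ((ContinuousLinearMap.snd ℝ K ℝ).smulRight e)
      (0, 0) := ((ContinuousLinearMap.snd ℝ K ℝ).smulRight e).hasFDerivAt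
    exact (h1.const_add X).sub h2
  have hqs : ContDiffAt ℝ r q (0, 0) := by
    have h1 : ContDiff ℝ r fun p : K × ℝ => (p.1 : E) :=
      (K.subtypeL.comp (ContinuousLinearMap.fst ℝ K ℝ)).contDiff
    have h2 : ContDiff ℝ r fun p : K × ℝ => p.2 • e :=
      ((ContinuousLinearMap.snd ℝ K ℝ).smulRight e).contDiff
    exact ((contDiff_const.add h1).sub h2).contDiffAt
  have hfs : ContDiffAt ℝ r (fun p => ψ (q p)) (0, 0) := by
    refine ContDiffAt.comp (0, 0) ?_ hqs
    rwa [hq0]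
  have hfd : ∀ p : K × ℝ, fderiv ℝ (fun p => ψ (q p)) (0, 0) p = - (c * p.2) := by
    intro p
    have h1 : HasFDerivAt ψ (fderiv ℝ ψ X) (q (0, 0)) := by
      rw [hq0]; exact (hψ.differentiableAt hr).hasFDerivAt
    have h2 : HasFDerivAt (fun p => ψ (q p)) _ (0, 0) := h1.comp _ hqd
    rw [h2.fderiv]
    simp only [ContinuousLinearMap.comp_apply, _root_.sub_apply, ContinuousLinearMap.smulRight_apply,
      ContinuousLinearMap.coe_fst', ContinuousLinearMap.coe_snd', hd, subtypeL_apply, inner_sub_right,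
      inner_smul_right, real_inner_self_eq_norm_sq, he]
    rw [inner_coe_orthogonal]; ring
  have hinv : (fderiv ℝ (fun p => ψ (q p)) (0, 0) ∘L .inr ℝ K ℝ).IsInvertible := by
    refine ⟨ContinuousLinearEquiv.unitsEquivAut ℝ (Units.mk0 (-c) (by linarith)), ?_⟩
    ext
    simp [hfd]
  let w := hfs.implicitFunction hr hinv
  have hw0 : w 0 = 0 := hfs.implicitFunction_apply_self hr hinv
  have hwd := (hfs.hasStrictFDerivAt_implicitFunction hr hinv).hasFDerivAt
  have hfq0 : ψ (q (0, 0)) = 0 := by rw [hq0, h0]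
  refine ⟨w, hfs.contDiffAt_implicitFunction hr hinv, hw0, ?_, ?_, ?_⟩
  · rw [hwd.fderiv]
    have : fderiv ℝ (fun p => ψ (q p)) (0, 0) ∘L .inl ℝ K ℝ = 0 := by
      ext z
      simp [hfd]
    rw [this, ContinuousLinearMap.comp_zero, neg_zero]
  · filter_upwards [hfs.eventually_apply_implicitFunction hr hinv] with z hz
    rw [hfq0] at hz
    exact hz
  · have hev := hfs.eventually_apply_eq_iff_implicitFunction hr hinv
    have ht : Tendsto (fun y : E => ((K.orthogonalProjectionOnto (y - X), -⟪e, y - X⟫_ℝ) : K × ℝ))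
        (𝓝 X) (𝓝 (0, 0)) := by
      have : Continuous fun y : E => ((K.orthogonalProjectionOnto (y - X), -⟪e, y - X⟫_ℝ) : K × ℝ) := by
        fun_prop
      simpa using this.tendsto X
    filter_upwards [ht.eventually hev] with y hy hψy
    have hqy : q (K.orthogonalProjectionOnto (y - X), -⟪e, y - X⟫_ℝ) = y := by
      have := coe_orthogonalProjection_add he (y - X)
      simp only [q, neg_smul, sub_neg_eq_add, add_assoc]
      rw [this]; abel
    have hy' : w (K.orthogonalProjectionOnto (y - X)) = -⟪e, y - X⟫_ℝ := by
      refine hy.1 ?_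
      rw [hqy, hψy, hfq0]
    unfold graphMap
    rw [hy']
    exact hqy

lemma sum_basis_orthogonal {ι : Type*} [Fintype ι] {e : E} (he : ‖e‖ = 1)
    (b : OrthonormalBasis ι ℝ (ℝ ∙ e)ᗮ) (v : E) :
    v = ⟪e, v⟫_ℝ • e + ∑ i, ⟪(b i : E), v⟫_ℝ • (b i : E) := by
  have h1 := coe_orthogonalProjection_add he v
  have h2 := congrArg (fun z : (ℝ ∙ e)ᗮ => (z : E))
    (b.sum_repr' ((ℝ ∙ e)ᗮ.orthogonalProjectionOnto v))
  simp only [coe_sum, coe_smul] at h2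
  have h3 : ∀ i, ⟪b i, (ℝ ∙ e)ᗮ.orthogonalProjectionOnto v⟫_ℝ = ⟪(b i : E), v⟫_ℝ := by
    intro i
    rw [coe_inner]
    conv_rhs => rw [← h1]
    rw [inner_add_right, inner_smul_right, real_inner_comm (e : E), inner_coe_orthogonal]
    simp
  simp only [h3] at h2
  rw [← h2] at h1
  rw [add_comm]
  exact h1.symm

end ImplicitGraph

/-! ### Radial graphs as local graphs over their tangent planes -/

section LocalGraph

set_option linter.unusedSectionVars false

open Filter Topology

variable {n : ℕ}

/-- The tangent plane of the radial graph at the point over `x₀`. -/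
noncomputable abbrev TanG (ρ : Sph n → ℝ) (x₀ : Sph n) : Submodule ℝ (Amb n) := (ℝ ∙ outerNormal ρ x₀)ᗮ

/-- The graph parametrization of the radial graph near the point over `x₀`. -/
noncomputable def graphPt (ρ : Sph n → ℝ) (x₀ : Sph n) (w : TanG ρ x₀ → ℝ) (z : TanG ρ x₀) : Amb n :=
  graphMap (radialGraph ρ x₀) (outerNormal ρ x₀) w z

/-- The direction of a point of the graph. -/
noncomputable def graphDir (ρ : Sph n → ℝ) (x₀ : Sph n) (w : TanG ρ x₀ → ℝ) (z : TanG ρ x₀) :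
    Sph n :=
  unitDir x₀ (graphPt ρ x₀ w z)

/-- Near the point over `x₀`, the radial graph is the graph of `w` over its tangent plane. -/
structure IsLocalGraph (ρ : Sph n → ℝ) (x₀ : Sph n) (w : TanG ρ x₀ → ℝ) : Prop where
  contDiffAt : ContDiffAt ℝ 4 w 0
  map_zero : w 0 = 0
  fderiv_zero : fderiv ℝ w 0 = 0
  eventually_radial : ∀ᶠ z in 𝓝 0,
    graphPt ρ x₀ w z ≠ 0 ∧ radialGraph ρ (graphDir ρ x₀ w z) = graphPt ρ x₀ w z
  eventually_cover : ∀ᶠ x in 𝓝 x₀,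
    graphDir ρ x₀ w ((TanG ρ x₀).orthogonalProjectionOnto (radialGraph ρ x - radialGraph ρ x₀)) = x

variable {ρ : Sph n → ℝ}

lemma radialGraph_ne_zero (hρ : ∀ x, 0 < ρ x) (x : Sph n) : radialGraph ρ x ≠ 0 :=
  smul_ne_zero (hρ x).ne' (sph_ne_zero x)

lemma continuous_radialGraph (h : Continuous ρ) : Continuous (radialGraph ρ) := by
  unfold radialGraph
  fun_prop

/-- The radial graph lies in the zero set of `|y| - ρ(y/|y|)`, whose differential at the point is a
positive multiple of the inner product with the normal. -/
theorem exists_isLocalGraph (h : ContMDiff (𝓡 n) 𝓘(ℝ, ℝ) 4 ρ) (hρ : ∀ x, 0 < ρ x) (x₀ : Sph n) :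
    ∃ w, IsLocalGraph ρ x₀ w := by
  have hX := radialGraph_ne_zero hρ x₀
  have h1 : ContMDiff (𝓡 n) 𝓘(ℝ, ℝ) 1 ρ := h.of_le (by norm_num)
  have hψ0 : ∀ x, ‖radialGraph ρ x‖ - radialExt ρ (radialGraph ρ x) = 0 := by
    intro x
    rw [norm_radialGraph hρ, radialGraph, radialExt_smul ρ (hρ x), radialExt_coe, sub_self]
  obtain ⟨w, hw, hw0, hwd, hwz, hwy⟩ := exists_graph (norm_outerNormal hρ x₀) (r := 4) (by simp)
    (contDiffAt_defining h hX) (hψ0 x₀) (div_pos (gradLen_pos hρ x₀) (hρ x₀))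
    (fderiv_defining h1 hρ x₀)
  refine ⟨w, hw, hw0, hwd, ?_, ?_⟩
  · have hc : ContinuousAt (graphPt ρ x₀ w) 0 := by
      unfold graphPt graphMap
      have := hw.continuousAt
      fun_prop
    have hne : ∀ᶠ z in 𝓝 0, graphPt ρ x₀ w z ≠ 0 := by
      refine hc.eventually_ne ?_
      simpa [graphPt, graphMap, hw0] using hX
    filter_upwards [hne, hwz] with z hz hz'
    refine ⟨hz, ?_⟩
    have h2 : ‖graphPt ρ x₀ w z‖ = ρ (graphDir ρ x₀ w z) := by
      rw [graphDir, ← radialExt_of_ne_zero ρ x₀ hz]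
      exact sub_eq_zero.1 hz'
    rw [radialGraph, ← h2, graphDir, coe_unitDir x₀ hz, smul_smul,
      mul_inv_cancel₀ (norm_ne_zero_iff.2 hz), one_smul]
  · have hc := (continuous_radialGraph h.continuous).tendsto x₀
    filter_upwards [hc.eventually hwy] with x hx
    have h3 := hx (hψ0 x)
    unfold graphDir graphPt
    rw [h3]
    exact unitDir_smul x₀ x (hρ x)

namespace IsLocalGraph

variable {x₀ : Sph n} {w : TanG ρ x₀ → ℝ}

lemma eventually_contDiffAt (hw : IsLocalGraph ρ x₀ w) : ∀ᶠ z in 𝓝 0, ContDiffAt ℝ 4 w z :=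
  hw.contDiffAt.eventually (by simp)

lemma graphPt_zero (hw : IsLocalGraph ρ x₀ w) : graphPt ρ x₀ w 0 = radialGraph ρ x₀ := by
  simp [graphPt, graphMap, hw.map_zero]

lemma graphDir_zero (hw : IsLocalGraph ρ x₀ w) (hρ : ∀ x, 0 < ρ x) : graphDir ρ x₀ w 0 = x₀ := by
  rw [graphDir, hw.graphPt_zero, radialGraph, unitDir_smul x₀ x₀ (hρ x₀)]

lemma continuousAt_graphPt (hw : IsLocalGraph ρ x₀ w) : ContinuousAt (graphPt ρ x₀ w) 0 := by
  unfold graphPt graphMap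
  have := hw.contDiffAt.continuousAt
  fun_prop

lemma continuousAt_graphDir (hw : IsLocalGraph ρ x₀ w) (hρ : ∀ x, 0 < ρ x) :
    ContinuousAt (graphDir ρ x₀ w) 0 := by
  refine ContinuousAt.comp (g := unitDir x₀) (continuousAt_unitDir x₀ ?_) hw.continuousAt_graphPt
  rw [hw.graphPt_zero]
  exact radialGraph_ne_zero hρ x₀

end IsLocalGraph

lemma hasFDerivAt_graphPt {x₀ : Sph n} {w : TanG ρ x₀ → ℝ} {z : TanG ρ x₀}
    (hw : DifferentiableAt ℝ w z) :
    HasFDerivAt (graphPt ρ x₀ w)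
      ((TanG ρ x₀).subtypeL - (fderiv ℝ w z).smulRight (outerNormal ρ x₀)) z := by
  have h1 := (TanG ρ x₀).subtypeL.hasFDerivAt (x := z)
  exact (h1.const_add (radialGraph ρ x₀)).sub (hw.hasFDerivAt.smul_const (outerNormal ρ x₀))

variable {ι : Type*} [Fintype ι]

/-- The slope `1 + |Dw|²` of a local graph, in an orthonormal basis. -/
noncomputable def slopeSq {x₀ : Sph n} (b : OrthonormalBasis ι ℝ (TanG ρ x₀)) (w : TanG ρ x₀ → ℝ)
    (z : TanG ρ x₀) : ℝ := 1 + ∑ i, fderiv ℝ w z (b i) ^ 2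

/-- The upward normal `e + Dw` of a local graph. -/
noncomputable def rawNormal {x₀ : Sph n} (b : OrthonormalBasis ι ℝ (TanG ρ x₀)) (w : TanG ρ x₀ → ℝ)
    (z : TanG ρ x₀) : Amb n := outerNormal ρ x₀ + ∑ i, fderiv ℝ w z (b i) • (b i : Amb n)

lemma slopeSq_pos {x₀ : Sph n} (b : OrthonormalBasis ι ℝ (TanG ρ x₀)) (w : TanG ρ x₀ → ℝ)
    (z : TanG ρ x₀) : 0 < slopeSq b w z := by
  have : 0 ≤ ∑ i, fderiv ℝ w z (b i) ^ 2 := Finset.sum_nonneg fun i _ => sq_nonneg _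
  unfold slopeSq
  linarith

lemma inner_rawNormal {x₀ : Sph n} (hρ : ∀ x, 0 < ρ x) (b : OrthonormalBasis ι ℝ (TanG ρ x₀))
    (w : TanG ρ x₀ → ℝ) (z a : TanG ρ x₀) (c : ℝ) :
    ⟪(a : Amb n) + c • outerNormal ρ x₀, rawNormal b w z⟫_ℝ = fderiv ℝ w z a + c := by
  have h1 : ⟪(a : Amb n), outerNormal ρ x₀⟫_ℝ = 0 := by
    rw [real_inner_comm]; exact inner_coe_orthogonal _ a
  have h2 : fderiv ℝ w z a = ∑ i, fderiv ℝ w z (b i) * ⟪(a : Amb n), (b i : Amb n)⟫_ℝ := by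
    conv_lhs => rw [← b.sum_repr' a]
    rw [map_sum]
    refine Finset.sum_congr rfl fun i _ => ?_
    rw [map_smul, smul_eq_mul, mul_comm, real_inner_comm, coe_inner]
  unfold rawNormal
  rw [inner_add_right, inner_add_left, h1, inner_smul_left, real_inner_self_eq_norm_sq,
    norm_outerNormal hρ, inner_sum, h2]
  simp only [inner_add_left, inner_smul_right, inner_smul_left, inner_coe_orthogonal]
  simp [add_comm]

lemma norm_sq_rawNormal {x₀ : Sph n} (hρ : ∀ x, 0 < ρ x) (b : OrthonormalBasis ι ℝ (TanG ρ x₀))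
    (w : TanG ρ x₀ → ℝ) (z : TanG ρ x₀) : ‖rawNormal b w z‖ ^ 2 = slopeSq b w z := by
  have h := inner_rawNormal hρ b w z (∑ i, fderiv ℝ w z (b i) • b i) 1
  have e : ((∑ i, fderiv ℝ w z (b i) • b i : TanG ρ x₀) : Amb n) + (1 : ℝ) • outerNormal ρ x₀ =
      rawNormal b w z := by
    rw [one_smul, add_comm, rawNormal]
    simp
  rw [e, real_inner_self_eq_norm_sq] at h
  rw [h, slopeSq, map_sum, add_comm]
  congr 1
  refine Finset.sum_congr rfl fun i _ => ?_
  rw [map_smul, smul_eq_mul, pow_two]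

/-- Differentiating the defining function along the graph shows that the normal is orthogonal to the
tangent vectors `b i - w_i e`, hence proportional to `e + Dw`. Unit length fixes the factor up to
sign. -/
theorem IsLocalGraph.eventually_outerNormal {x₀ : Sph n} {w : TanG ρ x₀ → ℝ}
    (hw : IsLocalGraph ρ x₀ w) (h : ContMDiff (𝓡 n) 𝓘(ℝ, ℝ) 1 ρ) (hρ : ∀ x, 0 < ρ x)
    (b : OrthonormalBasis ι ℝ (TanG ρ x₀)) :
    ∀ᶠ z in 𝓝 0, outerNormal ρ (graphDir ρ x₀ w z) = (√(slopeSq b w z))⁻¹ • rawNormal b w z := by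
  have hc : ContinuousAt (fun z => ⟪outerNormal ρ x₀, outerNormal ρ (graphDir ρ x₀ w z)⟫_ℝ) 0 := by
    have h1 : ContinuousAt (fun z => outerNormal ρ (graphDir ρ x₀ w z)) 0 :=
      ContinuousAt.comp (g := outerNormal ρ) (continuous_outerNormal h hρ).continuousAt
        (hw.continuousAt_graphDir hρ)
    exact continuousAt_const.inner h1
  -- Continuity selects the sign: the normal stays close to the one at `x₀`.
  have hpos : ∀ᶠ z in 𝓝 0, 0 < ⟪outerNormal ρ x₀, outerNormal ρ (graphDir ρ x₀ w z)⟫_ℝ := by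
    refine hc.eventually_const_lt ?_
    simp only
    rw [hw.graphDir_zero hρ, real_inner_self_eq_norm_sq, norm_outerNormal hρ]
    norm_num
  filter_upwards [hpos, hw.eventually_radial.eventually_nhds, hw.eventually_contDiffAt]
    with z hz hev hws
  set x := graphDir ρ x₀ w z with hx
  set ν := outerNormal ρ x with hν
  set e := outerNormal ρ x₀ with he
  have hXz : radialGraph ρ x = graphPt ρ x₀ w z := hev.self_of_nhds.2
  have hψ : ∀ᶠ z' in 𝓝 z, ‖graphPt ρ x₀ w z'‖ - radialExt ρ (graphPt ρ x₀ w z') = 0 := by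
    filter_upwards [hev] with z' hz'
    rw [← hz'.2, norm_radialGraph hρ, radialGraph, radialExt_smul ρ (hρ _), radialExt_coe, sub_self]
  have hY := hasFDerivAt_graphPt (hws.differentiableAt (by simp))
  have hd : HasFDerivAt (fun y : Amb n => ‖y‖ - radialExt ρ y)
      (fderiv ℝ (fun y : Amb n => ‖y‖ - radialExt ρ y) (graphPt ρ x₀ w z)) (graphPt ρ x₀ w z) := by
    refine ((contDiffAt_defining h ?_).differentiableAt (by simp)).hasFDerivAt
    exact hev.self_of_nhds.1
  have h0 := (hd.comp z hY).unique ((hasFDerivAt_const (0 : ℝ) z).congr_of_eventuallyEq hψ)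
  have hb : ∀ i, ⟪(b i : Amb n), ν⟫_ℝ = fderiv ℝ w z (b i) * ⟪e, ν⟫_ℝ := by
    intro i
    have h1 := congrArg (fun L : TanG ρ x₀ →L[ℝ] ℝ => L (b i)) h0
    simp only [ContinuousLinearMap.comp_apply, _root_.sub_apply, subtypeL_apply,
      ContinuousLinearMap.smulRight_apply, ← hXz, fderiv_defining h hρ, _root_.zero_apply,
      mul_eq_zero, div_eq_zero_iff, (gradLen_pos hρ x).ne', (hρ x).ne', false_or, or_self] at h1
    rw [inner_sub_right, inner_smul_right] at h1
    rw [real_inner_comm, real_inner_comm ν e]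
    linarith
  have hν2 : ν = ⟪e, ν⟫_ℝ • rawNormal b w z := by
    have h1 := sum_basis_orthogonal (norm_outerNormal hρ x₀) b ν
    rw [rawNormal, smul_add, Finset.smul_sum]
    simp only [hb] at h1
    conv_lhs => rw [h1]
    congr 1
    refine Finset.sum_congr rfl fun i _ => ?_
    rw [smul_smul, mul_comm]
  have hs := slopeSq_pos b w z
  have hn : ⟪e, ν⟫_ℝ * √(slopeSq b w z) = 1 := by
    have h1 : ‖ν‖ = 1 := norm_outerNormal hρ x
    rw [hν2, norm_smul, Real.norm_of_nonneg hz.le, ← Real.sqrt_sq (norm_nonneg (rawNormal b w z)),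
      norm_sq_rawNormal hρ] at h1
    exact h1
  have : (√(slopeSq b w z))⁻¹ = ⟪e, ν⟫_ℝ := by
    rw [inv_eq_one_div, div_eq_iff (Real.sqrt_pos.2 hs).ne']; exact hn.symm
  rw [this]
  exact hν2

/-- Chain rule for maps on the sphere along the graph parametrization. -/
lemma hasFDerivAt_comp_graphDir {F : Type*} [NormedAddCommGroup F] [NormedSpace ℝ F]
    {φ : Sph n → F} {x₀ : Sph n} {w : TanG ρ x₀ → ℝ} {z : TanG ρ x₀}
    (hw : DifferentiableAt ℝ w z) (hz : graphPt ρ x₀ w z ≠ 0)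
    (hφ : DifferentiableAt ℝ (radialExt φ) (graphDir ρ x₀ w z : Amb n)) :
    HasFDerivAt (fun z => φ (graphDir ρ x₀ w z))
      ((sphDeriv φ (graphDir ρ x₀ w z)).comp
        (‖graphPt ρ x₀ w z‖⁻¹ • (Tan (graphDir ρ x₀ w z)).orthogonalProjectionOnto.comp
          ((TanG ρ x₀).subtypeL - (fderiv ℝ w z).smulRight (outerNormal ρ x₀)))) z := by
  set x := graphDir ρ x₀ w z with hx
  set y := graphPt ρ x₀ w z with hy
  have hyn : 0 < ‖y‖⁻¹ := inv_pos.2 (norm_pos_iff.2 hz)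
  have hxy : (x : Amb n) = ‖y‖⁻¹ • y := by rw [hx, graphDir, coe_unitDir x₀ hz]
  have hY := hasFDerivAt_graphPt hw
  have hc := hY.continuousAt
  have hsc : HasFDerivAt (fun z' => ‖y‖⁻¹ • graphPt ρ x₀ w z') _ z := hY.const_smul ‖y‖⁻¹
  have hd : HasFDerivAt (radialExt φ) (fderiv ℝ (radialExt φ) (x : Amb n)) (‖y‖⁻¹ • y) := by
    rw [← hxy]; exact hφ.hasFDerivAt
  have h1 := (hd.comp z hsc).congr_of_eventuallyEq
    (f₁ := fun z => φ (graphDir ρ x₀ w z)) (by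
      filter_upwards [hc.eventually_ne hz] with z' hz'
      rw [Function.comp_apply, radialExt_smul φ hyn, radialExt_of_ne_zero φ x₀ hz', graphDir])
  refine h1.congr_fderiv ?_
  ext a
  simp only [ContinuousLinearMap.comp_apply, sphDeriv, _root_.smul_apply, subtypeL_apply,
    map_smul]
  congr 1
  set v := ((TanG ρ x₀).subtypeL - (fderiv ℝ w z).smulRight (outerNormal ρ x₀)) a
  have h2 := coe_orthogonalProjection_add (norm_sph x) v
  conv_lhs => rw [← h2]
  rw [map_add, map_smul, fderiv_radialExt_self, smul_zero, add_zero]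

variable [DecidableEq ι]

/-- The matrix of second derivatives of `w`. -/
noncomputable def graphHess {x₀ : Sph n} (b : OrthonormalBasis ι ℝ (TanG ρ x₀)) (w : TanG ρ x₀ → ℝ)
    (z : TanG ρ x₀) : Matrix ι ι ℝ :=
  Matrix.of fun i j => fderiv ℝ (fun z => fderiv ℝ w z (b i)) z (b j)

/-- The shape operator of a graph, in the coordinates given by an orthonormal basis. -/
noncomputable def graphShape {x₀ : Sph n} (b : OrthonormalBasis ι ℝ (TanG ρ x₀)) (w : TanG ρ x₀ → ℝ)
    (z : TanG ρ x₀) : Matrix ι ι ℝ :=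
  Matrix.of fun i j => (√(slopeSq b w z))⁻¹ * (graphHess b w z i j -
    fderiv ℝ w z (b i) * ((slopeSq b w z)⁻¹ * ∑ m, fderiv ℝ w z (b m) * graphHess b w z m j))

lemma graphHess_symm {x₀ : Sph n} (b : OrthonormalBasis ι ℝ (TanG ρ x₀)) {w : TanG ρ x₀ → ℝ}
    {z : TanG ρ x₀} (hw : ContDiffAt ℝ 2 w z) (i j : ι) :
    graphHess b w z i j = graphHess b w z j i := by
  have hd : DifferentiableAt ℝ (fderiv ℝ w) z :=
    (hw.fderiv_right (m := 1) (by norm_num)).differentiableAt (by simp)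
  have h1 : ∀ i j, graphHess b w z i j = fderiv ℝ (fderiv ℝ w) z (b j) (b i) := by
    intro i j
    have := (hd.hasFDerivAt.clm_apply (hasFDerivAt_const (b i) z)).fderiv
    rw [graphHess, Matrix.of_apply, this]
    simp
  rw [h1, h1]
  exact (hw.isSymmSndFDerivAt (by simp)) _ _

/-- The Sherman–Morrison formula for the inverse of `1 + p pᵀ`, applied to `s W`. -/
lemma graph_metric_mul_shape {p : ι → ℝ} {W S : Matrix ι ι ℝ} {s : ℝ}
    (hS : ∀ i j, S i j = s * (W i j - p i * ((1 + ∑ m, p m ^ 2)⁻¹ * ∑ m, p m * W m j))) :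
    (1 + Matrix.vecMulVec p p) * S = s • W := by
  have hP : (1 + ∑ m, p m ^ 2) ≠ 0 := by
    have : 0 ≤ ∑ m, p m ^ 2 := Finset.sum_nonneg fun i _ => sq_nonneg _
    linarith
  ext i j
  rw [Matrix.add_mul, Matrix.one_mul, Matrix.add_apply, Matrix.mul_apply]
  simp only [Matrix.vecMulVec_apply, Matrix.smul_apply, smul_eq_mul, hS]
  set V := ∑ m, p m * W m j
  have h1 : ∑ x, p i * p x * (s * (W x j - p x * ((1 + ∑ m, p m ^ 2)⁻¹ * V))) =
      s * (p i * (V - (∑ m, p m ^ 2) * ((1 + ∑ m, p m ^ 2)⁻¹ * V))) := by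
    have h2 : ∀ x, p i * p x * (s * (W x j - p x * ((1 + ∑ m, p m ^ 2)⁻¹ * V))) =
        s * p i * (p x * W x j) - s * p i * ((1 + ∑ m, p m ^ 2)⁻¹ * V) * p x ^ 2 := fun x => by ring
    simp only [h2]
    rw [Finset.sum_sub_distrib, ← Finset.mul_sum, ← Finset.mul_sum]
    ring
  rw [h1]
  field_simp
  ring

end LocalGraph

/-! ### The curvatures of a radial graph in local graph coordinates -/

section LocalCurvature

open Filter Topology

lemma matrix_of_bilinear {ι V W : Type*} [Fintype ι] [NormedAddCommGroup V]
    [InnerProductSpace ℝ V] [NormedAddCommGroup W] [InnerProductSpace ℝ W]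
    (τ : OrthonormalBasis ι ℝ V) (L₁ L₂ : V →L[ℝ] W) (v : ι → V) :
    (Matrix.of fun i j => ⟪L₁ (v i), L₂ (v j)⟫_ℝ) =
      (Matrix.of fun a i => ⟪τ a, v i⟫_ℝ).transpose * (Matrix.of fun a c => ⟪L₁ (τ a), L₂ (τ c)⟫_ℝ) *
        Matrix.of fun a i => ⟪τ a, v i⟫_ℝ := by
  ext i j
  simp only [Matrix.mul_apply, Matrix.transpose_apply, Matrix.of_apply]
  conv_lhs => rw [← τ.sum_repr' (v i), ← τ.sum_repr' (v j)]
  simp only [map_sum, map_smul, sum_inner, inner_sum, inner_smul_left, inner_smul_right,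
    RCLike.conj_to_real, Finset.sum_mul, Finset.mul_sum]
  refine Finset.sum_congr rfl fun a _ => Finset.sum_congr rfl fun c _ => ?_
  ring

variable {n : ℕ} {ρ : Sph n → ℝ} {x₀ : Sph n} {w : TanG ρ x₀ → ℝ}

lemma hasFDerivAt_rawNormal {z : TanG ρ x₀} (b : OrthonormalBasis (Fin n) ℝ (TanG ρ x₀))
    (hw : ContDiffAt ℝ 2 w z) :
    HasFDerivAt (rawNormal b w)
      (∑ i, (fderiv ℝ (fun z => fderiv ℝ w z (b i)) z).smulRight (b i : Amb n)) z := by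
  have hd : DifferentiableAt ℝ (fderiv ℝ w) z :=
    (hw.fderiv_right (m := 1) (by norm_num)).differentiableAt (by simp)
  have hp : ∀ i, DifferentiableAt ℝ (fun z => fderiv ℝ w z (b i)) z := fun i =>
    hd.clm_apply (differentiableAt_const _)
  unfold rawNormal
  exact (HasFDerivAt.fun_sum fun i _ => (hp i).hasFDerivAt.smul_const (b i : Amb n)).const_add _

lemma differentiableAt_slopeSq {z : TanG ρ x₀} (b : OrthonormalBasis (Fin n) ℝ (TanG ρ x₀))
    (hw : ContDiffAt ℝ 2 w z) : DifferentiableAt ℝ (slopeSq b w) z := by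
  have hd : DifferentiableAt ℝ (fderiv ℝ w) z :=
    (hw.fderiv_right (m := 1) (by norm_num)).differentiableAt (by simp)
  unfold slopeSq
  fun_prop

/-- In the basis carried over from the tangent plane by the graph, the metric is `1 + DwᵀDw` and the
second form is `D²w/√(1+|Dw|²)`: the derivative of the normalizing factor multiplies a normal vector
and drops out. -/
theorem IsLocalGraph.eventually_sigmaCurv (hw : IsLocalGraph ρ x₀ w)
    (h : ContMDiff (𝓡 n) 𝓘(ℝ, ℝ) 2 ρ) (hρ : ∀ x, 0 < ρ x)
    (b : OrthonormalBasis (Fin n) ℝ (TanG ρ x₀)) :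
    ∀ᶠ z in 𝓝 0, ∀ j ≤ n,
      sigmaCurv j ρ (graphDir ρ x₀ w z) = ematrix (graphShape b w z) j := by
  have h1 : ContMDiff (𝓡 n) 𝓘(ℝ, ℝ) 1 ρ := h.of_le (by norm_num)
  filter_upwards [(hw.eventually_outerNormal h1 hρ b).eventually_nhds,
    hw.eventually_radial.eventually_nhds, hw.eventually_contDiffAt] with z hν hr hs4
  intro j hj
  have hs : ContDiffAt ℝ 2 w z := hs4.of_le (by norm_num)
  have hwd : DifferentiableAt ℝ w z := hs.differentiableAt (by simp)
  set x := graphDir ρ x₀ w z with hx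
  set e := outerNormal ρ x₀ with he
  set D : TanG ρ x₀ →L[ℝ] Amb n := (TanG ρ x₀).subtypeL - (fderiv ℝ w z).smulRight e with hD
  set A : TanG ρ x₀ →L[ℝ] Tan x :=
    ‖graphPt ρ x₀ w z‖⁻¹ • (Tan x).orthogonalProjectionOnto.comp D with hA
  set s : TanG ρ x₀ → ℝ := fun z => (√(slopeSq b w z))⁻¹ with hsdef
  have hXA : ∀ a, sphDeriv (radialGraph ρ) x (A a) = D a := by
    intro a
    have e1 := hasFDerivAt_comp_graphDir hwd hr.self_of_nhds.1
      (differentiableAt_radialExt_radialGraph h1 x)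
    have e2 := (hasFDerivAt_graphPt hwd).congr_of_eventuallyEq (hr.mono fun z' hz' => hz'.2)
    exact congrArg (fun L : TanG ρ x₀ →L[ℝ] Amb n => L a) (e1.unique e2)
  have hsd : DifferentiableAt ℝ s z :=
    ((differentiableAt_slopeSq b hs).sqrt (slopeSq_pos b w z).ne').inv
      (Real.sqrt_pos.2 (slopeSq_pos b w z)).ne'
  have hNA : ∀ a, sphDeriv (outerNormal ρ) x (A a) =
      s z • (∑ i, fderiv ℝ (fun z => fderiv ℝ w z (b i)) z a • (b i : Amb n)) +
        fderiv ℝ s z a • rawNormal b w z := by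
    intro a
    have e1 := hasFDerivAt_comp_graphDir hwd hr.self_of_nhds.1
      (differentiableAt_radialExt_outerNormal h hρ x)
    have e2 := (hsd.hasFDerivAt.smul (hasFDerivAt_rawNormal b hs)).congr_of_eventuallyEq hν
    have e3 := congrArg (fun L : TanG ρ x₀ →L[ℝ] Amb n => L a) (e1.unique e2)
    refine e3.trans ?_
    simp
  have hDa : ∀ a : TanG ρ x₀, D a = (a : Amb n) + (-fderiv ℝ w z a) • e := by
    intro a
    simp [hD, sub_eq_add_neg]
  have heb : ∀ i, ⟪e, (b i : Amb n)⟫_ℝ = 0 := fun i => inner_coe_orthogonal e (b i)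
  have hbb : ∀ i j, ⟪(b i : Amb n), (b j : Amb n)⟫_ℝ = if i = j then 1 else 0 := fun i j => by
    rw [← coe_inner]; exact orthonormal_iff_ite.1 b.orthonormal i j
  have hDN : ∀ a, ⟪D a, rawNormal b w z⟫_ℝ = 0 := by
    intro a
    rw [hDa, inner_rawNormal hρ]; ring
  have hDb : ∀ i m, ⟪D (b i), (b m : Amb n)⟫_ℝ = if i = m then 1 else 0 := by
    intro i m
    rw [hDa, inner_add_left, inner_smul_left, heb, mul_zero, add_zero, hbb]
  set p : Fin n → ℝ := fun i => fderiv ℝ w z (b i) with hp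
  have hg : (Matrix.of fun i j => ⟪sphDeriv (radialGraph ρ) x (A (b i)),
      sphDeriv (radialGraph ρ) x (A (b j))⟫_ℝ) = 1 + Matrix.vecMulVec p p := by
    ext i j
    rw [Matrix.of_apply, hXA, hXA, hDa (b j), inner_add_right, hDb, inner_smul_right, hDa (b i),
      inner_add_left, inner_smul_left, real_inner_comm, heb, real_inner_self_eq_norm_sq,
      norm_outerNormal hρ, Matrix.add_apply, Matrix.one_apply, Matrix.vecMulVec_apply]
    simp [hp]
    ring
  have hh : (Matrix.of fun i j => ⟪sphDeriv (radialGraph ρ) x (A (b i)),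
      sphDeriv (outerNormal ρ) x (A (b j))⟫_ℝ) = s z • graphHess b w z := by
    ext i j
    rw [Matrix.of_apply, hXA, hNA, inner_add_right, inner_smul_right, inner_smul_right, hDN,
      inner_sum]
    simp only [inner_smul_right, hDb]
    simp [graphHess]
  have hgpos : (1 + Matrix.vecMulVec p p : Matrix (Fin n) (Fin n) ℝ).PosDef := by
    have := Matrix.posSemidef_vecMulVec_self_star p
    rw [star_trivial] at this
    exact Matrix.PosDef.one.add_posSemidef this
  have hsym : (s z • graphHess b w z).IsHermitian := by
    ext i j
    simp [graphHess_symm b hs i j]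
  have hS : (1 + Matrix.vecMulVec p p) * graphShape b w z = s z • graphHess b w z :=
    graph_metric_mul_shape fun i j => rfl
  have key := esymm_roots_det_sub
    (hg.symm.trans (matrix_of_bilinear (tanBasis x) _ _ fun i => A (b i)))
    (hh.symm.trans (matrix_of_bilinear (tanBasis x) _ _ fun i => A (b i)))
    hgpos hsym hS (j := j) (by simpa using hj)
  exact key

lemma graphHess_zero_diagonal_shape (hw : IsLocalGraph ρ x₀ w)
    (b : OrthonormalBasis (Fin n) ℝ (TanG ρ x₀)) : graphShape b w 0 = graphHess b w 0 := by
  ext i j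
  simp [graphShape, hw.fderiv_zero, slopeSq]

lemma continuousAt_graphShape (hw : IsLocalGraph ρ x₀ w)
    (b : OrthonormalBasis (Fin n) ℝ (TanG ρ x₀)) : ContinuousAt (graphShape b w) 0 := by
  have h1 : ContDiffAt ℝ 1 (fderiv ℝ w) 0 := hw.contDiffAt.fderiv_right (by norm_num)
  have hp : ∀ i, ContDiffAt ℝ 1 (fun z => fderiv ℝ w z (b i)) 0 := fun i =>
    h1.clm_apply contDiffAt_const
  have hpc : ∀ i, ContinuousAt (fun z => fderiv ℝ w z (b i)) 0 := fun i => (hp i).continuousAt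
  have hW : ∀ i j, ContinuousAt (fun z => graphHess b w z i j) 0 := by
    intro i j
    have := ((hp i).fderiv_right (m := 0) (by norm_num)).continuousAt
    exact this.clm_apply continuousAt_const
  have hq : ContinuousAt (slopeSq b w) 0 := by
    unfold slopeSq
    fun_prop
  have hq0 := slopeSq_pos b w 0
  refine continuousAt_pi.2 fun i => continuousAt_pi.2 fun j => ?_
  have hs : ContinuousAt (fun z => √(slopeSq b w z)) 0 := Real.continuous_sqrt.continuousAt.comp hq
  have hsum : ContinuousAt (fun z => ∑ m, fderiv ℝ w z (b m) * graphHess b w z m j) 0 :=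
    tendsto_finsetSum _ fun m _ => (hpc m).mul (hW m j)
  exact (hs.inv₀ (Real.sqrt_pos.2 hq0).ne').mul
    ((hW i j).sub ((hpc i).mul ((hq.inv₀ hq0.ne').mul hsum)))

/-- Continuity is not visible on a multiset of roots, but it is on the coefficients of the shape
matrix, which depend continuously on the point. The covering property of the local graph brings this
back to the sphere. -/
theorem continuous_sigmaCurv (h : ContMDiff (𝓡 n) 𝓘(ℝ, ℝ) 4 ρ) (hρ : ∀ x, 0 < ρ x) {j : ℕ}
    (hj : j ≤ n) : Continuous (sigmaCurv j ρ) := by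
  rw [continuous_iff_continuousAt]
  intro x₀
  obtain ⟨w, hw⟩ := exists_isLocalGraph h hρ x₀
  have hfin : Module.finrank ℝ (TanG ρ x₀) = n := by
    refine finrank_orthogonal_span_singleton (n := n) (v := outerNormal ρ x₀) fun h0 => ?_
    have := norm_outerNormal hρ x₀
    rw [h0] at this
    simp at this
  have b := (stdOrthonormalBasis ℝ (TanG ρ x₀)).reindex (finCongr hfin)
  have hev := hw.eventually_sigmaCurv (h.of_le (by norm_num)) hρ b
  set P : Sph n → TanG ρ x₀ := fun x =>
    (TanG ρ x₀).orthogonalProjectionOnto (radialGraph ρ x - radialGraph ρ x₀) with hP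
  have hPc : Continuous P := by
    have := continuous_radialGraph h.continuous
    fun_prop
  have hP0 : P x₀ = 0 := by simp [hP]
  have hPt : Tendsto P (𝓝 x₀) (𝓝 0) := by simpa [hP0] using hPc.tendsto x₀
  have hc : ContinuousAt (fun x => ematrix (graphShape b w (P x)) j) x₀ := by
    have h1 : ContinuousAt (fun z => ematrix (graphShape b w z) j) (P x₀) := by
      rw [hP0]
      exact (continuous_ematrix j).continuousAt.comp (continuousAt_graphShape hw b)
    exact ContinuousAt.comp (f := P) h1 hPc.continuousAt
  refine hc.congr ?_
  filter_upwards [hPt.eventually hev, hw.eventually_cover] with x hx hx'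
  rw [← hx j hj, hx']

end LocalCurvature

/-! ### Expansions along straight lines -/

section DirectionalDerivatives

open Filter Topology

variable {V : Type*} [NormedAddCommGroup V] [NormedSpace ℝ V]

/-- The derivative of `φ` in the direction `u`, as a function of the base point. -/
noncomputable def dirD (u : V) (φ : V → ℝ) : V → ℝ := fun z => fderiv ℝ φ z u

lemma ContDiffAt.dirD {φ : V → ℝ} {z : V} {m k : ℕ∞ω} (h : ContDiffAt ℝ k φ z) (hm : m + 1 ≤ k)
    (u : V) : ContDiffAt ℝ m (dirD u φ) z :=
  (h.fderiv_right hm).clm_apply contDiffAt_const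

lemma Filter.EventuallyEq.dirD {φ ψ : V → ℝ} {z : V} (h : φ =ᶠ[𝓝 z] ψ) (u : V) :
    dirD u φ =ᶠ[𝓝 z] dirD u ψ :=
  (h.fderiv (𝕜 := ℝ)).mono fun y hy => by simp only [_root_.dirD, hy]

lemma dirD_comm {φ : V → ℝ} {z : V} (h : ContDiffAt ℝ 2 φ z) (u v : V) :
    dirD u (dirD v φ) z = dirD v (dirD u φ) z := by
  have hd : DifferentiableAt ℝ (fderiv ℝ φ) z :=
    (h.fderiv_right (m := 1) (by norm_num)).differentiableAt (by simp)
  have h1 : ∀ u v, dirD u (dirD v φ) z = fderiv ℝ (fderiv ℝ φ) z u v := by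
    intro u v
    have := (hd.hasFDerivAt.clm_apply (hasFDerivAt_const v z)).fderiv
    change fderiv ℝ (fun z => fderiv ℝ φ z v) z u = _
    rw [this]
    simp
  rw [h1, h1]
  exact (h.isSymmSndFDerivAt (by simp)) u v

lemma dirD_comm_eventually {φ : V → ℝ} {z : V} (h : ContDiffAt ℝ 2 φ z) (u v : V) :
    dirD u (dirD v φ) =ᶠ[𝓝 z] dirD v (dirD u φ) :=
  (h.eventually (by simp)).mono fun _ hy => dirD_comm hy u v

lemma dirD_four_comm {φ : V → ℝ} {z : V} (h : ContDiffAt ℝ 4 φ z) (u v : V) :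
    dirD u (dirD u (dirD v (dirD v φ))) z = dirD v (dirD v (dirD u (dirD u φ))) z := by
  have h2 : ContDiffAt ℝ 2 φ z := h.of_le (by norm_num)
  have h3 : ∀ u, ContDiffAt ℝ 2 (dirD u φ) z := fun u => h.dirD (by norm_num) u
  have h4 : ∀ u v, ContDiffAt ℝ 2 (dirD u (dirD v φ)) z := fun u v =>
    (h.dirD (m := 3) (by norm_num) v).dirD (by norm_num) u
  calc dirD u (dirD u (dirD v (dirD v φ))) z
      = dirD u (dirD v (dirD u (dirD v φ))) z :=
        ((dirD_comm_eventually (h3 v) u v).dirD u).self_of_nhds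
    _ = dirD v (dirD u (dirD u (dirD v φ))) z := dirD_comm (h4 u v) u v
    _ = dirD v (dirD u (dirD v (dirD u φ))) z :=
        (((dirD_comm_eventually h2 u v).dirD u).dirD v).self_of_nhds
    _ = dirD v (dirD v (dirD u (dirD u φ))) z :=
        ((dirD_comm_eventually (h3 u) u v).dirD v).self_of_nhds

lemma hasDerivAt_comp_smul {F : Type*} [NormedAddCommGroup F] [NormedSpace ℝ F] {φ : V → F} {v : V}
    {t : ℝ} (h : DifferentiableAt ℝ φ (t • v)) :
    HasDerivAt (fun t : ℝ => φ (t • v)) (fderiv ℝ φ (t • v) v) t := by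
  have h1 : HasDerivAt (fun t : ℝ => t • v) v t := by
    simpa using (hasDerivAt_id t).smul_const v
  exact h.hasFDerivAt.comp_hasDerivAt t h1

lemma tendsto_smul_zero (v : V) : Tendsto (fun t : ℝ => t • v) (𝓝 0) (𝓝 0) := by
  have : Continuous fun t : ℝ => t • v := by fun_prop
  simpa using this.tendsto 0

lemma jet_line {φ : V → ℝ} (h : ContDiffAt ℝ 2 φ 0) (v : V) :
    Jet (fun t : ℝ => φ (t • v)) (φ 0) (dirD v φ 0) (dirD v (dirD v φ) 0) := by
  have h1 : ∀ᶠ z in 𝓝 (0 : V), ContDiffAt ℝ 2 φ z := h.eventually (by simp)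
  have h2 : DifferentiableAt ℝ (dirD v φ) ((0 : ℝ) • v) := by
    rw [zero_smul]
    exact (h.dirD (m := 1) (by norm_num) v).differentiableAt (by simp)
  have := jet_of_hasDerivAt (f := fun t : ℝ => φ (t • v)) (f' := fun t => dirD v φ (t • v))
    (((tendsto_smul_zero v).eventually h1).mono fun t ht =>
      hasDerivAt_comp_smul (ht.differentiableAt (by simp)))
    (hasDerivAt_comp_smul h2)
  simpa [dirD] using this

lemma jet_comp_curve {g : V → ℝ} {γ γ' : ℝ → V} {γ'' : V} (hg : ContDiffAt ℝ 2 g (γ 0))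
    (hγ : ∀ᶠ t in 𝓝 0, HasDerivAt γ (γ' t) t) (hγ' : HasDerivAt γ' γ'' 0) :
    Jet (fun t => g (γ t)) (g (γ 0)) (fderiv ℝ g (γ 0) (γ' 0))
      (fderiv ℝ (fderiv ℝ g) (γ 0) (γ' 0) (γ' 0) + fderiv ℝ g (γ 0) γ'') := by
  have hγ0 := hγ.self_of_nhds
  have hfd : ∀ᶠ y in 𝓝 (γ 0), DifferentiableAt ℝ g y :=
    (hg.eventually (by simp)).mono fun y hy => hy.differentiableAt (by simp)
  have hD : HasFDerivAt (fderiv ℝ g) (fderiv ℝ (fderiv ℝ g) (γ 0)) (γ 0) :=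
    ((hg.fderiv_right (m := 1) (by norm_num)).differentiableAt (by simp)).hasFDerivAt
  refine jet_of_hasDerivAt (f := fun t => g (γ t)) (f' := fun t => fderiv ℝ g (γ t) (γ' t)) ?_
    ((hD.comp_hasDerivAt (0 : ℝ) hγ0).clm_apply hγ')
  filter_upwards [hγ, hγ0.continuousAt.tendsto.eventually hfd] with t h1 h2
  exact h2.hasFDerivAt.comp_hasDerivAt t h1

/-- At a critical point of `f` the second derivative of `φ` never enters, so one derivative at the
point is enough. -/
lemma Jet.comp_of_first_order_zero {φ f : ℝ → ℝ} {a c d : ℝ} (hφ : HasDerivAt φ d a)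
    (hf : Jet f a 0 c) : Jet (fun t => φ (f t)) (φ a) 0 (d * c) := by
  have hs : Jet (fun t => f t - a) 0 0 c := by simpa using hf.sub (jet_const a)
  have hO : (fun t => f t - a) =O[𝓝 0] fun t : ℝ => t ^ 2 := by
    have h1 : (fun t : ℝ => c / 2 * t ^ 2) =O[𝓝 0] fun t : ℝ => t ^ 2 :=
      (Asymptotics.isBigO_refl _ _).const_mul_left _
    refine ((Asymptotics.IsLittleO.isBigO hs).add h1).congr_left fun t => ?_
    ring
  have h1 := ((hasDerivAt_iff_isLittleO.1 hφ).comp_tendsto hf.tendsto).trans_isBigO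
    (hO.congr_left fun t => rfl)
  refine ((show Jet (fun t => φ (f t) - φ a - (f t - a) * d) 0 0 0 by
    simpa [Jet, Function.comp_def] using h1).add ((jet_const (φ a)).add (hs.const_mul d))).cast
    (by ring) (by ring) (by ring) |>.congr (Eventually.of_forall fun t => ?_)
  ring

end DirectionalDerivatives

/-! ### Expansion of the geometric quantities along a local graph -/

section GraphJets

open Filter Topology Finset

variable {n : ℕ} {ρ : Sph n → ℝ} {x₀ : Sph n} {w : TanG ρ x₀ → ℝ}

namespace IsLocalGraph

lemma jet_map (hw : IsLocalGraph ρ x₀ w) (v : TanG ρ x₀) :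
    Jet (fun t : ℝ => w (t • v)) 0 0 (dirD v (dirD v w) 0) := by
  have := jet_line (hw.contDiffAt.of_le (by norm_num : (2 : ℕ∞ω) ≤ 4)) v
  exact this.cast hw.map_zero (by simp [dirD, hw.fderiv_zero]) rfl

lemma inner_radialGraph_outerNormal (ρ : Sph n → ℝ) (x : Sph n) :
    ⟪radialGraph ρ x, outerNormal ρ x⟫_ℝ = supportFn ρ x := rfl

/-- Expand `|X + tv - w(tv)e|²` with `w(tv)` of order `t²`. The square of `ρ` is used because this
is polynomial in the graph data. -/
lemma jet_sq (hw : IsLocalGraph ρ x₀ w) (hρ : ∀ x, 0 < ρ x) (v : TanG ρ x₀) :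
    Jet (fun t : ℝ => ρ (graphDir ρ x₀ w (t • v)) ^ 2) (ρ x₀ ^ 2)
      (2 * ⟪radialGraph ρ x₀, (v : Amb n)⟫_ℝ)
      (2 * ‖(v : Amb n)‖ ^ 2 - 2 * supportFn ρ x₀ * dirD v (dirD v w) 0) := by
  have hj := hw.jet_map v
  have h1 := (((jet_const (ρ x₀ ^ 2)).add
    (jet_id.const_mul (2 * ⟪radialGraph ρ x₀, (v : Amb n)⟫_ℝ))).add
    ((jet_id.mul jet_id).const_mul (‖(v : Amb n)‖ ^ 2))).add
    ((hj.const_mul (-2 * supportFn ρ x₀)).add (hj.mul hj))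
  refine (h1.cast (by ring) (by ring) (by ring)).congr ?_
  filter_upwards [(tendsto_smul_zero v).eventually hw.eventually_radial] with t ht
  rw [← norm_radialGraph hρ (graphDir ρ x₀ w (t • v)), ht.2, graphPt, graphMap]
  have e1 : ⟪(v : Amb n), outerNormal ρ x₀⟫_ℝ = 0 := by
    rw [real_inner_comm]; exact inner_coe_orthogonal (outerNormal ρ x₀) v
  rw [norm_sub_sq_real, norm_add_sq_real, inner_smul_right, inner_add_left,
    inner_radialGraph_outerNormal, norm_radialGraph hρ, norm_smul, norm_outerNormal hρ,
    Submodule.coe_smul, inner_smul_right, inner_smul_left, e1, norm_smul, mul_pow, mul_pow,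
    Real.norm_eq_abs, Real.norm_eq_abs, sq_abs, sq_abs]
  ring

lemma jet_comp (hw : IsLocalGraph ρ x₀ w) (hρ : ∀ x, 0 < ρ x) {f : Sph n → ℝ}
    (hf : ContMDiff (𝓡 n) 𝓘(ℝ, ℝ) 2 f) (v : TanG ρ x₀) :
    Jet (fun t : ℝ => f (graphDir ρ x₀ w (t • v))) (f x₀)
      (⟪sphGrad f x₀, (v : Amb n)⟫_ℝ / ρ x₀)
      (fderiv ℝ (fderiv ℝ (radialExt f)) (x₀ : Amb n) v v / ρ x₀ ^ 2 -
        dirD v (dirD v w) 0 * ⟪sphGrad f x₀, outerNormal ρ x₀⟫_ℝ / ρ x₀) := by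
  set e := outerNormal ρ x₀ with he
  set c := (ρ x₀)⁻¹ with hc
  have hcpos : 0 < c := inv_pos.2 (hρ x₀)
  have hx0 : c • graphPt ρ x₀ w ((0 : ℝ) • v) = (x₀ : Amb n) := by
    rw [zero_smul, hw.graphPt_zero, radialGraph, smul_smul, hc, inv_mul_cancel₀ (hρ x₀).ne', one_smul]
  have hγ : ∀ᶠ t in 𝓝 (0 : ℝ), HasDerivAt (fun t : ℝ => c • graphPt ρ x₀ w (t • v))
      (c • ((v : Amb n) - dirD v w (t • v) • e)) t := by
    filter_upwards [(tendsto_smul_zero v).eventually hw.eventually_contDiffAt] with t ht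
    have h1 := hasFDerivAt_graphPt (ht.differentiableAt (by simp))
    have h2 := hasDerivAt_comp_smul h1.differentiableAt
    rw [h1.fderiv] at h2
    exact h2.const_smul c
  have hγ0 := hγ.self_of_nhds
  have hp : HasDerivAt (fun t : ℝ => c • ((v : Amb n) - dirD v w (t • v) • e))
      (c • (0 - dirD v (dirD v w) 0 • e)) 0 := by
    have h1 : DifferentiableAt ℝ (dirD v w) ((0 : ℝ) • v) := by
      rw [zero_smul]
      exact (hw.contDiffAt.dirD (m := 1) (by norm_num) v).differentiableAt (by simp)
    have h2 := hasDerivAt_comp_smul h1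
    have h3 : fderiv ℝ (dirD v w) ((0 : ℝ) • v) v = dirD v (dirD v w) 0 := by rw [zero_smul]; rfl
    rw [h3] at h2
    exact ((hasDerivAt_const (0 : ℝ) (v : Amb n)).sub (h2.smul_const e)).const_smul c
  have hfx : ContDiffAt ℝ 2 (radialExt f) (c • graphPt ρ x₀ w ((0 : ℝ) • v)) := by
    rw [hx0]
    exact contDiffAt_radialExt hf (sph_ne_zero x₀)
  have key := jet_comp_curve hfx hγ hp
  have hdz : dirD v w ((0 : ℝ) • v) = 0 := by simp [dirD, hw.fderiv_zero]
  refine (key.cast ?_ ?_ ?_).congr ?_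
  · rw [hx0, radialExt_coe]
  · rw [hx0, hdz, inner_sphGrad]
    simp [hc, div_eq_inv_mul]
  · rw [hx0, hdz, inner_sphGrad]
    simp only [zero_smul, sub_zero, zero_sub, map_smul, map_neg, smul_eq_mul, _root_.smul_apply,
      smul_neg]
    rw [hc]
    field_simp
    ring
  · filter_upwards [(tendsto_smul_zero v).eventually hw.eventually_radial] with t ht
    rw [radialExt_smul f hcpos, radialExt_of_ne_zero f x₀ ht.1, graphDir]

end IsLocalGraph

lemma graphHess_eq_dirD (b : OrthonormalBasis (Fin n) ℝ (TanG ρ x₀)) (w : TanG ρ x₀ → ℝ)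
    (z : TanG ρ x₀) (i j : Fin n) : graphHess b w z i j = dirD (b j) (dirD (b i) w) z := rfl

namespace IsLocalGraph

variable {b : OrthonormalBasis (Fin n) ℝ (TanG ρ x₀)} {κ : Fin n → ℝ}

lemma jet_slope (hw : IsLocalGraph ρ x₀ w) (hκ : graphHess b w 0 = Matrix.diagonal κ)
    (i l : Fin n) :
    Jet (fun t : ℝ => fderiv ℝ w (t • b l) (b i)) 0 (if i = l then κ i else 0)
      (dirD (b l) (dirD (b l) (dirD (b i) w)) 0) := by
  have h1 := jet_line (hw.contDiffAt.dirD (m := 2) (by norm_num) (b i)) (b l)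
  refine h1.cast (by simp [dirD, hw.fderiv_zero]) ?_ rfl
  rw [← graphHess_eq_dirD, hκ, Matrix.diagonal_apply]

lemma jet_slopeSq (hw : IsLocalGraph ρ x₀ w) (hκ : graphHess b w 0 = Matrix.diagonal κ)
    (l : Fin n) : Jet (fun t : ℝ => slopeSq b w (t • b l)) 1 0 (2 * κ l ^ 2) := by
  have h1 := (jet_const 1).add (Jet.sum (s := univ) fun i _ =>
    (hw.jet_slope hκ i l).mul (hw.jet_slope hκ i l))
  refine (h1.cast (by simp) (by simp) ?_).congr (Eventually.of_forall fun t => ?_)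
  · simp only [zero_mul, mul_zero, zero_add, add_zero]
    rw [sum_eq_single l (fun i _ hi => by simp [hi]) (by simp)]
    simp; ring
  · simp only [slopeSq, pow_two]

lemma jet_inv_sqrt_slopeSq (hw : IsLocalGraph ρ x₀ w)
    (hκ : graphHess b w 0 = Matrix.diagonal κ) (l : Fin n) :
    Jet (fun t : ℝ => (√(slopeSq b w (t • b l)))⁻¹) 1 0 (-κ l ^ 2) := by
  have h1 : HasDerivAt (fun s : ℝ => (√s)⁻¹) (-(1 / 2)) 1 := by
    have := (Real.hasDerivAt_sqrt (one_ne_zero)).inv (by simp : √(1 : ℝ) ≠ 0)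
    refine this.congr_deriv ?_
    norm_num
  exact ((hw.jet_slopeSq hκ l).comp_of_first_order_zero h1).cast (by simp) rfl (by ring)

lemma jet_inv_slopeSq (hw : IsLocalGraph ρ x₀ w)
    (hκ : graphHess b w 0 = Matrix.diagonal κ) (l : Fin n) :
    Jet (fun t : ℝ => (slopeSq b w (t • b l))⁻¹) 1 0 (-(2 * κ l ^ 2)) := by
  have h1 : HasDerivAt (fun s : ℝ => s⁻¹) (-1) 1 := by
    simpa using hasDerivAt_inv (one_ne_zero (α := ℝ))
  exact ((hw.jet_slopeSq hκ l).comp_of_first_order_zero h1).cast (by simp) rfl (by ring)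

lemma jet_graphHess (hw : IsLocalGraph ρ x₀ w) (hκ : graphHess b w 0 = Matrix.diagonal κ)
    (i j l : Fin n) :
    Jet (fun t : ℝ => graphHess b w (t • b l) i j) (if i = j then κ i else 0)
      (dirD (b l) (dirD (b j) (dirD (b i) w)) 0)
      (dirD (b l) (dirD (b l) (dirD (b j) (dirD (b i) w))) 0) := by
  have h1 := jet_line ((hw.contDiffAt.dirD (m := 3) (by norm_num) (b i)).dirD (m := 2)
    (by norm_num) (b j)) (b l)
  refine h1.cast ?_ rfl rfl
  rw [← graphHess_eq_dirD, hκ, Matrix.diagonal_apply]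

/-- In a basis diagonalizing `D²w(0)`, the slopes vanish to first order. The cubic terms in `κ` come
from the expansions of `1/√(1+|Dw|²)` and of the rank one correction to the inverse metric. -/
lemma jet_graphShape (hw : IsLocalGraph ρ x₀ w) (hκ : graphHess b w 0 = Matrix.diagonal κ)
    (i j l : Fin n) :
    Jet (fun t : ℝ => graphShape b w (t • b l) i j) (if i = j then κ i else 0)
      (dirD (b l) (dirD (b j) (dirD (b i) w)) 0)
      (dirD (b l) (dirD (b l) (dirD (b j) (dirD (b i) w))) 0 -
        2 * ((if i = l then κ i else 0) * (if l = j then κ l ^ 2 else 0)) -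
        κ l ^ 2 * (if i = j then κ i else 0)) := by
  obtain ⟨c, hsum⟩ : ∃ c, Jet (fun t : ℝ => ∑ m, fderiv ℝ w (t • b l) (b m) *
      graphHess b w (t • b l) m j) 0 (if l = j then κ l ^ 2 else 0) c := by
    refine ⟨_, (Jet.sum (s := univ) fun m _ =>
      (hw.jet_slope hκ m l).mul (hw.jet_graphHess hκ m j l)).cast (by simp) ?_ rfl⟩
    simp only [zero_mul, zero_add]
    rw [sum_eq_single l (fun i _ hi => by simp [hi]) (by simp)]
    simp [pow_two]
  have h1 := (hw.jet_inv_sqrt_slopeSq hκ l).mul ((hw.jet_graphHess hκ i j l).sub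
    ((hw.jet_slope hκ i l).mul ((hw.jet_inv_slopeSq hκ l).mul hsum)))
  exact h1.cast (by ring) (by ring) (by ring)

/-- Along the line, `u = (u₀ + Σ a_m w_m + t w_l - w)/√(1+|Dw|²)`. -/
lemma jet_supportFn (hw : IsLocalGraph ρ x₀ w) (hκ : graphHess b w 0 = Matrix.diagonal κ)
    (h : ContMDiff (𝓡 n) 𝓘(ℝ, ℝ) 1 ρ) (hρ : ∀ x, 0 < ρ x) (l : Fin n) :
    Jet (fun t : ℝ => supportFn ρ (graphDir ρ x₀ w (t • b l))) (supportFn ρ x₀)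
      (⟪radialGraph ρ x₀, (b l : Amb n)⟫_ℝ * κ l)
      (∑ m, ⟪radialGraph ρ x₀, (b m : Amb n)⟫_ℝ *
        dirD (b l) (dirD (b l) (dirD (b m) w)) 0 + κ l - supportFn ρ x₀ * κ l ^ 2) := by
  set a : Fin n → ℝ := fun m => ⟪radialGraph ρ x₀, (b m : Amb n)⟫_ℝ with ha
  have h1 := (hw.jet_inv_sqrt_slopeSq hκ l).mul (((jet_const (supportFn ρ x₀)).add
    (Jet.sum (s := univ) fun m _ => (hw.jet_slope hκ m l).const_mul (a m))).add
    ((jet_id.mul (hw.jet_slope hκ l l)).sub (hw.jet_map (b l))))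
  have hll : dirD (b l) (dirD (b l) w) 0 = κ l := by
    rw [← graphHess_eq_dirD, hκ, Matrix.diagonal_apply_eq]
  have hs1 : ∑ m, a m * (if m = l then κ m else 0) = a l * κ l := by
    rw [sum_eq_single l (fun i _ hi => by simp [hi]) (by simp)]
    simp
  refine (h1.cast (by simp) ?_ ?_).congr ?_
  · simp only [hs1]; simp [ha]
  · simp only [hs1, hll]; simp; ring
  · filter_upwards [(tendsto_smul_zero (b l)).eventually hw.eventually_radial,
      (tendsto_smul_zero (b l)).eventually (hw.eventually_outerNormal h hρ b)] with t ht1 ht2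
    change _ = ⟪radialGraph ρ (graphDir ρ x₀ w (t • b l)),
      outerNormal ρ (graphDir ρ x₀ w (t • b l))⟫_ℝ
    rw [ht1.2, ht2, inner_smul_right]
    congr 1
    have e1 : graphPt ρ x₀ w (t • b l) = radialGraph ρ x₀ +
        (((t • b l : TanG ρ x₀) : Amb n) + (-w (t • b l)) • outerNormal ρ x₀) := by
      rw [graphPt, graphMap, neg_smul]; abel
    rw [e1, inner_add_left, inner_rawNormal hρ, rawNormal, inner_add_right,
      inner_radialGraph_outerNormal, inner_sum]
    simp only [inner_smul_right, map_smul, smul_eq_mul, ha]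
    rw [sum_congr rfl fun m _ => mul_comm (fderiv ℝ w (t • b l) (b m)) _]
    ring

end IsLocalGraph

lemma finrank_tanG (hρ : ∀ x, 0 < ρ x) (x₀ : Sph n) : Module.finrank ℝ (TanG ρ x₀) = n := by
  refine finrank_orthogonal_span_singleton (n := n) (v := outerNormal ρ x₀) fun h0 => ?_
  have := norm_outerNormal hρ x₀
  rw [h0] at this
  simp at this

lemma exists_diagonal_basis (hw : IsLocalGraph ρ x₀ w) (hρ : ∀ x, 0 < ρ x) :
    ∃ (b : OrthonormalBasis (Fin n) ℝ (TanG ρ x₀)) (κ : Fin n → ℝ),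
      graphHess b w 0 = Matrix.diagonal κ := by
  have hw2 : ContDiffAt ℝ 2 w 0 := hw.contDiffAt.of_le (by norm_num)
  have hd : DifferentiableAt ℝ (fderiv ℝ w) 0 :=
    (hw2.fderiv_right (m := 1) (by norm_num)).differentiableAt (by simp)
  let A : TanG ρ x₀ →ₗ[ℝ] TanG ρ x₀ :=
    ((InnerProductSpace.toDual ℝ (TanG ρ x₀)).symm.toLinearEquiv.toLinearMap).comp
      (fderiv ℝ (fderiv ℝ w) 0).toLinearMap
  have hA : ∀ u v, ⟪A u, v⟫_ℝ = fderiv ℝ (fderiv ℝ w) 0 u v := fun u v =>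
    InnerProductSpace.toDual_symm_apply
  have hsym : A.IsSymmetric := by
    intro u v
    rw [hA, real_inner_comm, hA]
    exact (hw2.isSymmSndFDerivAt (by simp)) u v
  refine ⟨hsym.eigenvectorBasis (finrank_tanG hρ x₀), hsym.eigenvalues (finrank_tanG hρ x₀), ?_⟩
  set b := hsym.eigenvectorBasis (finrank_tanG hρ x₀) with hb
  ext i j
  have h1 : graphHess b w 0 i j = fderiv ℝ (fderiv ℝ w) 0 (b j) (b i) := by
    have := (hd.hasFDerivAt.clm_apply (hasFDerivAt_const (b i) 0)).fderiv
    rw [graphHess, Matrix.of_apply, this]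
    simp
  rw [h1, ← hA, hb, hsym.apply_eigenvectorBasis, inner_smul_left, Matrix.diagonal_apply,
    ← hb, orthonormal_iff_ite.1 b.orthonormal]
  by_cases hij : i = j
  · subst hij; simp
  · simp [hij, Ne.symm hij]

end GraphJets

/-! ### Second order data of a radial graph at a point, in principal directions -/

section PrincipalFrame

open Filter Topology Finset

variable {n : ℕ} {ρ : Sph n → ℝ} {x₀ : Sph n}

/-- Expansions at the point over `x₀` of the geometric quantities of the radial graph of `ρ`, along
curves tangent to the principal directions `b l`. The numbers `T i j l` and `Q i l` are the third
derivatives `w_ijl` and the fourth derivatives `w_iill` of a local graph representation. -/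
structure PrincipalFrame (ρ : Sph n → ℝ) (x₀ : Sph n) where
  b : Fin n → Amb n
  κ : Fin n → ℝ
  T : Fin n → Fin n → Fin n → ℝ
  Q : Fin n → Fin n → ℝ
  curve : Fin n → ℝ → Sph n
  S : Fin n → ℝ → Matrix (Fin n) (Fin n) ℝ
  θ : Fin n → Fin n → Fin n → ℝ
  norm_b : ∀ i, ‖b i‖ = 1
  sum_basis : ∀ v, v = ⟪outerNormal ρ x₀, v⟫_ℝ • outerNormal ρ x₀ + ∑ i, ⟪b i, v⟫_ℝ • b i
  T_swap : ∀ i j l, T i j l = T j i l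
  T_swap' : ∀ i j l, T i j l = T i l j
  Q_symm : ∀ i l, Q i l = Q l i
  θ_diag : ∀ l i, θ l i i = Q i l - (if i = l then 2 * κ l ^ 3 else 0) - κ l ^ 2 * κ i
  sigmaCurv_eq : ∀ j ≤ n, sigmaCurv j ρ x₀ = esum κ univ j
  sigmaCurv_curve : ∀ l, ∀ᶠ t in 𝓝 0, ∀ j ≤ n, sigmaCurv j ρ (curve l t) = ematrix (S l t) j
  jet_S : ∀ l i j, Jet (fun t => S l t i j) (if i = j then κ i else 0) (T i j l) (θ l i j)
  jet_support : ∀ l, Jet (fun t => supportFn ρ (curve l t)) (supportFn ρ x₀)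
    (⟪radialGraph ρ x₀, b l⟫_ℝ * κ l)
    (∑ m, ⟪radialGraph ρ x₀, b m⟫_ℝ * T m l l + κ l - supportFn ρ x₀ * κ l ^ 2)
  jet_sq : ∀ l, Jet (fun t => ρ (curve l t) ^ 2) (ρ x₀ ^ 2) (2 * ⟪radialGraph ρ x₀, b l⟫_ℝ)
    (2 - 2 * supportFn ρ x₀ * κ l)
  jet_comp : ∀ (f : Sph n → ℝ), ContMDiff (𝓡 n) 𝓘(ℝ, ℝ) 2 f → ∀ l,
    Jet (fun t => f (curve l t)) (f x₀) (⟪sphGrad f x₀, b l⟫_ℝ / ρ x₀)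
      (fderiv ℝ (fderiv ℝ (radialExt f)) (x₀ : Amb n) (b l) (b l) / ρ x₀ ^ 2 -
        κ l * ⟪sphGrad f x₀, outerNormal ρ x₀⟫_ℝ / ρ x₀)
  hess_eq : ∀ v, ⟪outerNormal ρ x₀, v⟫_ℝ = 0 →
    ρ x₀ * (fderiv ℝ (fderiv ℝ (radialExt ρ)) (x₀ : Amb n) v v / ρ x₀ ^ 2 -
      (∑ i, κ i * ⟪b i, v⟫_ℝ ^ 2) * ⟪sphGrad ρ x₀, outerNormal ρ x₀⟫_ℝ / ρ x₀) +
      (⟪sphGrad ρ x₀, v⟫_ℝ / ρ x₀) ^ 2 = ‖v‖ ^ 2 - supportFn ρ x₀ * ∑ i, κ i * ⟪b i, v⟫_ℝ ^ 2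

theorem exists_principalFrame (h : ContMDiff (𝓡 n) 𝓘(ℝ, ℝ) 4 ρ) (hρ : ∀ x, 0 < ρ x) (x₀ : Sph n) :
    Nonempty (PrincipalFrame ρ x₀) := by
  obtain ⟨w, hw⟩ := exists_isLocalGraph h hρ x₀
  obtain ⟨b, κ, hκ⟩ := exists_diagonal_basis hw hρ
  have h2 : ContMDiff (𝓡 n) 𝓘(ℝ, ℝ) 2 ρ := h.of_le (by norm_num)
  have h1 : ContMDiff (𝓡 n) 𝓘(ℝ, ℝ) 1 ρ := h.of_le (by norm_num)
  have hw2 : ContDiffAt ℝ 2 w 0 := hw.contDiffAt.of_le (by norm_num)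
  have hll : ∀ l, dirD (b l) (dirD (b l) w) 0 = κ l := fun l => by
    rw [← graphHess_eq_dirD, hκ, Matrix.diagonal_apply_eq]
  have hbn : ∀ i, ‖(b i : Amb n)‖ = 1 := fun i => b.orthonormal.1 i
  have hσ := hw.eventually_sigmaCurv h2 hρ b
  have hquad : ∀ v : TanG ρ x₀, dirD v (dirD v w) 0 = ∑ i, κ i * ⟪(b i : Amb n), (v : Amb n)⟫_ℝ ^ 2 := by
    intro v
    have hd : DifferentiableAt ℝ (fderiv ℝ w) 0 :=
      (hw2.fderiv_right (m := 1) (by norm_num)).differentiableAt (by simp)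
    have e1 : ∀ u v, dirD u (dirD v w) 0 = fderiv ℝ (fderiv ℝ w) 0 u v := by
      intro u v
      have := (hd.hasFDerivAt.clm_apply (hasFDerivAt_const v 0)).fderiv
      change fderiv ℝ (fun z => fderiv ℝ w z v) 0 u = _
      rw [this]
      simp
    have e2 : ∀ i j, fderiv ℝ (fderiv ℝ w) 0 (b j) (b i) = if i = j then κ i else 0 := by
      intro i j
      rw [← e1, ← graphHess_eq_dirD, hκ, Matrix.diagonal_apply]
    rw [e1]
    conv_lhs => rw [← b.sum_repr' v]
    simp only [map_sum, map_smul, _root_.sum_apply, _root_.smul_apply, smul_eq_mul, e2]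
    refine sum_congr rfl fun i _ => ?_
    rw [sum_eq_single i (fun j _ hj => by simp [hj.symm]) (by simp)]
    rw [if_pos rfl, coe_inner]
    ring
  refine ⟨{
    b := fun i => b i
    κ := κ
    T := fun i j l => dirD (b l) (dirD (b j) (dirD (b i) w)) 0
    Q := fun i l => dirD (b l) (dirD (b l) (dirD (b i) (dirD (b i) w))) 0
    curve := fun l t => graphDir ρ x₀ w (t • b l)
    S := fun l t => graphShape b w (t • b l)
    θ := fun l i j => dirD (b l) (dirD (b l) (dirD (b j) (dirD (b i) w))) 0 -
        2 * ((if i = l then κ i else 0) * (if l = j then κ l ^ 2 else 0)) -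
        κ l ^ 2 * (if i = j then κ i else 0)
    norm_b := hbn
    sum_basis := fun v => sum_basis_orthogonal (norm_outerNormal hρ x₀) b v
    T_swap := fun i j l => ((dirD_comm_eventually hw2 (b j) (b i)).dirD (b l)).self_of_nhds
    T_swap' := fun i j l => dirD_comm (hw.contDiffAt.dirD (m := 2) (by norm_num) (b i)) (b l) (b j)
    Q_symm := fun i l => dirD_four_comm hw.contDiffAt (b l) (b i)
    θ_diag := fun l i => ?_
    sigmaCurv_eq := fun j hj => ?_
    sigmaCurv_curve := fun l => (tendsto_smul_zero (b l)).eventually hσ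
    jet_S := fun l i j => hw.jet_graphShape hκ i j l
    jet_support := fun l => hw.jet_supportFn hκ h1 hρ l
    jet_sq := fun l => ?_
    jet_comp := fun f hf l => ?_
    hess_eq := fun v hv => ?_ }⟩
  · by_cases hil : i = l
    · subst hil; simp; ring
    · simp [hil]
  · have := hσ.self_of_nhds j hj
    rwa [hw.graphDir_zero hρ, graphHess_zero_diagonal_shape hw, hκ, ematrix_diagonal] at this
  · have := hw.jet_sq hρ (b l)
    rw [hll, hbn] at this
    exact this.cast rfl rfl (by ring)
  · have := hw.jet_comp hρ hf (b l)
    rwa [hll] at this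
  · obtain ⟨v, rfl⟩ : ∃ v' : TanG ρ x₀, (v' : Amb n) = v :=
      ⟨⟨v, mem_orthogonal_singleton_iff_inner_right.2 hv⟩, rfl⟩
    have j1 := hw.jet_comp hρ h2 v
    have j2 := hw.jet_sq hρ v
    -- Two expansions of `ρ²` in the direction `v`, one through the Hessian of `ρ` and one through
    -- `|X|²`; equating second order terms expresses `∇²ρ` by the curvatures.
    have j3 : Jet (fun t : ℝ => ρ (graphDir ρ x₀ w (t • v)) ^ 2) _ _ _ :=
      (j1.mul j1).congr (Eventually.of_forall fun t => (pow_two _).symm)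
    have := (j2.unique j3).2.2
    rw [hquad] at this
    linarith

namespace PrincipalFrame

variable (G : PrincipalFrame ρ x₀)

/-- The tangential components of the position vector. -/
noncomputable def a (l : Fin n) : ℝ := ⟪radialGraph ρ x₀, G.b l⟫_ℝ

lemma sum_mul_inner (v w : Amb n) : ⟪v, w⟫_ℝ =
    ⟪outerNormal ρ x₀, v⟫_ℝ * ⟪outerNormal ρ x₀, w⟫_ℝ + ∑ i, ⟪G.b i, v⟫_ℝ * ⟪G.b i, w⟫_ℝ := by
  conv_lhs => rw [G.sum_basis v]
  simp only [inner_add_left, inner_smul_left, sum_inner, RCLike.conj_to_real]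

/-- Pythagoras for the position vector, of length `ρ` and normal component `u`. -/
lemma sum_a_sq (hρ : ∀ x, 0 < ρ x) : ∑ l, G.a l ^ 2 = ρ x₀ ^ 2 - supportFn ρ x₀ ^ 2 := by
  have h := G.sum_mul_inner (radialGraph ρ x₀) (radialGraph ρ x₀)
  rw [real_inner_self_eq_norm_sq, norm_radialGraph hρ, real_inner_comm (radialGraph ρ x₀),
    IsLocalGraph.inner_radialGraph_outerNormal] at h
  have e : ∑ l, G.a l ^ 2 = ∑ i, ⟪G.b i, radialGraph ρ x₀⟫_ℝ * ⟪G.b i, radialGraph ρ x₀⟫_ℝ := by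
    refine sum_congr rfl fun i _ => ?_
    rw [a, real_inner_comm, pow_two]
  rw [e]
  linarith

/-- The radial component of a spherical gradient vanishes. -/
lemma sum_a_mul_grad (f : Sph n → ℝ) :
    ∑ l, G.a l * ⟪sphGrad f x₀, G.b l⟫_ℝ =
      - (supportFn ρ x₀ * ⟪sphGrad f x₀, outerNormal ρ x₀⟫_ℝ) := by
  have h := G.sum_mul_inner (radialGraph ρ x₀) (sphGrad f x₀)
  have h0 : ⟪radialGraph ρ x₀, sphGrad f x₀⟫_ℝ = 0 := by
    rw [radialGraph, real_inner_smul_left, real_inner_comm, inner_sphGrad_self, mul_zero]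
  rw [h0, real_inner_comm (radialGraph ρ x₀), IsLocalGraph.inner_radialGraph_outerNormal,
    real_inner_comm (sphGrad f x₀)] at h
  have e : ∑ l, G.a l * ⟪sphGrad f x₀, G.b l⟫_ℝ =
      ∑ i, ⟪G.b i, radialGraph ρ x₀⟫_ℝ * ⟪G.b i, sphGrad f x₀⟫_ℝ := by
    refine sum_congr rfl fun i _ => ?_
    rw [a, real_inner_comm, real_inner_comm (G.b i) (sphGrad f x₀)]
  rw [e]
  linarith

end PrincipalFrame

end PrincipalFrame

/-! ### Admissibility and the `C⁰` estimate -/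

section Admissible

open Filter Topology Finset

lemma pow_le_esum {ι : Type*} {x : ι → ℝ} {s : Finset ι} {k : ℕ} {c : ℝ} (hc : 0 ≤ c)
    (hx : ∀ i ∈ s, c ≤ x i) (hk : k ≤ #s) : c ^ k ≤ esum x s k := by
  obtain ⟨t, ht, htk⟩ := exists_subset_card_eq hk
  calc c ^ k = ∏ _i ∈ t, c := by rw [prod_const, htk]
    _ ≤ ∏ i ∈ t, x i := prod_le_prod (fun _ _ => hc) fun i hi => hx i (ht hi)
    _ ≤ esum x s k := by
        refine single_le_sum (f := fun t => ∏ i ∈ t, x i) (fun t' ht' => prod_nonneg fun i hi => ?_)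
          (mem_powersetCard.2 ⟨ht, htk⟩)
        exact hc.trans (hx i ((mem_powersetCard.1 ht').1 hi))

variable {n : ℕ} {ρ f : Sph n → ℝ} {x₀ : Sph n}

lemma exists_forall_le_of_continuous {φ : Sph n → ℝ} (hφ : Continuous φ) (x : Sph n) :
    ∃ x₀, ∀ y, φ y ≤ φ x₀ := by
  obtain ⟨x₀, -, h⟩ := isCompact_univ.exists_isMaxOn ⟨x, Set.mem_univ x⟩ hφ.continuousOn
  exact ⟨x₀, fun y => h (Set.mem_univ y)⟩

lemma supportFn_le (hρ : ∀ x, 0 < ρ x) (x : Sph n) : supportFn ρ x ≤ ρ x := by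
  have h := supportFn_mul_gradLen hρ x
  have h1 : ρ x ≤ gradLen ρ x := by
    refine le_of_sq_le_sq ?_ (gradLen_pos hρ x).le
    rw [gradLen_sq]; nlinarith [sq_nonneg ‖sphGrad ρ x‖]
  have := supportFn_pos hρ x
  have := hρ x
  nlinarith

namespace PrincipalFrame

variable (G : PrincipalFrame ρ x₀)
include G

lemma supportFn_eq_of_a_eq_zero (hρ : ∀ x, 0 < ρ x) (ha : ∀ l, G.a l = 0) :
    supportFn ρ x₀ = ρ x₀ := by
  have h := G.sum_a_sq hρ
  simp only [ha, ne_eq, OfNat.ofNat_ne_zero, not_false_eq_true, zero_pow, sum_const_zero] at h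
  nlinarith [supportFn_pos hρ x₀, hρ x₀]

/-- Apply the second order test to `ρ²`. The first order condition makes `X` normal, so `u = ρ`, and
`2 - 2uκ_l ≤ 0` is the comparison with the circumscribed sphere. -/
lemma inv_le_of_isMax (hρ : ∀ x, 0 < ρ x) (hmax : ∀ y, ρ y ≤ ρ x₀) (l : Fin n) :
    supportFn ρ x₀ = ρ x₀ ∧ (ρ x₀)⁻¹ ≤ G.κ l := by
  have key : ∀ l, 2 * G.a l = 0 ∧ 2 - 2 * supportFn ρ x₀ * G.κ l ≤ 0 := fun l => by
    refine (((G.jet_sq l).sub (jet_const (ρ x₀ ^ 2))).cast (by ring) (sub_zero _)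
      (sub_zero _)).zero_of_eventually_nonpos (Eventually.of_forall fun t => ?_)
    have := hρ (G.curve l t)
    simp only [sub_nonpos]
    gcongr
    exact hmax _
  have hu := G.supportFn_eq_of_a_eq_zero hρ fun l => by linarith [(key l).1]
  refine ⟨hu, ?_⟩
  have := (key l).2
  rw [hu] at this
  rw [inv_le_iff_one_le_mul₀' (hρ x₀)]
  linarith

lemma le_inv_of_isMin (hρ : ∀ x, 0 < ρ x) (hmin : ∀ y, ρ x₀ ≤ ρ y) (l : Fin n) :
    supportFn ρ x₀ = ρ x₀ ∧ G.κ l ≤ (ρ x₀)⁻¹ := by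
  have key : ∀ l, -(2 * G.a l) = 0 ∧ -(2 - 2 * supportFn ρ x₀ * G.κ l) ≤ 0 := fun l => by
    refine (((jet_const (ρ x₀ ^ 2)).sub (G.jet_sq l)).cast (by ring) (zero_sub _)
      (zero_sub _)).zero_of_eventually_nonpos (Eventually.of_forall fun t => ?_)
    have := hρ x₀
    simp only [sub_nonpos]
    gcongr
    exact hmin _
  have hu := G.supportFn_eq_of_a_eq_zero hρ fun l => by linarith [(key l).1]
  refine ⟨hu, ?_⟩
  have := (key l).2
  rw [hu] at this
  rw [← one_div, le_div_iff₀ (hρ x₀)]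
  linarith

end PrincipalFrame

/-- A positive solution of a `σ_k` equation on a connected closed hypersurface lies in the Gårding
cone. -/
theorem sigmaCurv_pos_of_sigmaCurv_pos (h : ContMDiff (𝓡 n) 𝓘(ℝ, ℝ) 4 ρ) (hρ : ∀ x, 0 < ρ x)
    {k : ℕ} (hn : 1 ≤ n) (hkn : k ≤ n) (hk : ∀ x, 0 < sigmaCurv k ρ x) (x : Sph n) :
    ∀ j ≤ k, 0 < sigmaCurv j ρ x := by
  have hcont : ∀ j ≤ k, Continuous (sigmaCurv j ρ) := fun j hj =>
    continuous_sigmaCurv h hρ (hj.trans hkn)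
  set U : Set (Sph n) := {x | ∀ j ≤ k, 0 < sigmaCurv j ρ x} with hU
  have hopen : IsOpen U := by
    have : U = ⋂ j ∈ Set.Iic k, {x | 0 < sigmaCurv j ρ x} := by ext; simp [hU]
    rw [this]
    exact (Set.finite_Iic k).isOpen_biInter fun j hj =>
      isOpen_lt continuous_const (hcont j hj)
  have hU_le : ∀ y ∈ U, ∀ j < k, sigmaCurv (j + 1) ρ y ≤ sigmaCurv 1 ρ y * sigmaCurv j ρ y := by
    intro y hy j hj
    obtain ⟨G⟩ := exists_principalFrame h hρ y
    have hG : InGarding G.κ univ k := fun i hi => by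
      rw [← G.sigmaCurv_eq i (hi.trans hkn)]; exact hy i hi
    rw [G.sigmaCurv_eq _ (by lia), G.sigmaCurv_eq _ hn, G.sigmaCurv_eq _ (by lia)]
    exact hG.esum_succ_le hj
  have hclosed : IsClosed U := by
    refine isClosed_of_closure_subset fun y hy => ?_
    have hnn : ∀ j ≤ k, 0 ≤ sigmaCurv j ρ y := fun j hj =>
      closure_minimal (t := {x | 0 ≤ sigmaCurv j ρ x}) (fun z hz => (hz j hj).le)
        (isClosed_le continuous_const (hcont j hj)) hy
    have hle : ∀ j < k, sigmaCurv (j + 1) ρ y ≤ sigmaCurv 1 ρ y * sigmaCurv j ρ y := fun j hj =>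
      closure_minimal (t := {x | sigmaCurv (j + 1) ρ x ≤ sigmaCurv 1 ρ x * sigmaCurv j ρ x})
        (fun z hz => hU_le z hz j hj)
        (isClosed_le (hcont _ hj) ((continuous_sigmaCurv h hρ hn).mul (hcont _ hj.le))) hy
    -- Descend from `σ_k > 0`: if `σ_j` vanished at `y`, the limiting inequality would force
    -- `σ_{j+1} ≤ 0`.
    have hdown : ∀ i ≤ k, 0 < sigmaCurv (k - i) ρ y := by
      intro i
      induction i with
      | zero => intro _; exact hk y
      | succ i ih =>
        intro hi
        have h1 := ih (by lia)
        have h2 := hle (k - (i + 1)) (by lia)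
        rw [show k - (i + 1) + 1 = k - i by lia] at h2
        refine (hnn _ (by lia)).lt_of_ne fun h0 => ?_
        rw [← h0, mul_zero] at h2
        linarith
    intro j hj
    have := hdown (k - j) (by lia)
    rwa [show k - (k - j) = j by lia] at this
  have hne : U.Nonempty := by
    obtain ⟨x₀, hmax⟩ := exists_forall_le_of_continuous h.continuous x
    obtain ⟨G⟩ := exists_principalFrame h hρ x₀
    refine ⟨x₀, fun j hj => ?_⟩
    rw [G.sigmaCurv_eq j (hj.trans hkn)]
    have : 0 < (ρ x₀)⁻¹ := inv_pos.2 (hρ x₀)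
    exact (pow_pos this j).trans_le
      (pow_le_esum this.le (fun l _ => (G.inv_le_of_isMax hρ hmax l).2) (by simp; lia))
  have hconn : PreconnectedSpace (Sph n) := by
    refine isPreconnected_iff_preconnectedSpace.1 (isPreconnected_sphere ?_ _ _)
    rw [← Module.finrank_eq_rank, finrank_euclideanSpace_fin]
    exact_mod_cast (by lia : 1 < n + 1)
  have : U = Set.univ := IsClopen.eq_univ ⟨hclosed, hopen⟩ hne
  exact (this ▸ Set.mem_univ x : x ∈ U)

lemma SolvesCurvatureEq.eq_mul {k : ℕ} (hsol : SolvesCurvatureEq k f ρ) (hρ : ∀ x, 0 < ρ x)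
    (x : Sph n) : sigmaCurv k ρ x = f x / ρ x ^ (n + 1) * supportFn ρ x := by
  rw [hsol x, norm_radialGraph hρ]
  ring

lemma le_max_one_of_pow_le {r Λ : ℝ} {p : ℕ} (hp : 1 ≤ p) (h : r ^ p ≤ Λ) :
    r ≤ max 1 Λ := by
  by_contra! hr
  have h1 : 1 < r := (le_max_left _ _).trans_lt hr
  have h2 := le_self_pow₀ h1.le (by lia : p ≠ 0)
  have := le_max_right 1 Λ
  linarith

lemma min_one_le_of_le_pow {r c : ℝ} {p : ℕ} (hr0 : 0 ≤ r) (hp : 1 ≤ p) (h : c ≤ r ^ p) :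
    min 1 c ≤ r := by
  by_contra! hr
  have h1 : r < 1 := hr.trans_le (min_le_left _ _)
  have h2 := pow_le_of_le_one hr0 h1.le (by lia : p ≠ 0)
  have := min_le_right 1 c
  linarith

/-- At the maximum the equation reads `σ_k = f ρ^{-n}`, while a single product of `k` curvatures
already gives `σ_k ≥ ρ^{-k}`. Hence `ρ^{n-k} ≤ f`. -/
theorem radius_le (h : ContMDiff (𝓡 n) 𝓘(ℝ, ℝ) 4 ρ) (hρ : ∀ x, 0 < ρ x)
    {k : ℕ} (hn : 1 ≤ n) (hkn : k < n) (hsol : SolvesCurvatureEq k f ρ) {Λ : ℝ}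
    (hf : ∀ x, f x ≤ Λ) (x : Sph n) : ρ x ≤ max 1 Λ := by
  obtain ⟨x₀, hmax⟩ := exists_forall_le_of_continuous h.continuous x
  obtain ⟨G⟩ := exists_principalFrame h hρ x₀
  refine (hmax x).trans (le_max_one_of_pow_le (p := n - k) (by lia) ?_)
  have hu := (G.inv_le_of_isMax hρ hmax ⟨0, hn⟩).1
  have hr := hρ x₀
  have h1 := pow_le_esum (k := k) (inv_pos.2 hr).le
    (fun l (_ : l ∈ univ) => (G.inv_le_of_isMax hρ hmax l).2) (by simp; lia)
  rw [← G.sigmaCurv_eq k hkn.le, hsol.eq_mul hρ, hu] at h1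
  refine le_trans ?_ (hf x₀)
  rw [inv_pow, pow_succ, div_mul_eq_mul_div, mul_div_mul_right _ _ hr.ne',
    le_div_iff₀ (pow_pos hr n), ← pow_sub_mul_pow (ρ x₀) hkn.le, mul_comm, mul_assoc,
    mul_inv_cancel₀ (pow_pos hr k).ne', mul_one] at h1
  exact h1

/-- At the minimum, `f ρ^{-n} = σ_k ≤ σ_1^k ≤ (n/ρ)^k`. Admissibility is needed here because the
curvatures are bounded only from above. -/
theorem le_radius (h : ContMDiff (𝓡 n) 𝓘(ℝ, ℝ) 4 ρ) (hρ : ∀ x, 0 < ρ x)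
    {k : ℕ} (hk : 1 ≤ k) (hkn : k < n) (hsol : SolvesCurvatureEq k f ρ) {m : ℝ}
    (hf : ∀ x, m ≤ f x) (hadm : ∀ x, ∀ j ≤ k, 0 < sigmaCurv j ρ x) (x : Sph n) :
    min 1 (m / n ^ k) ≤ ρ x := by
  obtain ⟨x₀, hmin'⟩ := exists_forall_le_of_continuous h.continuous.neg x
  have hmin : ∀ y, ρ x₀ ≤ ρ y := fun y => neg_le_neg_iff.1 (hmin' y)
  obtain ⟨G⟩ := exists_principalFrame h hρ x₀
  refine (min_one_le_of_le_pow (p := n - k) (hρ x₀).le (by lia) ?_).trans (hmin x)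
  have hn : 1 ≤ n := by lia
  have hu := (G.le_inv_of_isMin hρ hmin ⟨0, hn⟩).1
  have hr := hρ x₀
  have hG : InGarding G.κ univ k := fun i hi => by
    rw [← G.sigmaCurv_eq i (hi.trans hkn.le)]; exact hadm x₀ i hi
  have h1 := hG.esum_le_pow hk
  have h2 : esum G.κ univ 1 ≤ n * (ρ x₀)⁻¹ := by
    rw [esum_one]
    refine (sum_le_sum fun l _ => (G.le_inv_of_isMin hρ hmin l).2).trans ?_
    simp
  have h3 := h1.trans (pow_le_pow_left₀ (hG 1 hk).le h2 k)
  rw [← G.sigmaCurv_eq k hkn.le, hsol.eq_mul hρ, hu, pow_succ, div_mul_eq_mul_div,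
    mul_div_mul_right _ _ hr.ne', div_le_iff₀ (pow_pos hr n), ← pow_sub_mul_pow (ρ x₀) hkn.le,
    mul_pow, inv_pow] at h3
  have hn' : (0 : ℝ) < n := by exact_mod_cast hn
  rw [div_le_iff₀ (pow_pos hn' k)]
  refine (hf x₀).trans (h3.trans_eq ?_)
  have := (pow_pos hr k).ne'
  field_simp

end Admissible

/-! ### The differentiated curvature equation and the two maximum principles -/

section MaximumPrinciple

open Filter Topology Finset

variable {n : ℕ} {ρ : Sph n → ℝ} {x₀ : Sph n}

namespace PrincipalFrame

variable (G : PrincipalFrame ρ x₀)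
include G

lemma ematrix_eventually {k : ℕ} (hk : k ≤ n) {Φ : Sph n → ℝ}
    (heq : ∀ x, sigmaCurv k ρ x = Φ x * supportFn ρ x) (l : Fin n) :
    ∀ᶠ t in 𝓝 0, ematrix (G.S l t) k = Φ (G.curve l t) * supportFn ρ (G.curve l t) := by
  filter_upwards [G.sigmaCurv_curve l] with t ht
  rw [← ht k hk, heq]

/-- The curvature equation differentiated twice in a principal direction. -/
theorem differentiated_eq {k : ℕ} (hk : k + 2 ≤ n) (hG : InGarding G.κ univ (k + 2))
    {Φ : Sph n → ℝ} (heq : ∀ x, sigmaCurv (k + 2) ρ x = Φ x * supportFn ρ x)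
    {Φ₀ Φ₁ Φ₂ : ℝ} {l : Fin n} (hΦ : Jet (fun t => Φ (G.curve l t)) Φ₀ Φ₁ Φ₂) :
    ∑ i, G.T i i l * esum G.κ (univ.erase i) (k + 1) =
        Φ₁ * supportFn ρ x₀ + Φ₀ * (G.a l * G.κ l) ∧
      Φ₂ * supportFn ρ x₀ + 2 * (Φ₁ * (G.a l * G.κ l)) +
          Φ₀ * (∑ m, G.a m * G.T m l l + G.κ l - supportFn ρ x₀ * G.κ l ^ 2) ≤
        ∑ i, G.θ l i i * esum G.κ (univ.erase i) (k + 1) +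
          esumHess G.κ univ k (fun i => G.T i i l) := by
  obtain ⟨c, hc, hj⟩ := jet_ematrix (S := G.S l) (κ := G.κ) (ξ := fun i j => G.T i j l)
    (θ := G.θ l) (k := k) (G.jet_S l) (fun i j => G.T_swap _ _ _) fun i j hij =>
      (((hG.erase (mem_univ i)).erase (mem_erase.2 ⟨hij.symm, mem_univ j⟩)) k le_rfl).le
  have h2 := (hΦ.mul (G.jet_support l)).congr
    ((G.ematrix_eventually hk heq l).mono fun t ht => ht.symm)
  obtain ⟨-, h3, h4⟩ := hj.unique h2
  refine ⟨h3.trans ?_, le_trans (le_of_eq ?_) (h4 ▸ hc)⟩ <;> simp only [a] <;> ring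

/-- The maximum principle at a minimum of the quotient of the support function by the radius. -/
theorem support_estimate (hρ : ∀ x, 0 < ρ x) {k : ℕ} (hk : k + 2 ≤ n)
    (hG : InGarding G.κ univ (k + 2)) {Φ : Sph n → ℝ}
    (heq : ∀ x, sigmaCurv (k + 2) ρ x = Φ x * supportFn ρ x) {Φ₁ Φ₂ : Fin n → ℝ}
    (hΦ : ∀ l, Jet (fun t => Φ (G.curve l t)) (Φ x₀) (Φ₁ l) (Φ₂ l))
    (hmin : ∀ x, supportFn ρ x₀ / ρ x₀ ≤ supportFn ρ x / ρ x) :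
    0 ≤ (k + 2) * supportFn ρ x₀ ^ 2 * Φ x₀ + ρ x₀ ^ 2 * ∑ l, G.a l * Φ₁ l +
      Φ x₀ * ∑ l, G.a l ^ 2 + (k + 2) * ρ x₀ ^ 2 * Φ x₀ := by
  set u := supportFn ρ x₀ with hu_def
  set r := ρ x₀ ^ 2 with hr_def
  set F : Fin n → ℝ := fun i => esum G.κ (univ.erase i) (k + 1) with hF_def
  have hu : 0 < u := supportFn_pos hρ x₀
  have hr : 0 < r := pow_pos (hρ x₀) 2
  have hF : ∀ i, 0 < F i := fun i => (hG.erase (mem_univ i)) _ le_rfl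
  -- Second order test for `u₀² ρ² - ρ₀² u²`, which is nonpositive and vanishes at the minimum
  -- point. Squaring avoids expanding `ρ` itself. The common factor `2u` is then divided out.
  have key : ∀ l, G.a l * (G.κ l * r) = G.a l * u ∧
      u * (1 - u * G.κ l) - r * (∑ m, G.a m * G.T m l l + G.κ l - u * G.κ l ^ 2) -
        u / r * G.a l ^ 2 ≤ 0 := fun l => by
    have hj := (((G.jet_sq l).const_mul (u ^ 2)).sub
      (((G.jet_support l).mul (G.jet_support l)).const_mul r)).cast (a' := 0) (by ring) rfl rfl
    have hz := hj.zero_of_eventually_nonpos (Eventually.of_forall fun t => ?_)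
    · obtain ⟨h1, h2⟩ := hz
      have h1' : G.a l * (G.κ l * r) = G.a l * u := by
        have : 2 * u * (G.a l * u - G.a l * (G.κ l * r)) = 0 := by
          rw [← h1]; simp only [a]; ring
        have := (mul_eq_zero.1 this).resolve_left (by positivity)
        linarith
      refine ⟨h1', ?_⟩
      have h3 : r * (G.a l * G.κ l) ^ 2 = u * (u / r * G.a l ^ 2) := by
        have : r ^ 2 * (G.a l * G.κ l) ^ 2 = (G.a l * u) ^ 2 := by rw [← h1']; ring
        field_simp
        linarith
      have h4 : 2 * u * (u * (1 - u * G.κ l) -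
          r * (∑ m, G.a m * G.T m l l + G.κ l - u * G.κ l ^ 2) - u / r * G.a l ^ 2) ≤ 0 := by
        refine le_trans (le_of_eq ?_) h2
        have h5 : ⟪radialGraph ρ x₀, G.b l⟫_ℝ = G.a l := rfl
        simp only [h5, ← hu_def, show ∀ m, ⟪radialGraph ρ x₀, G.b m⟫_ℝ = G.a m from fun _ => rfl]
        linear_combination 2 * h3
      exact nonpos_of_mul_nonpos_right h4 (by positivity)
    · have := hmin (G.curve l t)
      rw [div_le_div_iff₀ (hρ _) (hρ _)] at this
      have hp : 0 ≤ u * ρ (G.curve l t) := (mul_pos hu (hρ _)).le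
      have := mul_self_le_mul_self hp this
      nlinarith
  -- The total symmetry of the third derivatives turns `Σ F_l w_mll` into the first derivative of
  -- the equation in direction `m`.
  have hT : ∀ m, ∑ l, F l * G.T m l l = Φ₁ m * u + Φ x₀ * (G.a m * G.κ m) := fun m => by
    rw [← (G.differentiated_eq hk hG heq (hΦ m)).1]
    refine sum_congr rfl fun i _ => ?_
    rw [G.T_swap, G.T_swap']; ring
  have hFκ : ∑ l, F l * G.κ l = (k + 2) * (Φ x₀ * u) := by
    rw [← heq, G.sigmaCurv_eq _ hk]
    have := sum_mul_esum_erase G.κ univ (k + 1)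
    push_cast at this
    rw [show (k : ℝ) + 2 = k + 1 + 1 by ring, ← this]
    exact sum_congr rfl fun i _ => mul_comm _ _
  have hsum : ∑ l, F l * (u * (1 - u * G.κ l) -
      r * (∑ m, G.a m * G.T m l l + G.κ l - u * G.κ l ^ 2) - u / r * G.a l ^ 2) ≤ 0 :=
    sum_nonpos fun l _ => mul_nonpos_of_nonneg_of_nonpos (hF l).le (key l).2
  have hcomm : ∑ l, F l * ∑ m, G.a m * G.T m l l =
      u * ∑ m, G.a m * Φ₁ m + Φ x₀ * ∑ m, G.a m ^ 2 * G.κ m := by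
    simp only [mul_sum]
    rw [sum_comm, ← sum_add_distrib]
    refine sum_congr rfl fun m _ => ?_
    rw [show ∑ l, F l * (G.a m * G.T m l l) = G.a m * ∑ l, F l * G.T m l l by
      rw [mul_sum]; exact sum_congr rfl fun l _ => by ring, hT]
    ring
  have haκ : r * ∑ m, G.a m ^ 2 * G.κ m = u * ∑ m, G.a m ^ 2 := by
    simp only [mul_sum]
    exact sum_congr rfl fun m _ => by linear_combination G.a m * (key m).1
  have hexp : ∑ l, F l * (u * (1 - u * G.κ l) -
      r * (∑ m, G.a m * G.T m l l + G.κ l - u * G.κ l ^ 2) - u / r * G.a l ^ 2) =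
      ∑ l, F l * (u * (1 - G.a l ^ 2 / r) + r * u * G.κ l ^ 2) - u ^ 2 * ∑ l, F l * G.κ l -
        r * ∑ l, F l * ∑ m, G.a m * G.T m l l - r * ∑ l, F l * G.κ l := by
    simp only [mul_sum (s := (univ : Finset (Fin n))) (a := r), mul_sum (a := u ^ 2), ← sum_sub_distrib]
    refine sum_congr rfl fun l _ => ?_
    ring
  -- These terms have a good sign and are discarded, since `a_l² ≤ ρ² - u² ≤ r`.
  have hpos : 0 ≤ ∑ l, F l * (u * (1 - G.a l ^ 2 / r) + r * u * G.κ l ^ 2) := by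
    refine sum_nonneg fun l _ => mul_nonneg (hF l).le ?_
    have : G.a l ^ 2 ≤ r := by
      refine (single_le_sum (f := fun l => G.a l ^ 2) (fun _ _ => sq_nonneg _)
        (mem_univ l)).trans ?_
      rw [G.sum_a_sq hρ]
      nlinarith
    have : G.a l ^ 2 / r ≤ 1 := (div_le_one hr).2 this
    have : 0 ≤ 1 - G.a l ^ 2 / r := by linarith
    positivity
  rw [hexp, hFκ, hcomm] at hsum
  have : 0 ≤ u * ((k + 2) * u ^ 2 * Φ x₀ + r * ∑ l, G.a l * Φ₁ l +
      Φ x₀ * ∑ l, G.a l ^ 2 + (k + 2) * r * Φ x₀) := by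
    linear_combination hsum + hpos + Φ x₀ * haκ
  exact nonneg_of_mul_nonneg_right this hu

/-- The maximum principle at a maximum of the quotient of the mean curvature by the support
function. -/
theorem mean_curvature_estimate (hρ : ∀ x, 0 < ρ x) {k : ℕ} (hk : k + 2 ≤ n)
    (hG : InGarding G.κ univ (k + 2)) {Φ : Sph n → ℝ} (hpos : 0 < Φ x₀)
    (heq : ∀ x, sigmaCurv (k + 2) ρ x = Φ x * supportFn ρ x) {Φ₁ Φ₂ : Fin n → ℝ}
    (hΦ : ∀ l, Jet (fun t => Φ (G.curve l t)) (Φ x₀) (Φ₁ l) (Φ₂ l))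
    (hmax : ∀ x, sigmaCurv 1 ρ x / supportFn ρ x ≤ sigmaCurv 1 ρ x₀ / supportFn ρ x₀) :
    (k + 1) * Φ x₀ * supportFn ρ x₀ * ∑ l, G.κ l ^ 2 ≤
      supportFn ρ x₀ * (∑ l, Φ₁ l ^ 2) / Φ x₀ - supportFn ρ x₀ * ∑ l, Φ₂ l +
        sigmaCurv 1 ρ x₀ * ∑ l, G.a l * Φ₁ l + (k + 1) * Φ x₀ * sigmaCurv 1 ρ x₀ := by
  have hn1 : 1 ≤ n := by lia
  set u := supportFn ρ x₀ with hu_def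
  set H := sigmaCurv 1 ρ x₀ with hH_def
  set F : Fin n → ℝ := fun i => esum G.κ (univ.erase i) (k + 1) with hF_def
  have hu : 0 < u := supportFn_pos hρ x₀
  have hHκ : H = ∑ i, G.κ i := by rw [hH_def, G.sigmaCurv_eq 1 hn1, esum_one]
  have hH1 : H = esum G.κ univ 1 := by rw [hH_def, G.sigmaCurv_eq 1 hn1]
  have hH : 0 < H := by rw [hH1]; exact hG 1 (by lia)
  have hF : ∀ i, 0 < F i := fun i => (hG.erase (mem_univ i)) _ le_rfl
  -- Second order test for `u₀ H - H₀ u`, nonpositive and zero at the maximum point, with `H`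
  -- written as the trace of the shape matrix.
  have key : ∀ l, u * ∑ i, G.T i i l = H * (G.a l * G.κ l) ∧
      u * ∑ i, G.θ l i i ≤ H * (∑ m, G.a m * G.T m l l + G.κ l - u * G.κ l ^ 2) := fun l => by
    have ht : Jet (fun t => ∑ i, G.S l t i i) (∑ i, if i = i then G.κ i else 0)
      (∑ i, G.T i i l) (∑ i, G.θ l i i) := Jet.sum fun i _ => G.jet_S l i i
    have hz := (((ht.const_mul u).sub ((G.jet_support l).const_mul H)).cast (a' := 0)
      (by simp only [if_true, ← hHκ]; ring) rfl rfl).zero_of_eventually_nonpos ?_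
    · exact ⟨sub_eq_zero.1 hz.1, sub_nonpos.1 hz.2⟩
    · filter_upwards [G.sigmaCurv_curve l] with t ht'
      have h1 := ht' 1 hn1
      rw [ematrix_one] at h1
      have h2 := hmax (G.curve l t)
      rw [div_le_div_iff₀ (supportFn_pos hρ _) hu, h1] at h2
      have : ∑ i, G.S l t i i = (G.S l t).trace := rfl
      simp only [this]
      linarith
  have hT : ∀ m, ∑ l, F l * G.T m l l = Φ₁ m * u + Φ x₀ * (G.a m * G.κ m) := fun m => by
    rw [← (G.differentiated_eq hk hG heq (hΦ m)).1]
    refine sum_congr rfl fun i _ => ?_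
    rw [G.T_swap, G.T_swap']; ring
  have hσ : esum G.κ univ (k + 2) = Φ x₀ * u := by rw [← G.sigmaCurv_eq _ hk, heq]
  have hFκ : ∑ l, F l * G.κ l = (k + 2) * (Φ x₀ * u) := by
    rw [← hσ]
    have := sum_mul_esum_erase G.κ univ (k + 1)
    push_cast at this
    rw [show (k : ℝ) + 2 = k + 1 + 1 by ring, ← this]
    exact sum_congr rfl fun i _ => mul_comm _ _
  -- At this point `dH/H = aκ/u`, while the equation gives `dσ_k/σ_k = Φ₁/Φ + aκ/u`. In the
  -- difference of squares from log-concavity the terms `(aκ/u)²` cancel.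
  have hD : ∀ l, esumHess G.κ univ k (fun i => G.T i i l) ≤
      Φ₁ l ^ 2 * u / Φ x₀ + 2 * (Φ₁ l * (G.a l * G.κ l)) := fun l => by
    have h1 := hG.esumHess_le (fun i => G.T i i l)
    rw [(G.differentiated_eq hk hG heq (hΦ l)).1, hσ, ← hH1] at h1
    have h2 : H ^ 2 * (u * Φ x₀ * (esumHess G.κ univ k (fun i => G.T i i l) -
        (Φ₁ l ^ 2 * u / Φ x₀ + 2 * (Φ₁ l * (G.a l * G.κ l))))) ≤ 0 := by
      have h3 : Φ₁ l ^ 2 * u / Φ x₀ * Φ x₀ = Φ₁ l ^ 2 * u := div_mul_cancel₀ _ hpos.ne'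
      have h4 : (u * ∑ i, G.T i i l) ^ 2 = (H * (G.a l * G.κ l)) ^ 2 := by rw [(key l).1]
      linear_combination h1 - H ^ 2 * u * h3 - Φ x₀ ^ 2 * h4
    have h5 := nonpos_of_mul_nonpos_right h2 (by positivity)
    have h6 := nonpos_of_mul_nonpos_right h5 (by positivity)
    linarith
  -- the two sums of the second derivatives of the curvature matrix
  have hcomm : ∑ l, F l * ∑ m, G.a m * G.T m l l =
      u * ∑ m, G.a m * Φ₁ m + Φ x₀ * ∑ m, G.a m ^ 2 * G.κ m := by
    simp only [mul_sum]
    rw [sum_comm, ← sum_add_distrib]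
    refine sum_congr rfl fun m _ => ?_
    rw [show ∑ l, F l * (G.a m * G.T m l l) = G.a m * ∑ l, F l * G.T m l l by
      rw [mul_sum]; exact sum_congr rfl fun l _ => by ring, hT]
    ring
  have hV : u * ∑ l, ∑ m, G.a m * G.T m l l = H * ∑ m, G.a m ^ 2 * G.κ m := by
    rw [sum_comm, mul_sum, mul_sum]
    refine sum_congr rfl fun m _ => ?_
    have : ∑ l, G.a m * G.T m l l = G.a m * ∑ i, G.T i i m := by
      rw [mul_sum]
      refine sum_congr rfl fun i _ => ?_
      rw [G.T_swap, G.T_swap']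
    rw [this]
    linear_combination G.a m * (key m).1
  -- A form of Simons' identity: fourth derivatives of `w` commute, and the cubic corrections in `θ`
  -- produce the curvature terms.
  have hswap : ∑ l, ∑ i, G.θ l i i * F i = ∑ l, F l * ∑ i, G.θ l i i -
      (k + 2) * (Φ x₀ * u) * (∑ l, G.κ l ^ 2) + H * ∑ l, F l * G.κ l ^ 2 := by
    have e1 : ∀ l i, G.θ l i i * F i = G.θ i l l * F i - (G.κ l ^ 2 * (F i * G.κ i)) +
        G.κ l * (F i * G.κ i ^ 2) := by
      intro l i
      rw [G.θ_diag, G.θ_diag, G.Q_symm]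
      rcases eq_or_ne i l with rfl | h
      · ring
      · rw [if_neg h, if_neg h.symm]; ring
    simp only [e1, sum_add_distrib, sum_sub_distrib, ← mul_sum, ← sum_mul]
    rw [sum_comm, hFκ, ← hHκ]
    congr 1
    rw [mul_comm (∑ l, G.κ l ^ 2)]
    congr 1
    refine sum_congr rfl fun i _ => ?_
    rw [mul_sum]
    exact sum_congr rfl fun i _ => mul_comm _ _
  have hθ : u * ∑ l, F l * ∑ i, G.θ l i i ≤
      H * (u * ∑ m, G.a m * Φ₁ m + Φ x₀ * (∑ m, G.a m ^ 2 * G.κ m) +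
        (k + 2) * (Φ x₀ * u) - u * ∑ l, F l * G.κ l ^ 2) := by
    have h1 : ∑ l, F l * (u * ∑ i, G.θ l i i) ≤
        ∑ l, F l * (H * (∑ m, G.a m * G.T m l l + G.κ l - u * G.κ l ^ 2)) :=
      sum_le_sum fun l _ => mul_le_mul_of_nonneg_left (key l).2 (hF l).le
    have h2 : ∑ l, F l * (u * ∑ i, G.θ l i i) = u * ∑ l, F l * ∑ i, G.θ l i i := by
      rw [mul_sum]; exact sum_congr rfl fun l _ => by ring
    have h3 : ∑ l, F l * (H * (∑ m, G.a m * G.T m l l + G.κ l - u * G.κ l ^ 2)) =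
        H * (∑ l, F l * (∑ m, G.a m * G.T m l l) + ∑ l, F l * G.κ l -
          u * ∑ l, F l * G.κ l ^ 2) := by
      rw [mul_sum (a := u), ← sum_add_distrib, ← sum_sub_distrib, mul_sum]
      exact sum_congr rfl fun l _ => by ring
    rw [h2, h3, hcomm, hFκ] at h1
    exact h1
  have hsecond : u * (∑ l, Φ₂ l) + 2 * (∑ l, Φ₁ l * (G.a l * G.κ l)) +
      Φ x₀ * (∑ l, ∑ m, G.a m * G.T m l l + H - u * ∑ l, G.κ l ^ 2) ≤
      ∑ l, ∑ i, G.θ l i i * F i + (u * (∑ l, Φ₁ l ^ 2) / Φ x₀ +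
        2 * ∑ l, Φ₁ l * (G.a l * G.κ l)) := by
    have h1 := sum_le_sum fun l (_ : l ∈ (univ : Finset (Fin n))) =>
      ((G.differentiated_eq hk hG heq (hΦ l)).2).trans (add_le_add_right (hD l) _)
    refine le_trans (le_of_eq ?_) (h1.trans (le_of_eq ?_))
    · rw [hHκ]
      simp only [mul_sum, ← sum_add_distrib, ← sum_sub_distrib]
      refine sum_congr rfl fun l _ => ?_
      ring
    · rw [sum_add_distrib]
      congr 1
      rw [mul_sum, sum_div, mul_sum, ← sum_add_distrib]
      exact sum_congr rfl fun l _ => by ring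
  -- The terms `H Σ F κ²`, `Σ a²κ` and `Σ Φ₁ aκ` all cancel. The coefficient `k+1` is `k+2` from
  -- Euler's identity minus `1` from the term `-uκ²` in the second derivative of `u`.
  have hfin : u * ((k + 1) * Φ x₀ * u * ∑ l, G.κ l ^ 2) ≤
      u * (u * (∑ l, Φ₁ l ^ 2) / Φ x₀ - u * ∑ l, Φ₂ l + H * ∑ l, G.a l * Φ₁ l +
        (k + 1) * Φ x₀ * H) := by
    rw [hswap] at hsecond
    linear_combination u * hsecond + hθ - Φ x₀ * hV
  exact le_of_mul_le_mul_left hfin hu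

end PrincipalFrame

end MaximumPrinciple

/-! ### The right hand side of the curvature equation and the curvature bounds -/

section Estimates

open Filter Topology Finset

variable {n : ℕ} {ρ f : Sph n → ℝ} {x₀ : Sph n}

/-- The weight is expanded as a power of `ρ²`, for which a `Jet` is available. -/
lemma sq_rpow_neg_half (n : ℕ) {r : ℝ} (hr : 0 < r) :
    (r ^ 2) ^ (-((n + 1 : ℝ) / 2)) = (r ^ (n + 1))⁻¹ := by
  rw [Real.rpow_neg (by positivity), ← Real.rpow_natCast r 2, ← Real.rpow_mul hr.le,
    ← Real.rpow_natCast r (n + 1)]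
  congr 2
  push_cast
  ring

namespace PrincipalFrame

variable (G : PrincipalFrame ρ x₀)

/-- The scale invariant first derivatives of the weight `f(X/|X|) / |X|^{n+1}`. -/
noncomputable def weightD (f : Sph n → ℝ) (l : Fin n) : ℝ :=
  ⟪sphGrad f x₀, G.b l⟫_ℝ - (n + 1) * (G.a l / ρ x₀) * f x₀

/-- The scale invariant second derivatives of the weight `f(X/|X|) / |X|^{n+1}`. -/
noncomputable def weightD2 (f : Sph n → ℝ) (l : Fin n) : ℝ :=
  fderiv ℝ (fderiv ℝ (radialExt f)) (x₀ : Amb n) (G.b l) (G.b l) -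
    ρ x₀ * G.κ l * ⟪sphGrad f x₀, outerNormal ρ x₀⟫_ℝ -
    2 * (n + 1) * (G.a l / ρ x₀) * ⟪sphGrad f x₀, G.b l⟫_ℝ +
    f x₀ * (-(n + 1) * (1 - supportFn ρ x₀ / ρ x₀ * (ρ x₀ * G.κ l)) +
      (n + 1) * (n + 3) * (G.a l / ρ x₀) ^ 2)

lemma jet_weight (hρ : ∀ x, 0 < ρ x) (hf : ContMDiff (𝓡 n) 𝓘(ℝ, ℝ) 2 f) (l : Fin n) :
    Jet (fun t => f (G.curve l t) / ρ (G.curve l t) ^ (n + 1)) (f x₀ / ρ x₀ ^ (n + 1))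
      ((ρ x₀ ^ (n + 1))⁻¹ * (G.weightD f l / ρ x₀))
      ((ρ x₀ ^ (n + 1))⁻¹ * (G.weightD2 f l / ρ x₀ ^ 2)) := by
  set p : ℝ := -((n + 1 : ℝ) / 2) with hp
  have hr : 0 < ρ x₀ := hρ x₀
  have hr2 : 0 < ρ x₀ ^ 2 := by positivity
  have hφ : ∀ᶠ s in 𝓝 (ρ x₀ ^ 2), HasDerivAt (fun s : ℝ => s ^ p) (p * s ^ (p - 1)) s :=
    (eventually_gt_nhds hr2).mono fun s hs => Real.hasDerivAt_rpow_const (.inl hs.ne')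
  have hφ' : HasDerivAt (fun s : ℝ => p * s ^ (p - 1))
      (p * ((p - 1) * (ρ x₀ ^ 2) ^ (p - 1 - 1))) (ρ x₀ ^ 2) :=
    (Real.hasDerivAt_rpow_const (.inl hr2.ne')).const_mul p
  have hj := ((Jet.comp_of_hasDerivAt hφ hφ' (G.jet_sq l)).mul (G.jet_comp f hf l)).congr
    (g := fun t => f (G.curve l t) / ρ (G.curve l t) ^ (n + 1)) (Eventually.of_forall fun t => by
      simp only [hp]
      rw [sq_rpow_neg_half n (hρ _)]
      ring)
  have e0 : (ρ x₀ ^ 2) ^ p = (ρ x₀ ^ (n + 1))⁻¹ := sq_rpow_neg_half n hr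
  refine hj.cast ?_ ?_ ?_
  · rw [e0]; ring
  all_goals
    simp only [Real.rpow_sub_one hr2.ne', e0, weightD, weightD2, a]
    generalize (ρ x₀ ^ (n + 1))⁻¹ = P
    simp only [hp]
    field_simp
    ring

lemma abs_a_div_le (hρ : ∀ x, 0 < ρ x) (l : Fin n) : |G.a l / ρ x₀| ≤ 1 := by
  rw [abs_div, abs_of_pos (hρ x₀), div_le_one (hρ x₀)]
  refine abs_le_of_sq_le_sq ?_ (hρ x₀).le
  refine (single_le_sum (f := fun l => G.a l ^ 2) (fun _ _ => sq_nonneg _) (mem_univ l)).trans ?_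
  rw [G.sum_a_sq hρ]
  nlinarith

lemma abs_inner_b_le {Λ : ℝ} (hf : ‖sphGrad f x₀‖ ≤ Λ) (l : Fin n) :
    |⟪sphGrad f x₀, G.b l⟫_ℝ| ≤ Λ := by
  refine (abs_real_inner_le_norm _ _).trans ?_
  rwa [G.norm_b, mul_one]

lemma abs_weightD_le (hρ : ∀ x, 0 < ρ x) {Λ : ℝ} (hf0 : |f x₀| ≤ Λ)
    (hf1 : ‖sphGrad f x₀‖ ≤ Λ) (l : Fin n) : |G.weightD f l| ≤ (n + 2) * Λ := by
  have h1 := G.abs_inner_b_le hf1 l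
  have h2 : |(n + 1) * (G.a l / ρ x₀) * f x₀| ≤ (n + 1) * 1 * Λ := by
    rw [abs_mul, abs_mul, abs_of_nonneg (by positivity : (0 : ℝ) ≤ n + 1)]
    gcongr
    exact G.abs_a_div_le hρ l
  exact (abs_sub _ _).trans (by linarith)

lemma abs_weightD2_le (hρ : ∀ x, 0 < ρ x) (hf : ContMDiff (𝓡 n) 𝓘(ℝ, ℝ) 2 f) {Λ : ℝ}
    (hf0 : |f x₀| ≤ Λ) (hf1 : ‖sphGrad f x₀‖ ≤ Λ) (hf2 : ‖sphHess f x₀‖ ≤ Λ) {B : ℝ} {l : Fin n}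
    (hκ : |ρ x₀ * G.κ l| ≤ B) : |G.weightD2 f l| ≤ (n + 4) ^ 2 * Λ * (1 + B) := by
  have hΛ : 0 ≤ Λ := (abs_nonneg _).trans hf0
  have hB : 0 ≤ B := (abs_nonneg _).trans hκ
  have ha := G.abs_a_div_le hρ l
  have h1 : |fderiv ℝ (fderiv ℝ (radialExt f)) (x₀ : Amb n) (G.b l) (G.b l)| ≤ 3 * Λ := by
    refine (abs_fderiv_fderiv_radialExt_le hf x₀ _).trans ?_
    rw [G.norm_b]
    linarith
  have h2 : |ρ x₀ * G.κ l * ⟪sphGrad f x₀, outerNormal ρ x₀⟫_ℝ| ≤ B * Λ := by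
    rw [abs_mul]
    gcongr
    refine (abs_real_inner_le_norm _ _).trans ?_
    rwa [norm_outerNormal hρ, mul_one]
  have h3 : |2 * (n + 1) * (G.a l / ρ x₀) * ⟪sphGrad f x₀, G.b l⟫_ℝ| ≤ 2 * (n + 1) * 1 * Λ := by
    rw [abs_mul, abs_mul, abs_of_nonneg (by positivity : (0 : ℝ) ≤ 2 * (n + 1))]
    gcongr
    exact G.abs_inner_b_le hf1 l
  have hu : |supportFn ρ x₀ / ρ x₀ * (ρ x₀ * G.κ l)| ≤ 1 * B := by
    rw [abs_mul, abs_of_pos (div_pos (supportFn_pos hρ x₀) (hρ x₀))]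
    gcongr
    exact (div_le_one (hρ x₀)).2 (supportFn_le hρ x₀)
  have h4 : |-(n + 1) * (1 - supportFn ρ x₀ / ρ x₀ * (ρ x₀ * G.κ l)) +
      (n + 1) * (n + 3) * (G.a l / ρ x₀) ^ 2| ≤ (n + 1) * (1 + B) + (n + 1) * (n + 3) * 1 := by
    have ha2 : (G.a l / ρ x₀) ^ 2 ≤ 1 := by
      rw [← sq_abs]; exact pow_le_one₀ (abs_nonneg _) ha
    refine (abs_add_le _ _).trans (add_le_add ?_ ?_)
    · rw [abs_mul, abs_neg, abs_of_nonneg (by positivity : (0 : ℝ) ≤ n + 1)]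
      gcongr
      refine (abs_sub _ _).trans ?_
      rw [abs_one]
      linarith
    · rw [abs_of_nonneg (by positivity)]
      gcongr
  have h5 : |f x₀ * (-(n + 1) * (1 - supportFn ρ x₀ / ρ x₀ * (ρ x₀ * G.κ l)) +
      (n + 1) * (n + 3) * (G.a l / ρ x₀) ^ 2)| ≤
      Λ * ((n + 1) * (1 + B) + (n + 1) * (n + 3) * 1) := by
    rw [abs_mul]
    gcongr
  refine (abs_add_le _ _).trans ((add_le_add ((abs_sub _ _).trans (add_le_add
    ((abs_sub _ _).trans (add_le_add h1 h2)) h3)) h5).trans ?_)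
  have hn : (0 : ℝ) ≤ n := n.cast_nonneg
  have e : (n + 4) ^ 2 * Λ * (1 + B) - (3 * Λ + B * Λ + 2 * (n + 1) * 1 * Λ +
      Λ * ((n + 1) * (1 + B) + (n + 1) * (n + 3) * 1)) =
      Λ * ((n + 7) + B * (n ^ 2 + 7 * n + 14)) := by ring
  have : 0 ≤ Λ * ((n + 7) + B * (n ^ 2 + 7 * n + 14) : ℝ) := by positivity
  linarith

lemma inGarding {k : ℕ} (hk : k ≤ n) (hadm : ∀ j ≤ k, 0 < sigmaCurv j ρ x₀) :
    InGarding G.κ univ k := fun j hj => by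
  rw [← G.sigmaCurv_eq j (hj.trans hk)]; exact hadm j hj

/-- Uses `σ_2 > 0`: this is where order at least two is needed. -/
lemma sum_sq_le {k : ℕ} (hk : k + 2 ≤ n) (hG : InGarding G.κ univ (k + 2)) :
    ∑ l, G.κ l ^ 2 ≤ sigmaCurv 1 ρ x₀ ^ 2 := by
  rw [esum_sq_sum, G.sigmaCurv_eq 1 (by lia)]
  linarith [hG 2 (by lia)]

lemma abs_κ_le {k : ℕ} (hk : k + 2 ≤ n) (hG : InGarding G.κ univ (k + 2)) (l : Fin n) :
    |G.κ l| ≤ sigmaCurv 1 ρ x₀ := by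
  refine abs_le_of_sq_le_sq ?_ ?_
  · exact (single_le_sum (f := fun l => G.κ l ^ 2) (fun _ _ => sq_nonneg _)
      (mem_univ l)).trans (G.sum_sq_le hk hG)
  · rw [G.sigmaCurv_eq 1 (by lia)]; exact (hG 1 (by lia)).le

/-- Inserting `Φ = f/ρ^{n+1}` turns the estimate into `f((n+k+2)u² - (n-k-2)ρ²) ≥ ρu⟨∇f, ν⟩`. -/
theorem mul_radius_le_of_isMin (hρ : ∀ x, 0 < ρ x) (hf : ContMDiff (𝓡 n) 𝓘(ℝ, ℝ) 2 f)
    {k : ℕ} (hk : k + 2 < n) (hG : InGarding G.κ univ (k + 2))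
    (hsol : SolvesCurvatureEq (k + 2) f ρ) {m Λ : ℝ} (hm : 0 < m) (hfm : m ≤ f x₀)
    (hf0 : |f x₀| ≤ Λ) (hf1 : ‖sphGrad f x₀‖ ≤ Λ)
    (hmin : ∀ x, supportFn ρ x₀ / ρ x₀ ≤ supportFn ρ x / ρ x) :
    m * ρ x₀ ≤ (n + k + 3) * Λ * supportFn ρ x₀ := by
  have h := G.support_estimate hρ hk.le hG (fun x => hsol.eq_mul hρ x) (G.jet_weight hρ hf) hmin
  have hr := hρ x₀
  have hu := supportFn_pos hρ x₀
  have hur := supportFn_le hρ x₀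
  have hΛ : f x₀ ≤ Λ := (le_abs_self _).trans hf0
  have hf' : 0 ≤ f x₀ := hm.le.trans hfm
  have hΛ0 : 0 ≤ Λ := hf'.trans hΛ
  have hg : |⟪sphGrad f x₀, outerNormal ρ x₀⟫_ℝ| ≤ Λ := by
    refine (abs_real_inner_le_norm _ _).trans ?_
    rwa [norm_outerNormal hρ, mul_one]
  have hg' := neg_le_of_abs_le hg
  -- Since `∇f` is orthogonal to `X`, its contribution carries a factor `u`, so it can be absorbed
  -- on the side of `u`.
  have hsum : ∑ l, G.a l * ((ρ x₀ ^ (n + 1))⁻¹ * (G.weightD f l / ρ x₀)) =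
      (ρ x₀ ^ (n + 1))⁻¹ / ρ x₀ * (-(supportFn ρ x₀ * ⟪sphGrad f x₀, outerNormal ρ x₀⟫_ℝ) -
        (n + 1) * f x₀ / ρ x₀ * (ρ x₀ ^ 2 - supportFn ρ x₀ ^ 2)) := by
    rw [← G.sum_a_mul_grad f, ← G.sum_a_sq hρ, mul_sum, ← sum_sub_distrib, mul_sum]
    refine sum_congr rfl fun l _ => ?_
    rw [weightD]; ring
  rw [hsum, G.sum_a_sq hρ] at h
  set P := (ρ x₀ ^ (n + 1))⁻¹ with hP
  have hPpos : 0 < P := by positivity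
  set u := supportFn ρ x₀
  set g := ⟪sphGrad f x₀, outerNormal ρ x₀⟫_ℝ
  have h2 : 0 ≤ P * (f x₀ * ((n + k + 2) * u ^ 2 - (n - k - 2) * ρ x₀ ^ 2) - ρ x₀ * u * g) := by
    refine h.trans_eq ?_
    rw [div_eq_mul_inv (f x₀), ← hP]
    field_simp
    ring
  have h3 := nonneg_of_mul_nonneg_right h2 hPpos
  -- The strict inequality between order and dimension gives `ρ²` a definite coefficient.
  have hnk : (1 : ℝ) ≤ n - k - 2 := by
    have : ((k + 2 + 1 : ℕ) : ℝ) ≤ n := by exact_mod_cast hk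
    push_cast at this
    linarith
  have hk0 : (0 : ℝ) ≤ n + k + 2 := by positivity
  have h4 : m * ρ x₀ ^ 2 ≤ f x₀ * ((n - k - 2) * ρ x₀ ^ 2) := by
    have : 1 * ρ x₀ ^ 2 ≤ (n - k - 2) * ρ x₀ ^ 2 := by gcongr
    calc m * ρ x₀ ^ 2 = m * (1 * ρ x₀ ^ 2) := by ring
      _ ≤ _ := by gcongr
  have h5 : f x₀ * ((n + k + 2) * u ^ 2) ≤ Λ * ((n + k + 2) * (u * ρ x₀)) := by
    have : u ^ 2 ≤ u * ρ x₀ := by rw [pow_two]; gcongr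
    gcongr
  have h6 : -(ρ x₀ * u * g) ≤ ρ x₀ * u * Λ := by
    have := mul_le_mul_of_nonneg_left hg' (mul_pos hr hu).le
    linarith
  have h7 : ρ x₀ * (m * ρ x₀) ≤ ρ x₀ * ((n + k + 3) * Λ * u) := by linarith
  exact le_of_mul_le_mul_left h7 hr

/-- The scale invariant bound for the mean curvature where it is largest relative to the support
function. -/
theorem mean_curvature_mul_radius_le (hρ : ∀ x, 0 < ρ x) (hf : ContMDiff (𝓡 n) 𝓘(ℝ, ℝ) 2 f)
    {k : ℕ} (hk : k + 2 ≤ n) (hG : InGarding G.κ univ (k + 2))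
    (hsol : SolvesCurvatureEq (k + 2) f ρ) {m Λ c : ℝ} (hm : 0 < m) (hfm : m ≤ f x₀)
    (hf0 : |f x₀| ≤ Λ) (hf1 : ‖sphGrad f x₀‖ ≤ Λ) (hf2 : ‖sphHess f x₀‖ ≤ Λ) (hc : 0 < c)
    (hcu : c ≤ supportFn ρ x₀ / ρ x₀)
    (hmax : ∀ x, sigmaCurv 1 ρ x / supportFn ρ x ≤ sigmaCurv 1 ρ x₀ / supportFn ρ x₀) :
    sigmaCurv 1 ρ x₀ * ρ x₀ ≤ n * (n * ((n + 2) * Λ) ^ 2 / m + n * ((n + 4) ^ 2 * Λ) +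
      n * ((n + 2) * Λ) + n * Λ) / (m * c) + 1 := by
  have hr := hρ x₀
  have hfpos : 0 < f x₀ := hm.trans_le hfm
  have hfΛ : f x₀ ≤ Λ := (le_abs_self _).trans hf0
  have hΛ : 0 < Λ := hfpos.trans_le hfΛ
  have hn : (0 : ℝ) < n := by exact_mod_cast (by lia : 0 < n)
  have hHκ : sigmaCurv 1 ρ x₀ = ∑ l, G.κ l := by rw [G.sigmaCurv_eq 1 (by lia), esum_one]
  have hHpos : 0 < sigmaCurv 1 ρ x₀ := by
    rw [G.sigmaCurv_eq 1 (by lia)]; exact hG 1 (by lia)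
  have h := G.mean_curvature_estimate hρ hk hG (Φ := fun x => f x / ρ x ^ (n + 1))
    (by positivity) (fun x => hsol.eq_mul hρ x) (G.jet_weight hρ hf) hmax
  have hu0 := supportFn_pos hρ x₀
  set r := ρ x₀ with hr_def
  set P := (r ^ (n + 1))⁻¹ with hP
  have hPpos : 0 < P := by positivity
  set B := sigmaCurv 1 ρ x₀ * r with hB
  have hBpos : 0 < B := mul_pos hHpos hr
  have hB0 : 0 ≤ B := hBpos.le
  set v := supportFn ρ x₀ / r with hv
  have hv1 : v ≤ 1 := (div_le_one hr).2 (supportFn_le hρ x₀)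
  have hv0 : 0 ≤ v := hc.le.trans hcu
  have eu : supportFn ρ x₀ = r * v := by rw [hv]; field_simp
  have eH : sigmaCurv 1 ρ x₀ = B / r := by rw [hB]; field_simp
  have s1 : ∑ l, (P * (G.weightD f l / r)) ^ 2 = P ^ 2 / r ^ 2 * ∑ l, G.weightD f l ^ 2 := by
    rw [mul_sum]; exact sum_congr rfl fun l _ => by ring
  have s2 : ∑ l, P * (G.weightD2 f l / r ^ 2) = P / r ^ 2 * ∑ l, G.weightD2 f l := by
    rw [mul_sum]; exact sum_congr rfl fun l _ => by ring
  have s3 : ∑ l, G.a l * (P * (G.weightD f l / r)) = P * ∑ l, G.a l / r * G.weightD f l := by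
    rw [mul_sum]; exact sum_congr rfl fun l _ => by ring
  have s4 : ∑ l, G.κ l ^ 2 = (∑ l, (r * G.κ l) ^ 2) / r ^ 2 := by
    rw [sum_div]; exact sum_congr rfl fun l _ => by field_simp
  have e : f x₀ / r ^ (n + 1) = f x₀ * P := div_eq_mul_inv _ _
  rw [e, s1, s2, s3, s4, eH, eu] at h
  set N := ∑ l, (r * G.κ l) ^ 2 with hN
  -- the scale invariant form of the inequality
  have h' : (k + 1) * f x₀ * v * N ≤ v * (∑ l, G.weightD f l ^ 2) / f x₀ -
      v * ∑ l, G.weightD2 f l + B * ∑ l, G.a l / r * G.weightD f l + (k + 1) * f x₀ * B := by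
    -- Multiplying by `ρ^{n+2}` removes every power of the radius.
    have hm := mul_le_mul_of_nonneg_left h (by positivity : 0 ≤ r / P)
    refine le_trans (le_of_eq ?_) (hm.trans (le_of_eq ?_)) <;> field_simp
  have hκ : ∀ l, |r * G.κ l| ≤ B := fun l => by
    rw [abs_mul, abs_of_pos hr, hB, mul_comm]
    gcongr
    exact G.abs_κ_le hk hG l
  have b1 : v * (∑ l, G.weightD f l ^ 2) / f x₀ ≤ n * ((n + 2) * Λ) ^ 2 / m := by
    have h1 : ∑ l, G.weightD f l ^ 2 ≤ n * ((n + 2) * Λ) ^ 2 := by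
      refine (sum_le_card_nsmul _ _ (((n + 2) * Λ) ^ 2) fun l _ => ?_).trans (by simp)
      rw [← sq_abs]
      exact pow_le_pow_left₀ (abs_nonneg _) (G.abs_weightD_le hρ hf0 hf1 l) 2
    have h2 : 0 ≤ ∑ l, G.weightD f l ^ 2 := sum_nonneg fun _ _ => sq_nonneg _
    exact div_le_div₀ (by positivity) ((mul_le_of_le_one_left h2 hv1).trans h1) hm hfm
  have b2 : -(v * ∑ l, G.weightD2 f l) ≤ n * ((n + 4) ^ 2 * Λ) * (1 + B) := by
    have h1 : |∑ l, G.weightD2 f l| ≤ n * ((n + 4) ^ 2 * Λ * (1 + B)) := by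
      refine (abs_sum_le_sum_abs _ _).trans ((sum_le_card_nsmul _ _ ((n + 4) ^ 2 * Λ * (1 + B))
        fun l _ => ?_).trans (by simp))
      exact G.abs_weightD2_le hρ hf hf0 hf1 hf2 (hκ l)
    refine (neg_le_abs _).trans ?_
    rw [abs_mul, abs_of_nonneg hv0]
    refine (mul_le_of_le_one_left (abs_nonneg _) hv1).trans (h1.trans_eq (by ring))
  have b3 : ∑ l, G.a l / r * G.weightD f l ≤ n * ((n + 2) * Λ) := by
    refine (sum_le_card_nsmul _ _ ((n + 2) * Λ) fun l _ => ?_).trans (by simp)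
    refine (le_abs_self _).trans ?_
    rw [abs_mul]
    exact (mul_le_of_le_one_left (abs_nonneg _) (G.abs_a_div_le hρ l)).trans
      (G.abs_weightD_le hρ hf0 hf1 l)
  have b4 : (k + 1) * f x₀ * B ≤ n * Λ * B := by
    have : (k + 1 : ℝ) ≤ n := by exact_mod_cast (by lia : k + 1 ≤ n)
    gcongr
  have b3' := mul_le_mul_of_nonneg_left b3 hB0
  -- Cauchy–Schwarz: `H² ≤ n|A|²`, making the left side quadratic in `B` against a linear right
  -- side.
  have hNB : B ^ 2 ≤ n * N := by
    have h1 := sq_sum_le_card_mul_sum_sq (s := univ) (f := fun l => r * G.κ l)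
    rw [← mul_sum, ← hHκ, mul_comm r] at h1
    simpa using h1
  have b0 : m * c * N ≤ (k + 1) * f x₀ * v * N := by
    have hN0 : 0 ≤ N := sum_nonneg fun _ _ => sq_nonneg _
    have : m ≤ (k + 1) * f x₀ := by
      have : (1 : ℝ) ≤ k + 1 := by linarith [(k.cast_nonneg : (0 : ℝ) ≤ k)]
      exact hfm.trans (le_mul_of_one_le_left hfpos.le this)
    gcongr
  set K1 := n * ((n + 2) * Λ) ^ 2 / m with hK1
  set K2 := n * ((n + 4) ^ 2 * Λ) with hK2
  set K3 := n * ((n + 2) * Λ) with hK3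
  have hK1p : 0 ≤ K1 := by positivity
  have hK3p : 0 ≤ K3 := by positivity
  have hKn : 0 ≤ n * Λ := by positivity
  have hmain : m * c * N ≤ (K1 + K2 + K3 + n * Λ) * (1 + B) := by
    have : 0 ≤ K1 * B := by positivity
    linarith
  have hq : B ^ 2 ≤ n * (K1 + K2 + K3 + n * Λ) / (m * c) * (1 + B) := by
    rw [div_mul_eq_mul_div, le_div_iff₀ (by positivity)]
    have h1 := mul_le_mul_of_nonneg_right hNB (by positivity : 0 ≤ m * c)
    have h2 := mul_le_mul_of_nonneg_left hmain hn.le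
    linarith
  -- `B² ≤ C(1 + B)` with `B > C + 1 > 1` is impossible: the product `(C+1)B < B²` would give `B <
  -- C`.
  by_contra! hlt
  have hlt' := mul_lt_mul_of_pos_right hlt hBpos
  generalize n * (K1 + K2 + K3 + n * Λ) / (m * c) = C at hq hlt hlt'
  linarith

end PrincipalFrame

end Estimates

/-! ### The Hessian of the radial function and the a priori estimate -/

section Hessian

open Filter Topology Finset

variable {n : ℕ} {ρ f : Sph n → ℝ} {x₀ : Sph n}

/-- A symmetric bilinear form on an inner product space is bounded by its quadratic form. -/
lemma opNorm_le_of_quadratic {E : Type*} [NormedAddCommGroup E] [InnerProductSpace ℝ E]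
    (A : E →L[ℝ] E →L[ℝ] ℝ) (hA : ∀ v w, A v w = A w v) {M : ℝ} (hM : 0 ≤ M)
    (h : ∀ v, |A v v| ≤ M * ‖v‖ ^ 2) : ‖A‖ ≤ M := by
  refine A.opNorm_le_bound₂ hM fun v w => ?_
  rcases eq_or_ne v 0 with rfl | hv
  · simp
  rcases eq_or_ne w 0 with rfl | hw
  · simp
  have hv' : 0 < ‖v‖ := norm_pos_iff.2 hv
  have hw' : 0 < ‖w‖ := norm_pos_iff.2 hw
  -- Both vectors are rescaled to a common length so that polarization with the parallelogram law
  -- loses no constant.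
  set p := ‖w‖ • v with hp
  set q := ‖v‖ • w with hq
  have hpn : ‖p‖ = ‖v‖ * ‖w‖ := by rw [hp, norm_smul, norm_norm, mul_comm]
  have hqn : ‖q‖ = ‖v‖ * ‖w‖ := by rw [hq, norm_smul, norm_norm]
  have e : A (p + q) (p + q) - A (p - q) (p - q) = 4 * (‖v‖ * ‖w‖ * A v w) := by
    have h1 : A p q = ‖v‖ * ‖w‖ * A v w := by
      simp only [hp, hq, map_smul, _root_.smul_apply, smul_eq_mul]; ring
    rw [← h1]
    simp only [map_add, map_sub, _root_.add_apply, _root_.sub_apply]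
    rw [hA q p]
    ring
  have hpar := parallelogram_law_with_norm ℝ p q
  rw [hpn, hqn] at hpar
  have h1 := h (p + q)
  have h2 := h (p - q)
  have h3 : |4 * (‖v‖ * ‖w‖ * A v w)| ≤ 4 * (‖v‖ * ‖w‖ * (M * ‖v‖ * ‖w‖)) := by
    rw [← e]
    refine (abs_sub _ _).trans ((add_le_add h1 h2).trans (le_of_eq ?_))
    linear_combination M * hpar
  rw [abs_mul, abs_mul, abs_of_pos (by norm_num : (0 : ℝ) < 4),
    abs_of_pos (mul_pos hv' hw')] at h3
  exact le_of_mul_le_mul_left (le_of_mul_le_mul_left h3 (by norm_num)) (mul_pos hv' hw')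

lemma inner_outerNormal_self (hρ : ∀ x, 0 < ρ x) (x : Sph n) :
    ⟪outerNormal ρ x, (x : Amb n)⟫_ℝ = supportFn ρ x / ρ x := by
  rw [supportFn, radialGraph, real_inner_smul_left, real_inner_comm, mul_div_cancel_left₀ _ (hρ x).ne']

/-- Because `√(ρ² + |∇ρ|²) = ρ²/u`, a lower bound on `u/ρ` is a gradient bound. -/
lemma norm_sphGrad_le (hρ : ∀ x, 0 < ρ x) {c : ℝ} (hc : 0 < c) (x : Sph n)
    (hcu : c ≤ supportFn ρ x / ρ x) : ‖sphGrad ρ x‖ ≤ ρ x / c := by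
  have hr := hρ x
  have hg := gradLen_pos hρ x
  have h1 : ‖sphGrad ρ x‖ ≤ gradLen ρ x := by
    refine le_of_sq_le_sq ?_ hg.le
    rw [gradLen_sq]
    linarith [pow_pos hr 2]
  have h2 := supportFn_mul_gradLen hρ x
  rw [le_div_iff₀ hr] at hcu
  have h3 := mul_le_mul_of_nonneg_right hcu hg.le
  have h4 : ρ x * (c * gradLen ρ x) ≤ ρ x * ρ x := by linarith
  rw [le_div_iff₀ hc]
  have := le_of_mul_le_mul_left h4 hr
  have := mul_le_mul_of_nonneg_right h1 hc.le
  linarith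

namespace PrincipalFrame

variable (G : PrincipalFrame ρ x₀)
include G

/-- Solve `hess_eq` for the second derivative of `ρ`: every other term is controlled by `c`, `R` and
`A`. -/
lemma abs_hess_le_of_inner_eq_zero (hρ : ∀ x, 0 < ρ x) {c R A : ℝ} (hc : 0 < c)
    (hcu : c ≤ supportFn ρ x₀ / ρ x₀) (hR : ρ x₀ ≤ R) (hA : ∀ l, |G.κ l| ≤ A) (hA0 : 0 ≤ A)
    {v : Amb n} (hv : ⟪outerNormal ρ x₀, v⟫_ℝ = 0) :
    |fderiv ℝ (fderiv ℝ (radialExt ρ)) (x₀ : Amb n) v v| ≤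
      R * (1 + R * A + 1 / c ^ 2 + A * (R / c)) * ‖v‖ ^ 2 := by
  have hr := hρ x₀
  have hR0 : 0 < R := hr.trans_le hR
  have h := G.hess_eq v hv
  set K := ∑ i, G.κ i * ⟪G.b i, v⟫_ℝ ^ 2 with hK
  set g := ⟪sphGrad ρ x₀, outerNormal ρ x₀⟫_ℝ
  set e := ⟪sphGrad ρ x₀, v⟫_ℝ
  set D := fderiv ℝ (fderiv ℝ (radialExt ρ)) (x₀ : Amb n) v v
  have hgrad := norm_sphGrad_le hρ hc x₀ hcu
  have hKb : |K| ≤ A * ‖v‖ ^ 2 := by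
    have h1 := G.sum_mul_inner v v
    rw [hv, real_inner_self_eq_norm_sq] at h1
    rw [h1, zero_mul, zero_add, mul_sum]
    refine (abs_sum_le_sum_abs _ _).trans (sum_le_sum fun i _ => ?_)
    rw [abs_mul, abs_of_nonneg (sq_nonneg ⟪G.b i, v⟫_ℝ), pow_two]
    exact mul_le_mul_of_nonneg_right (hA i) (mul_self_nonneg _)
  have hgb : |g| ≤ R / c := by
    refine (abs_real_inner_le_norm _ _).trans ?_
    rw [norm_outerNormal hρ, mul_one]
    exact hgrad.trans (by gcongr)
  have heb : |e / ρ x₀| ≤ 1 / c * ‖v‖ := by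
    rw [abs_div, abs_of_pos hr, div_le_iff₀ hr]
    refine (abs_real_inner_le_norm _ _).trans ?_
    calc ‖sphGrad ρ x₀‖ * ‖v‖ ≤ ρ x₀ / c * ‖v‖ := by gcongr
      _ = _ := by ring
  have heb2 : (e / ρ x₀) ^ 2 ≤ 1 / c ^ 2 * ‖v‖ ^ 2 := by
    rw [← sq_abs]
    exact (pow_le_pow_left₀ (abs_nonneg _) heb 2).trans_eq (by ring)
  have hub : |supportFn ρ x₀ * K| ≤ R * (A * ‖v‖ ^ 2) := by
    rw [abs_mul, abs_of_pos (supportFn_pos hρ x₀)]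
    have := (supportFn_le hρ x₀).trans hR
    gcongr
  have hD : D = ρ x₀ * (‖v‖ ^ 2 - supportFn ρ x₀ * K - (e / ρ x₀) ^ 2 + K * g) := by
    have h2 : D = ρ x₀ * (ρ x₀ * (D / ρ x₀ ^ 2 - K * g / ρ x₀) + K * g) := by
      field_simp
      ring
    rw [h2, ← h]
    ring
  have hKg : |K * g| ≤ A * ‖v‖ ^ 2 * (R / c) := by
    rw [abs_mul]; gcongr
  rw [hD, abs_mul, abs_of_pos hr, mul_assoc]
  refine mul_le_mul hR ?_ (abs_nonneg _) hR0.le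
  have a1 := abs_le.1 hub
  have a2 := abs_le.1 hKg
  have a3 := sq_nonneg (e / ρ x₀)
  have a4 := sq_nonneg ‖v‖
  have a5 : 0 ≤ 1 / c ^ 2 * ‖v‖ ^ 2 := by positivity
  rw [abs_le]
  constructor <;> linarith

/-- The curvatures control only directions tangent to the hypersurface. Any `v` differs from one by
a multiple of `x₀`, on which the Hessian is known by homogeneity, and `u/ρ ≥ c` bounds that
multiple. -/
theorem norm_sphHess_le (h : ContMDiff (𝓡 n) 𝓘(ℝ, ℝ) 2 ρ) (hρ : ∀ x, 0 < ρ x) {c R A : ℝ}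
    (hc : 0 < c) (hcu : c ≤ supportFn ρ x₀ / ρ x₀) (hR : ρ x₀ ≤ R) (hA : ∀ l, |G.κ l| ≤ A)
    (hA0 : 0 ≤ A) :
    ‖sphHess ρ x₀‖ ≤ R * (1 + R * A + 1 / c ^ 2 + A * (R / c)) * (1 + 1 / c) ^ 2 +
      2 * (1 / c * (R / c)) := by
  have hr := hρ x₀
  have hR0 : 0 < R := hr.trans_le hR
  set D := fderiv ℝ (fderiv ℝ (radialExt ρ)) (x₀ : Amb n) with hD
  have hsymm := fderiv_fderiv_radialExt_symm h (sph_ne_zero x₀)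
  have hself := fderiv_fderiv_radialExt_self h (sph_ne_zero x₀)
  set M := R * (1 + R * A + 1 / c ^ 2 + A * (R / c)) with hM
  have hM0 : 0 ≤ M := by positivity
  have hM' : 0 ≤ M * (1 + 1 / c) ^ 2 + 2 * (1 / c * (R / c)) := by positivity
  have hquad : ∀ v, |D v v| ≤ (M * (1 + 1 / c) ^ 2 + 2 * (1 / c * (R / c))) * ‖v‖ ^ 2 := by
    intro v
    set s := ⟪outerNormal ρ x₀, v⟫_ℝ / (supportFn ρ x₀ / ρ x₀) with hs
    have hup : 0 < supportFn ρ x₀ / ρ x₀ := hc.trans_le hcu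
    have hsb : |s| ≤ 1 / c * ‖v‖ := by
      rw [hs, abs_div, abs_of_pos hup, one_div_mul_eq_div]
      gcongr
      refine (abs_real_inner_le_norm _ _).trans ?_
      rw [norm_outerNormal hρ, one_mul]
    set w := v - s • (x₀ : Amb n) with hw
    have hw0 : ⟪outerNormal ρ x₀, w⟫_ℝ = 0 := by
      rw [hw, inner_sub_right, real_inner_smul_right, inner_outerNormal_self hρ, hs,
        div_mul_cancel₀ _ hup.ne', sub_self]
    have hwn : ‖w‖ ≤ (1 + 1 / c) * ‖v‖ := by
      refine (norm_sub_le _ _).trans ?_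
      rw [norm_smul, norm_sph, mul_one, Real.norm_eq_abs]
      linarith
    have hDw : D v v = D w w - 2 * (s * fderiv ℝ (radialExt ρ) (x₀ : Amb n) v) := by
      rw [hw]
      simp only [map_sub, map_smul, _root_.sub_apply, _root_.smul_apply, smul_eq_mul]
      rw [hsymm x₀ v, hself, hself, fderiv_radialExt_self]
      ring
    have h1 := G.abs_hess_le_of_inner_eq_zero hρ hc hcu hR hA hA0 hw0
    have h2 : |fderiv ℝ (radialExt ρ) (x₀ : Amb n) v| ≤ R / c * ‖v‖ := by
      rw [← inner_sphGrad]
      refine (abs_real_inner_le_norm _ _).trans ?_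
      have := (norm_sphGrad_le hρ hc x₀ hcu).trans (div_le_div_of_nonneg_right hR hc.le)
      gcongr
    have h3 : |2 * (s * fderiv ℝ (radialExt ρ) (x₀ : Amb n) v)| ≤
        2 * (1 / c * ‖v‖ * (R / c * ‖v‖)) := by
      rw [abs_mul, abs_mul, abs_two]
      gcongr
    have h4 : M * ‖w‖ ^ 2 ≤ M * ((1 + 1 / c) * ‖v‖) ^ 2 := by gcongr
    rw [hDw]
    refine (abs_sub _ _).trans ((add_le_add (h1.trans h4) h3).trans (le_of_eq (by ring)))
  refine opNorm_le_of_quadratic _ (fun v w => ?_) hM' fun v => ?_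
  · simp only [sphHess, ContinuousLinearMap.bilinearComp_apply]
    exact hsymm _ _
  · simp only [sphHess, ContinuousLinearMap.bilinearComp_apply]
    refine (hquad _).trans ?_
    gcongr
    exact (Tan x₀).norm_starProjection_apply_le v

end PrincipalFrame

end Hessian

/-! ### Global bounds from the estimates at extremal points -/

section APriori

variable {n : ℕ} {ρ f : Sph n → ℝ}

theorem support_lower_bound (h : ContMDiff (𝓡 n) 𝓘(ℝ, ℝ) 4 ρ) (hρ : ∀ x, 0 < ρ x)
    (hf : ContMDiff (𝓡 n) 𝓘(ℝ, ℝ) 2 f) {k : ℕ} (hkn : k + 2 < n)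
    (hadm : ∀ x, ∀ j ≤ k + 2, 0 < sigmaCurv j ρ x) (hsol : SolvesCurvatureEq (k + 2) f ρ)
    {m Λ : ℝ} (hm : 0 < m) (hfm : ∀ x, m ≤ f x) (hf0 : ∀ x, |f x| ≤ Λ)
    (hf1 : ∀ x, ‖sphGrad f x‖ ≤ Λ) (x : Sph n) :
    m / ((n + k + 3) * Λ) ≤ supportFn ρ x / ρ x := by
  have h1 : ContMDiff (𝓡 n) 𝓘(ℝ, ℝ) 1 ρ := h.of_le (by norm_num)
  have hcont : Continuous fun x => -(supportFn ρ x / ρ x) :=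
    ((continuous_supportFn h1 hρ).div h.continuous fun x => (hρ x).ne').neg
  obtain ⟨x₀, hmin'⟩ := exists_forall_le_of_continuous hcont x
  have hmin : ∀ y, supportFn ρ x₀ / ρ x₀ ≤ supportFn ρ y / ρ y := fun y =>
    neg_le_neg_iff.1 (hmin' y)
  obtain ⟨G⟩ := exists_principalFrame h hρ x₀
  have hG := G.inGarding hkn.le (hadm x₀)
  have hle := G.mul_radius_le_of_isMin hρ hf hkn hG hsol hm (hfm x₀) (hf0 x₀) (hf1 x₀) hmin
  have hΛ : 0 < Λ := hm.trans_le ((hfm x).trans ((le_abs_self _).trans (hf0 x)))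
  refine le_trans ?_ (hmin x)
  rw [div_le_div_iff₀ (by positivity) (hρ x₀)]
  linarith

/-- From the maximum point `x₀` of `H/u`, `H(x) ≤ (H₀/u₀) u(x)`. The bound on `Hρ` there, `u₀ ≥ cρ₀`
and the bounds on `ρ` do the rest. -/
theorem mean_curvature_le (h : ContMDiff (𝓡 n) 𝓘(ℝ, ℝ) 4 ρ) (hρ : ∀ x, 0 < ρ x)
    (hf : ContMDiff (𝓡 n) 𝓘(ℝ, ℝ) 2 f) {k : ℕ} (hkn : k + 2 < n)
    (hadm : ∀ x, ∀ j ≤ k + 2, 0 < sigmaCurv j ρ x) (hsol : SolvesCurvatureEq (k + 2) f ρ)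
    {m Λ c r R : ℝ} (hm : 0 < m) (hfm : ∀ x, m ≤ f x) (hf0 : ∀ x, |f x| ≤ Λ)
    (hf1 : ∀ x, ‖sphGrad f x‖ ≤ Λ) (hf2 : ∀ x, ‖sphHess f x‖ ≤ Λ) (hc : 0 < c)
    (hcu : ∀ x, c ≤ supportFn ρ x / ρ x) (hr : 0 < r) (hrρ : ∀ x, r ≤ ρ x) (hR : ∀ x, ρ x ≤ R)
    (x : Sph n) :
    sigmaCurv 1 ρ x ≤ (n * (n * ((n + 2) * Λ) ^ 2 / m + n * ((n + 4) ^ 2 * Λ) +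
      n * ((n + 2) * Λ) + n * Λ) / (m * c) + 1) * R / (r ^ 2 * c) := by
  have h1 : ContMDiff (𝓡 n) 𝓘(ℝ, ℝ) 1 ρ := h.of_le (by norm_num)
  have hcont : Continuous fun x => sigmaCurv 1 ρ x / supportFn ρ x :=
    (continuous_sigmaCurv h hρ (by lia)).div (continuous_supportFn h1 hρ)
      fun x => (supportFn_pos hρ x).ne'
  obtain ⟨x₀, hmax⟩ := exists_forall_le_of_continuous hcont x
  obtain ⟨G⟩ := exists_principalFrame h hρ x₀
  have hG := G.inGarding hkn.le (hadm x₀)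
  have hle := G.mean_curvature_mul_radius_le hρ hf hkn.le hG hsol hm (hfm x₀) (hf0 x₀) (hf1 x₀)
    (hf2 x₀) hc (hcu x₀) hmax
  set B := n * (n * ((n + 2) * Λ) ^ 2 / m + n * ((n + 4) ^ 2 * Λ) +
      n * ((n + 2) * Λ) + n * Λ) / (m * c) + 1 with hB
  have hρ0 := hρ x₀
  have hu := supportFn_pos hρ x
  have hu0 := supportFn_pos hρ x₀
  have hHpos : 0 < sigmaCurv 1 ρ x₀ := hadm x₀ 1 (by lia)
  have hB0 : 0 < B := (mul_pos hHpos hρ0).trans_le hle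
  have hux : supportFn ρ x ≤ R := (supportFn_le hρ x).trans (hR x)
  have h2 := (div_le_iff₀ hu).1 (hmax x)
  have h3 : sigmaCurv 1 ρ x₀ ≤ B / ρ x₀ := (le_div_iff₀ hρ0).2 hle
  have h4 : c * ρ x₀ ≤ supportFn ρ x₀ := (le_div_iff₀ hρ0).1 (hcu x₀)
  refine h2.trans ?_
  calc sigmaCurv 1 ρ x₀ / supportFn ρ x₀ * supportFn ρ x
      ≤ B / ρ x₀ / (c * ρ x₀) * R := by gcongr
    _ = B * R / (ρ x₀ ^ 2 * c) := by field_simp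
    _ ≤ B * R / (r ^ 2 * c) := by
        have hR0 : 0 < R := hρ0.trans_le (hR x₀)
        have := hrρ x₀
        gcongr

end APriori

theorem lemma3p4 (n k : ℕ) (hk : 2 ≤ k) (hkn : k < n) (m Λ₁ Λ₂ : ℝ) (hm : 0 < m) :
    ∃ C : ℝ, ∀ f ρ : Sph n → ℝ,
      ContMDiff (𝓡 n) 𝓘(ℝ, ℝ) 2 f →
      (∀ x, m ≤ f x) → c1Norm f ≤ Λ₁ → c2Norm f ≤ Λ₂ →
      ContMDiff (𝓡 n) 𝓘(ℝ, ℝ) 4 ρ →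
      (∀ x, 0 < ρ x) →
      SolvesCurvatureEq k f ρ →
      (∀ x, sigmaCurv 1 ρ x ≤ C) ∧ (∀ x, ‖sphHess ρ x‖ ≤ C) := by
  -- The order of the equation is `k + 2` from here on.
  obtain ⟨k, rfl⟩ := Nat.exists_eq_add_of_le' hk
  -- The constants bound, in turn, `u/ρ` from below, `ρ` from below, `ρ` from above and `H` from
  -- above.
  set c := m / ((n + k + 3) * Λ₂) with hc
  set r := min 1 (m / n ^ (k + 2)) with hr
  set R := max 1 Λ₂ with hR
  set A := (n * (n * ((n + 2) * Λ₂) ^ 2 / m + n * ((n + 4) ^ 2 * Λ₂) +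
      n * ((n + 2) * Λ₂) + n * Λ₂) / (m * c) + 1) * R / (r ^ 2 * c) with hA
  refine ⟨max A (R * (1 + R * A + 1 / c ^ 2 + A * (R / c)) * (1 + 1 / c) ^ 2 +
      2 * (1 / c * (R / c))), fun f ρ hf hfm _ hf2 h hρ hsol => ?_⟩
  have hbd := fun x => bounds_of_c2Norm_le hf hf2 x
  have hpos : ∀ x, 0 < sigmaCurv (k + 2) ρ x := fun x => by
    rw [hsol.eq_mul hρ]
    exact mul_pos (div_pos (hm.trans_le (hfm x)) (pow_pos (hρ x) _)) (supportFn_pos hρ x)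
  have hadm := sigmaCurv_pos_of_sigmaCurv_pos h hρ (by lia) hkn.le hpos
  have hn : (0 : ℝ) < n := by exact_mod_cast (by lia : 0 < n)
  have hr0 : 0 < r := by positivity
  have hrρ := le_radius h hρ (by lia) hkn hsol hfm hadm
  have hRρ := radius_le h hρ (by lia) hkn hsol fun x => (le_abs_self _).trans (hbd x).1
  have key : ∀ x, sigmaCurv 1 ρ x ≤ A ∧ ‖sphHess ρ x‖ ≤
      R * (1 + R * A + 1 / c ^ 2 + A * (R / c)) * (1 + 1 / c) ^ 2 + 2 * (1 / c * (R / c)) := by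
    intro x
    -- Positivity of `Λ₂`, hence of `c`, follows only once some `f` satisfies the bounds; otherwise
    -- the constants are arbitrary and the claim is vacuous.
    have hΛ : 0 < Λ₂ := hm.trans_le ((hfm x).trans ((le_abs_self _).trans (hbd x).1))
    have hc0 : 0 < c := by positivity
    have hcu := support_lower_bound h hρ hf hkn hadm hsol hm hfm (fun x => (hbd x).1)
      fun x => (hbd x).2.1
    have hH := mean_curvature_le h hρ hf hkn hadm hsol hm hfm (fun x => (hbd x).1)
      (fun x => (hbd x).2.1) (fun x => (hbd x).2.2) hc0 hcu hr0 hrρ hRρ x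
    obtain ⟨G⟩ := exists_principalFrame h hρ x
    exact ⟨hH, G.norm_sphHess_le (h.of_le (by norm_num)) hρ hc0 (hcu x) (hRρ x)
      (fun l => (G.abs_κ_le hkn.le (G.inGarding hkn.le (hadm x)) l).trans hH)
      ((hadm x 1 (by lia)).le.trans hH)⟩
  exact ⟨fun x => (key x).1.trans (le_max_left _ _), fun x => (key x).2.trans (le_max_right _ _)⟩
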